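/- **Setting.** Let $d\ge 1$. Let $\omega_k$ be the volume of the unit ball of $\mathbb R^k$ ($\omega_0=1$), $|B_\rho|=\omega_d\rho^d$, $|\partial B_\rho|=d\,\omega_d\rho^{d-1}$, and $H_q=\int_0^1\frac{1-t^q}{1-t}\,dt$ for $q\ge 0$. For a measurable $u:\mathbb R^d\to\{0,1\}$ let $$C_u(z)=\lim_{R\to\infty}\frac{1}{(2R)^d}\int_{[-R,R]^d}u(x+z)u(x)\,dx,\qquad \mathcal E(u)=\int_{\mathbb R^d}\frac{C_u(z)-C_u(0)-z\cdot\nabla C_u(0)\,\chi_{B_1}(z)}{|z|^{d+1}}\,dz,$$ where $z\cdot\nabla C_u(0)$ denotes the one-sided directional derivative $\frac{d}{dt}C_u(tz)\big|_{t=0+}$. With $(a)_n=a(a+1)\cdots(a+n-1)$ put $$\mathcal H_d(t)=F_4\big(\tfrac32,\tfrac{d+1}2;\tfrac{d+2}2,\tfrac{d+2}2;t,t\big)=\sum_{m,n\ge 0}\frac{(\frac32)_{m+n}(\frac{d+1}2)_{m+n}}{(\frac{d+2}2)_m(\frac{d+2}2)_n\,m!\,n!}\,t^{m+n}.$$ A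 Bravais lattice is $\Lambda=\mathbb Zv_1\oplus\dots\oplus\mathbb Zv_d$ with linearly independent $v_i\in\mathbb R^d$, and $|\Lambda|$ is the volume of its cell $[0,1]v_1\oplus\dots\oplus[0,1]v_d$. A radius $\rho$ is called admissible for $\Lambda$ if $0<\rho\le\frac12\min\{|p-q|:p,q\in\Lambda,\ p\ne q\}$, and then $u_{\Lambda,\rho}$ denotes the characteristic function of $\bigcup_{q\in\Lambda}B_\rho(q)$. **Lemma 4.4.** (i) Let $\Lambda$ be a Bravais lattice and $\rho$ an admissible radius. Then $u=u_{\Lambda,\rho}$ is $\Lambda$-periodic, and all limits and integrals in the definition of $\mathcal E(u)$ exist and are finite. If $d\ge 2$, or if $d=1$ and $\rho<\frac12\min\{|p-q|:p\ne q\in\Lambda\}$, then $$\mathcal E(u)=-\omega_{d-1}\Big(\ln(2\rho)+1-\tfrac12H_{\frac{d-1}2}\Big)\frac{|\partial B_\rho|}{|\Lambda|}+I_\Lambda|B_\rho|^2,\qquad I_\Lambda=\frac1{|\Lambda|}\sum_{q\in\Lambda\setminus\{0\}}\frac{\mathcal H_d(\rho^2/|q|^2)}{|q|^{d+1}},$$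 where all the series converge. (ii) There is a constant $C$, depending only on $d$, such that the following holds for every Bravais lattice $\Lambda_0$ with $|\Lambda_0|=1$. The sum $\sum_{e\in\Lambda_0\setminus\{0\}}|e|^{-(d+1)}$ converges, and there is a largest number $\lambda_0=\lambda_0(\Lambda_0)$ among the volume fractions $|B_\rho|/|\Lambda_0|$ with $\rho$ admissible for $\Lambda_0$. For $0<\lambda\le\lambda_0$ the energy $\mathcal E(u_{a\Lambda_0,\rho})$ attains a minimum $e_{B,\Lambda_0}(\lambda)$ among all $a>0$ and all $\rho$ that are admissible for $a\Lambda_0$ and satisfy $|B_\rho|/|a\Lambda_0|=\lambda$, and $$\Big|e_{B,\Lambda_0}(\lambda)+2\omega_{d-1}\,d\,e^{-\frac12H_{(d-1)/2}}\,\lambda\Big|\le C\,\lambda^{2+\frac1d}\sum_{e\in\Lambda_0\setminus\{0\}}\frac1{|e|^{d+1}}.$$ For $0<\lambda<\lambda_0$ the radius $\rho_{\rm opt}(\lambda)$ of the minimizing configuration is unique, and $\rho_{\rm opt}(\lambda)=\frac12e^{\frac12H_{(d-1)/2}}+o(1)$ as $\lambda\to0$. -/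

import Mathlib

open MeasureTheory Filter Topology

noncomputable section

/-! ### Autocorrelation function and limit energy of a general configuration -/

/-- The cube `[-R, R]^d`. -/
def cube (d : ℕ) (R : ℝ) : Set (EuclideanSpace ℝ (Fin d)) := {x | ∀ i, |x i| ≤ R}

/-- The average of `x ↦ u (x + z) u (x)` over the cube `[-R, R]^d`. -/
def cubeCorrelation {d : ℕ} (u : EuclideanSpace ℝ (Fin d) → ℝ)
    (z : EuclideanSpace ℝ (Fin d)) (R : ℝ) : ℝ :=
  ⨍ x in cube d R, u (x + z) * u x

/-- The autocorrelation function `C_u(z) = lim_{R → ∞} ⨍_{[-R,R]^d} u(x+z) u(x) dx`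
(meaningful if the limit exists, see `EnergyWellDefined`). -/
def autocorr {d : ℕ} (u : EuclideanSpace ℝ (Fin d) → ℝ) (z : EuclideanSpace ℝ (Fin d)) : ℝ :=
  limUnder atTop (cubeCorrelation u z)

/-- The term `z · ∇C(0)`. The function `C = C_u` is even and has a kink at the origin, so this is the
one-sided directional derivative of `C` at `0` in direction `z`, i.e. `d/dt C(t z)` at `t = 0+`. -/
def dirDerivZero {d : ℕ} (C : EuclideanSpace ℝ (Fin d) → ℝ) (z : EuclideanSpace ℝ (Fin d)) : ℝ :=
  derivWithin (fun t : ℝ => C (t • z)) (Set.Ici 0) 0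

open Classical in
/-- The integrand
`(C_u(z) - C_u(0) - z · ∇C_u(0) χ_{B_1}(z)) / |z| * K(|z|)` of the limit energy. -/
def energyIntegrand {d : ℕ} (K : ℝ → ℝ) (u : EuclideanSpace ℝ (Fin d) → ℝ)
    (z : EuclideanSpace ℝ (Fin d)) : ℝ :=
  (autocorr u z - autocorr u 0 - (if ‖z‖ < 1 then dirDerivZero (autocorr u) z else 0)) / ‖z‖ * K ‖z‖

/-- The limit energy of a configuration `u`, for the kernel `K`. -/
def limitEnergy {d : ℕ} (K : ℝ → ℝ) (u : EuclideanSpace ℝ (Fin d) → ℝ) : ℝ :=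
  ∫ z, energyIntegrand K u z

/-- All the limits and integrals in the definition of `limitEnergy K u` exist, and the energy is
finite. -/
structure EnergyWellDefined {d : ℕ} (K : ℝ → ℝ) (u : EuclideanSpace ℝ (Fin d) → ℝ) : Prop where
  measurable : Measurable u
  autocorr_exists : ∀ z, ∃ c : ℝ, Tendsto (cubeCorrelation u z) atTop (𝓝 c)
  dirDeriv_exists : ∀ z, DifferentiableWithinAt ℝ (fun t : ℝ => autocorr u (t • z)) (Set.Ici 0) 0
  integrable : Integrable (energyIntegrand K u)

/-- The prototypical kernel `r ↦ r^{-d}`. -/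
def kernelOne (d : ℕ) (r : ℝ) : ℝ := (r ^ d)⁻¹

/-! ### Constants and special functions -/

/-- `|B_ρ|`, the volume of a ball of radius `ρ` in `ℝ^d`. -/
def ballVol (d : ℕ) (ρ : ℝ) : ℝ := volume.real (Metric.ball (0 : EuclideanSpace ℝ (Fin d)) ρ)

/-- `ω_d`, the volume of the unit ball in `ℝ^d`. -/
def unitBallVol (d : ℕ) : ℝ := ballVol d 1

/-- `|∂B_ρ|`, the area of the sphere of radius `ρ` in `ℝ^d`, where the unit sphere has
area `σ_{d-1} = d ω_d`. -/
def sphereArea (d : ℕ) (ρ : ℝ) : ℝ := d * unitBallVol d * ρ ^ (d - 1)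

/-- The generalized harmonic number `H_q = ∫_0^1 (1 - t^q) / (1 - t) dt`. -/
def genHarmonic (q : ℝ) : ℝ := ∫ t in (0 : ℝ)..1, (1 - t ^ q) / (1 - t)

/-- The Pochhammer symbol `(a)_n = a (a + 1) ⋯ (a + n - 1)`. -/
def pochhammer (a : ℝ) (n : ℕ) : ℝ := (ascPochhammer ℝ n).eval a

/-- The terms of the Appell series `F_4(a, b; c, c'; x, y)`. -/
def appellF4Term (a b c c' x y : ℝ) (p : ℕ × ℕ) : ℝ :=
  pochhammer a (p.1 + p.2) * pochhammer b (p.1 + p.2) /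
    (pochhammer c p.1 * pochhammer c' p.2 * (p.1.factorial : ℝ) * (p.2.factorial : ℝ)) *
      x ^ p.1 * y ^ p.2

/-- The terms of the series that defines `𝓗_d(t)`. -/
def appellHTerm (d : ℕ) (t : ℝ) : ℕ × ℕ → ℝ :=
  appellF4Term (3 / 2) (((d : ℝ) + 1) / 2) (((d : ℝ) + 2) / 2) (((d : ℝ) + 2) / 2) t t

/-- `𝓗_d(t) = F_4(3/2, (d+1)/2; (d+2)/2, (d+2)/2; t, t)`. -/
def appellH (d : ℕ) (t : ℝ) : ℝ := ∑' p : ℕ × ℕ, appellHTerm d t p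

/-! ### Lattices of balls -/

/-- The Bravais lattice `Λ = ℤ v_1 ⊕ ⋯ ⊕ ℤ v_d`. -/
def bravais {d : ℕ} (v : Fin d → EuclideanSpace ℝ (Fin d)) :
    Submodule ℤ (EuclideanSpace ℝ (Fin d)) :=
  Submodule.span ℤ (Set.range v)

/-- The set `Λ \ {0}`. -/
def bravaisNonzero {d : ℕ} (v : Fin d → EuclideanSpace ℝ (Fin d)) :
    Set (EuclideanSpace ℝ (Fin d)) :=
  {q | q ∈ bravais v ∧ q ≠ 0}

/-- `|Λ|`, the volume of the periodicity cell `[0,1] v_1 ⊕ ⋯ ⊕ [0,1] v_d`. -/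
def cellVol {d : ℕ} (v : Fin d → EuclideanSpace ℝ (Fin d)) : ℝ :=
  volume.real (parallelepiped v)

/-- The characteristic function of `Ω = ⋃_{q ∈ Λ} B_ρ(q)`. -/
def latticeBalls {d : ℕ} (v : Fin d → EuclideanSpace ℝ (Fin d)) (ρ : ℝ) :
    EuclideanSpace ℝ (Fin d) → ℝ :=
  Set.indicator (⋃ q ∈ bravais v, Metric.ball q ρ) (fun _ => 1)

/-- The condition `0 < ρ ≤ (1/2) min {dist(p, q) : p, q ∈ Λ, p ≠ q}`: the balls of radius `ρ` centred
on `Λ` do not overlap (they may touch). -/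
def BallsFit {d : ℕ} (v : Fin d → EuclideanSpace ℝ (Fin d)) (ρ : ℝ) : Prop :=
  0 < ρ ∧ ∀ p ∈ bravais v, ∀ q ∈ bravais v, p ≠ q → ρ ≤ 1 / 2 * dist p q

/-- The terms of the lattice sum in `I_Λ`. -/
def latticeTerm {d : ℕ} (v : Fin d → EuclideanSpace ℝ (Fin d)) (ρ : ℝ) (q : bravaisNonzero v) : ℝ :=
  appellH d (ρ ^ 2 / ‖(q : EuclideanSpace ℝ (Fin d))‖ ^ 2) /
    ‖(q : EuclideanSpace ℝ (Fin d))‖ ^ (d + 1)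

/-- `I_Λ = |Λ|⁻¹ ∑_{q ∈ Λ \ {0}} 𝓗_d(ρ² / |q|²) / |q|^{d+1}`. -/
def latticeInteraction {d : ℕ} (v : Fin d → EuclideanSpace ℝ (Fin d)) (ρ : ℝ) : ℝ :=
  1 / cellVol v * ∑' q : bravaisNonzero v, latticeTerm v ρ q

/-- The terms of the lattice sum `∑_{e ∈ Λ \ {0}} |e|^{-(d+1)}`. -/
def zetaTerm {d : ℕ} (v : Fin d → EuclideanSpace ℝ (Fin d)) (e : bravaisNonzero v) : ℝ :=
  1 / ‖(e : EuclideanSpace ℝ (Fin d))‖ ^ (d + 1)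

/-! ### Minimization over dilations of a lattice at fixed volume fraction -/

/-- The volume fractions `|B_ρ| / |Λ|` that can be realized by non-overlapping balls centred
on `Λ`. -/
def volumeFractions {d : ℕ} (v : Fin d → EuclideanSpace ℝ (Fin d)) : Set ℝ :=
  {lam | ∃ ρ, BallsFit v ρ ∧ lam = ballVol d ρ / cellVol v}

/-- Non-overlapping balls of radius `ρ` on the lattice `a Λ₀` (spanned by `a v_1, …, a v_d`) with
volume fraction `lam`. -/
def IsConfig {d : ℕ} (v : Fin d → EuclideanSpace ℝ (Fin d)) (lam a ρ : ℝ) : Prop :=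
  0 < a ∧ BallsFit (a • v) ρ ∧ lam = ballVol d ρ / cellVol (a • v)

/-- The energies, for the kernel `r^{-d}`, of the balls on the lattices `a Λ₀`, `a > 0`, with volume
fraction `lam`. -/
def dilationEnergies {d : ℕ} (v : Fin d → EuclideanSpace ℝ (Fin d)) (lam : ℝ) : Set ℝ :=
  {E | ∃ a ρ, IsConfig v lam a ρ ∧ E = limitEnergy (kernelOne d) (latticeBalls (a • v) ρ)}

/-- `e_{B,Λ₀}(lam)`, the minimal energy among the lattices `a Λ₀` for prescribed volume
fraction. -/
def eBall {d : ℕ} (v : Fin d → EuclideanSpace ℝ (Fin d)) (lam : ℝ) : ℝ :=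
  sInf (dilationEnergies v lam)

/-- `ρ` is the radius of a ball configuration of minimal energy among the lattices `a Λ₀`, for
prescribed volume fraction `lam`. -/
def IsOptimalRadius {d : ℕ} (v : Fin d → EuclideanSpace ℝ (Fin d)) (lam ρ : ℝ) : Prop :=
  ∃ a, IsConfig v lam a ρ ∧
    IsLeast (dilationEnergies v lam) (limitEnergy (kernelOne d) (latticeBalls (a • v) ρ))

end

noncomputable section

open scoped ENNReal RealInnerProductSpace Pointwise

/-! ### Slicing and polar coordinates -/

/-! Averaging over a period cell turns the autocorrelation into `|B_ρ ∩ (Ω - z)| / |Λ|`. Since the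
balls are disjoint, this is the overlap of `B_ρ` with its own translate plus the overlaps with the
translates belonging to nonzero lattice points (`autocorr_latticeBalls`, `neighbourOverlap_facts`).
The first part falls off linearly in `|z|` with slope `ω_{d-1} ρ^{d-1}`. The second is
`O(|z|^{3/2})` at the origin, even for touching balls if `d ≥ 2`, and vanishes there on the line if
the intervals keep a gap (`neighbourOverlap_le_near_zero`). Hence the kink of `C_u` comes from a
single ball, and the energy splits into a self-energy and an interaction.

The self-energy is a radial integral (`integral_selfIntegrand`). The lens `B_ρ ∩ B_ρ(z)` consists of
two congruent caps, so the overlap is explicit. Integration by parts and the substitution `w = (s /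
2ρ)²` produce the harmonic number, and moving the cutoff from `2ρ` to `1` produces the logarithm.

The interaction with the ball at `q` is the double integral of `|q + x + y|^{-(d+1)}` over `B_ρ ×
B_ρ` (`lintegral_ballOverlap_div`). The mean of `|q + x|^{-2l}` over a ball is found by symmetrizing
in `x`, expanding in even powers of `⟪q, x⟫`, inserting the spherical moments
(`lintegral_inner_pow_mul_radial`), and resumming with a quadratic transformation of the Gauss
function (`quadratic_transformation`). Applied in `y` and then in `x`, the formula gives the Appell
series. All terms are nonnegative, so sums and integrals are exchanged in `[0, ∞]`, and convergence
of every series follows from integrability of the neighbour part.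

For dilations of a unit-volume lattice, the volume fraction fixes the ratio `s` of the radius to the
dilation factor. With `α = ω_{d-1} d` the energy is then the volume fraction times `(κ - α (log 2ρ +
1 - h/2)) / ρ`, where `κ` depends on `s` only. This has the unique minimizer `½ e^{h/2} e^{κ/α}` and
the minimum `-2α e^{-h/2} e^{-κ/α}` (`isLeast_dilationEnergies`). The relative error `1 - e^{-κ/α}`
is at most `min(1, κ/α)`. The bound by `κ/α` handles small balls, while for large balls the shortest
vector already makes the lattice sum large enough for the bound by `1` (`energy_error_le`). Touching
intervals on the line fill it up to a null set and have energy zero; they are treated separately. -/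

lemma exists_isometryEquiv_map_eq {E : Type*} [NormedAddCommGroup E] [InnerProductSpace ℝ E]
    {u w : E} (h : ‖u‖ = ‖w‖) : ∃ R : E ≃ₗᵢ[ℝ] E, R u = w :=
  ⟨_, Submodule.reflection_sub h⟩

lemma lintegral_euclidean_succ {n : ℕ} {F : ℝ × EuclideanSpace ℝ (Fin n) → ℝ≥0∞}
    (hF : Measurable F) :
    ∫⁻ x : EuclideanSpace ℝ (Fin (n + 1)), F (x 0, WithLp.toLp 2 (fun i : Fin n => x i.succ)) =
      ∫⁻ s : ℝ, ∫⁻ y : EuclideanSpace ℝ (Fin n), F (s, y) := by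
  have h1 := PiLp.volume_preserving_ofLp (Fin (n + 1))
  have h2 := volume_preserving_piFinSuccAbove (fun _ : Fin (n + 1) => ℝ) 0
  have h3 : MeasurePreserving (Prod.map id (WithLp.toLp 2) :
      ℝ × (Fin n → ℝ) → ℝ × EuclideanSpace ℝ (Fin n)) :=
    (MeasurePreserving.id volume).prod (PiLp.volume_preserving_toLp (Fin n))
  have h4 := (h3.comp h2).comp h1
  rw [← lintegral_prod F hF.aemeasurable, ← Measure.volume_eq_prod, ← h4.lintegral_comp hF]
  rfl

/-- Rotating `u` to the first coordinate vector and slicing perpendicular to it reduces the integral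
to Fubini. This serves both the Gaussian moments and the volumes of caps. -/
lemma lintegral_inner_normSq {n : ℕ} {u : EuclideanSpace ℝ (Fin (n + 1))} (hu : ‖u‖ = 1)
    {F : ℝ × ℝ → ℝ≥0∞} (hF : Measurable F) :
    ∫⁻ x : EuclideanSpace ℝ (Fin (n + 1)), F (⟪u, x⟫, ‖x‖ ^ 2) =
      ∫⁻ s : ℝ, ∫⁻ y : EuclideanSpace ℝ (Fin n), F (s, s ^ 2 + ‖y‖ ^ 2) := by
  obtain ⟨R, hR⟩ := exists_isometryEquiv_map_eq
    (w := (EuclideanSpace.single 0 1 : EuclideanSpace ℝ (Fin (n + 1)))) (u := u) (by simp [hu])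
  have hmeas : Measurable fun p : ℝ × EuclideanSpace ℝ (Fin n) =>
      F (p.1, p.1 ^ 2 + ‖p.2‖ ^ 2) := hF.comp (by fun_prop)
  rw [← lintegral_euclidean_succ hmeas]
  have key := R.measurePreserving.lintegral_comp_emb R.toHomeomorph.measurableEmbedding
    (fun x => F (x 0, x 0 ^ 2 + ‖(WithLp.toLp 2 (fun i : Fin n => x i.succ) :
      EuclideanSpace ℝ (Fin n))‖ ^ 2))
  rw [← key]
  refine lintegral_congr fun x => ?_
  have h0 : R x 0 = ⟪u, x⟫ := by
    rw [← R.inner_map_map, hR, EuclideanSpace.inner_single_left]; simp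
  have h1 : ‖x‖ ^ 2 = R x 0 ^ 2 + ‖(WithLp.toLp 2 (fun i : Fin n => R x i.succ) :
      EuclideanSpace ℝ (Fin n))‖ ^ 2 := by
    rw [← R.norm_map x, EuclideanSpace.real_norm_sq_eq, EuclideanSpace.real_norm_sq_eq,
      Fin.sum_univ_succ]
  rw [h1, h0]

/-- Homogeneity of `P` separates the angular from the radial variable. The angular factor stays
unevaluated: later it is only compared between two choices of `P`. -/
lemma lintegral_polar {E : Type*} [NormedAddCommGroup E] [NormedSpace ℝ E] [MeasurableSpace E]
    [BorelSpace E] [FiniteDimensional ℝ E] [Nontrivial E] (μ : Measure E) [μ.IsAddHaarMeasure]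
    {P : E → ℝ≥0∞} (hP : Measurable P) {k : ℕ}
    (hhom : ∀ r : ℝ, 0 < r → ∀ x, P (r • x) = ENNReal.ofReal (r ^ k) * P x)
    {g : ℝ → ℝ≥0∞} (hg : Measurable g) :
    ∫⁻ x, P x * g ‖x‖ ∂μ = (∫⁻ ω, P (ω : E) ∂μ.toSphere) *
      ∫⁻ r : Set.Ioi (0 : ℝ), ENNReal.ofReal ((r : ℝ) ^ k) * g r
        ∂(Measure.volumeIoiPow (Module.finrank ℝ E - 1)) := by
  have h := μ.measurePreserving_homeomorphUnitSphereProd.lintegral_comp_emb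
    (Homeomorph.measurableEmbedding _)
    (fun p : Metric.sphere (0 : E) 1 × Set.Ioi (0 : ℝ) =>
      P (p.1 : E) * (ENNReal.ofReal ((p.2 : ℝ) ^ k) * g p.2))
  rw [lintegral_prod_mul (μ := μ.toSphere) (f := fun ω => P (ω : E))
    (g := fun r : Set.Ioi (0 : ℝ) => ENNReal.ofReal ((r : ℝ) ^ k) * g r)
    (hP.comp measurable_subtype_coe).aemeasurable
    (by exact (by fun_prop : Measurable fun r : Set.Ioi (0 : ℝ) =>
      ENNReal.ofReal ((r : ℝ) ^ k) * g r).aemeasurable)] at h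
  rw [← h]
  conv_lhs => rw [← restrict_compl_singleton (μ := μ) 0,
    ← lintegral_subtype_comap (measurableSet_singleton _).compl]
  refine lintegral_congr fun x => ?_
  have hx : 0 < ‖(x : E)‖ := norm_pos_iff.2 x.2
  have hxe : (x : E) = ‖(x : E)‖ • ((homeomorphUnitSphereProd E x).1 : E) := by
    simp [smul_smul, hx.ne']
  have hPx : P (x : E) = ENNReal.ofReal (‖(x : E)‖ ^ k) *
      P ((homeomorphUnitSphereProd E x).1 : E) := by
    conv_lhs => rw [hxe, hhom _ hx]
  rw [hPx, homeomorphUnitSphereProd_apply_snd_coe]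
  ring

/-! ### Moments of linear forms against radial weights -/

lemma Gamma_add_natCast_eq_pochhammer {s : ℝ} (hs : 0 < s) (j : ℕ) :
    Real.Gamma (s + j) = pochhammer s j * Real.Gamma s := by
  induction j with
  | zero => simp [pochhammer]
  | succ j ih =>
    rw [Nat.cast_succ, ← add_assoc, Real.Gamma_add_one (by positivity), ih]
    simp only [pochhammer, ascPochhammer_succ_eval]
    ring

lemma lintegral_pow_mul_exp_neg_sq (m : ℕ) :
    ∫⁻ r in Set.Ioi (0 : ℝ), ENNReal.ofReal (r ^ m * Real.exp (-r ^ 2)) =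
      ENNReal.ofReal (1 / 2 * Real.Gamma (((m : ℝ) + 1) / 2)) := by
  have h := integral_rpow_mul_exp_neg_rpow (p := 2) (q := m) (by norm_num)
    (by have := Nat.cast_nonneg (α := ℝ) m; linarith)
  have hi := integrableOn_rpow_mul_exp_neg_rpow (p := 2) (s := m)
    (by have := Nat.cast_nonneg (α := ℝ) m; linarith) (by norm_num)
  have e : ∀ r ∈ Set.Ioi (0 : ℝ), r ^ (m : ℝ) * Real.exp (-r ^ (2 : ℝ)) =
      r ^ m * Real.exp (-r ^ 2) := by
    intro r _
    rw [Real.rpow_natCast]; norm_cast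
  rw [← h, setIntegral_congr_fun measurableSet_Ioi e, ofReal_integral_eq_lintegral_ofReal]
  · exact (integrableOn_congr_fun e measurableSet_Ioi).1 hi
  · filter_upwards [ae_restrict_mem measurableSet_Ioi] with r hr
    have : (0 : ℝ) < r := hr
    positivity

lemma lintegral_even_pow_mul_exp_neg_sq (j : ℕ) :
    ∫⁻ r : ℝ, ENNReal.ofReal (r ^ (2 * j) * Real.exp (-r ^ 2)) =
      ENNReal.ofReal (Real.Gamma (1 / 2 + j)) := by
  have h1 : ∫⁻ r in Set.Iic (0 : ℝ), ENNReal.ofReal (r ^ (2 * j) * Real.exp (-r ^ 2)) =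
      ∫⁻ r in Set.Ioi (0 : ℝ), ENNReal.ofReal (r ^ (2 * j) * Real.exp (-r ^ 2)) := by
    have := (Measure.measurePreserving_neg (volume : Measure ℝ)).setLIntegral_comp_preimage_emb
      (MeasurableEquiv.neg ℝ).measurableEmbedding
      (fun r => ENNReal.ofReal (r ^ (2 * j) * Real.exp (-r ^ 2))) (Set.Ici 0)
    rw [← setLIntegral_congr (Ioi_ae_eq_Ici (a := (0 : ℝ)))] at this
    rw [← this]
    simp [pow_mul]
  have h2 := lintegral_add_compl (μ := volume)
    (fun r : ℝ => ENNReal.ofReal (r ^ (2 * j) * Real.exp (-r ^ 2))) (measurableSet_Iic (a := (0 : ℝ)))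
  rw [Set.compl_Iic, h1, lintegral_pow_mul_exp_neg_sq] at h2
  have hG : 0 < Real.Gamma ((((2 * j : ℕ) : ℝ) + 1) / 2) := Real.Gamma_pos_of_pos (by positivity)
  rw [← h2, ← ENNReal.ofReal_add (by positivity) (by positivity)]
  congr 1
  rw [show ((((2 * j : ℕ) : ℝ) + 1) / 2) = 1 / 2 + j by push_cast; ring]
  ring

/-- The Gaussian integral over a Euclidean space is positive and finite. -/
lemma lintegral_exp_neg_normSq (n : ℕ) :
    0 < ∫⁻ y : EuclideanSpace ℝ (Fin n), ENNReal.ofReal (Real.exp (-‖y‖ ^ 2)) ∧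
    ∫⁻ y : EuclideanSpace ℝ (Fin n), ENNReal.ofReal (Real.exp (-‖y‖ ^ 2)) < ∞ := by
  constructor
  · rw [lintegral_pos_iff_support (by fun_prop)]
    have : (Function.support fun y : EuclideanSpace ℝ (Fin n) =>
        ENNReal.ofReal (Real.exp (-‖y‖ ^ 2))) = Set.univ := by
      ext y; simp [Real.exp_pos]
    rw [this]
    exact (isOpen_univ.measure_pos _ ⟨0, trivial⟩)
  · have h : Integrable (fun y : EuclideanSpace ℝ (Fin n) => Real.exp (-‖y‖ ^ 2)) := by
      have := (GaussianFourier.integrable_cexp_neg_mul_sq_norm_add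
        (V := EuclideanSpace ℝ (Fin n)) (b := 1) (by simp) 0 0).norm
      refine this.congr (Eventually.of_forall fun y => ?_)
      simp only [Complex.norm_exp]
      congr 1
      norm_cast
      simp
    exact h.lintegral_lt_top

lemma pochhammer_pos {a : ℝ} (ha : 0 < a) (n : ℕ) : 0 < pochhammer a n :=
  ascPochhammer_pos n a ha

lemma lintegral_volumeIoiPow (n : ℕ) {f : ℝ → ℝ≥0∞} (hf : Measurable f) :
    ∫⁻ r : Set.Ioi (0 : ℝ), f r ∂(Measure.volumeIoiPow n) =
      ∫⁻ r in Set.Ioi (0 : ℝ), ENNReal.ofReal (r ^ n) * f r := by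
  rw [Measure.volumeIoiPow, lintegral_withDensity_eq_lintegral_mul _ (by fun_prop) (by fun_prop),
    ← lintegral_subtype_comap measurableSet_Ioi]
  rfl

/-- The Gaussian factorizes along the line through `q` and its orthogonal complement, which leaves a
one-dimensional moment. -/
lemma lintegral_inner_pow_mul_exp_neg_normSq {n : ℕ} {q : EuclideanSpace ℝ (Fin (n + 1))}
    (hq : q ≠ 0) (j : ℕ) :
    ∫⁻ x : EuclideanSpace ℝ (Fin (n + 1)),
        ENNReal.ofReal (⟪q, x⟫ ^ (2 * j)) * ENNReal.ofReal (Real.exp (-‖x‖ ^ 2)) =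
      ENNReal.ofReal (‖q‖ ^ (2 * j)) * (ENNReal.ofReal (Real.Gamma (1 / 2 + j)) *
        ∫⁻ y : EuclideanSpace ℝ (Fin n), ENNReal.ofReal (Real.exp (-‖y‖ ^ 2))) := by
  have hq' : 0 < ‖q‖ := norm_pos_iff.2 hq
  set u := ‖q‖⁻¹ • q with hu
  have hun : ‖u‖ = 1 := by simp [hu, norm_smul, hq]
  have hqu : q = ‖q‖ • u := by simp [hu, smul_smul, hq'.ne']
  have h := lintegral_inner_normSq hun
    (F := fun p => ENNReal.ofReal (p.1 ^ (2 * j)) * ENNReal.ofReal (Real.exp (-p.2))) (by fun_prop)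
  have e1 : ∀ x : EuclideanSpace ℝ (Fin (n + 1)),
      ENNReal.ofReal (⟪q, x⟫ ^ (2 * j)) * ENNReal.ofReal (Real.exp (-‖x‖ ^ 2)) =
      ENNReal.ofReal (‖q‖ ^ (2 * j)) *
        (ENNReal.ofReal (⟪u, x⟫ ^ (2 * j)) * ENNReal.ofReal (Real.exp (-‖x‖ ^ 2))) := by
    intro x
    rw [← mul_assoc, ← ENNReal.ofReal_mul (p := ‖q‖ ^ (2 * j)) (by positivity), ← mul_pow]
    congr 3
    conv_lhs => rw [hqu, real_inner_smul_left]
  simp_rw [e1]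
  rw [lintegral_const_mul _ (by fun_prop), h]
  congr 1
  have e2 : ∀ (s : ℝ) (y : EuclideanSpace ℝ (Fin n)),
      ENNReal.ofReal (s ^ (2 * j)) * ENNReal.ofReal (Real.exp (-(s ^ 2 + ‖y‖ ^ 2))) =
      ENNReal.ofReal (s ^ (2 * j) * Real.exp (-s ^ 2)) *
        ENNReal.ofReal (Real.exp (-‖y‖ ^ 2)) := by
    intro s y
    have : 0 ≤ s ^ (2 * j) := by rw [pow_mul]; positivity
    rw [neg_add, Real.exp_add, ENNReal.ofReal_mul (Real.exp_nonneg _), ENNReal.ofReal_mul this]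
    ring
  simp_rw [e2]
  rw [lintegral_congr fun s => lintegral_const_mul _ (by fun_prop),
    lintegral_mul_const _ (by fun_prop), lintegral_even_pow_mul_exp_neg_sq]

/-- The average of `⟪q, ω⟫^{2j}` over the unit sphere does not depend on the radial weight `g`. It
is therefore enough to determine it for one weight, the Gaussian, where both sides are Gamma
functions. -/
lemma lintegral_inner_pow_mul_radial {d : ℕ} (hd : 1 ≤ d) {q : EuclideanSpace ℝ (Fin d)}
    (hq : q ≠ 0) (j : ℕ) {g : ℝ → ℝ≥0∞} (hg : Measurable g) :
    ∫⁻ x : EuclideanSpace ℝ (Fin d), ENNReal.ofReal (⟪q, x⟫ ^ (2 * j)) * g ‖x‖ =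
      ENNReal.ofReal (‖q‖ ^ (2 * j) * (pochhammer (1 / 2) j / pochhammer ((d : ℝ) / 2) j)) *
        ∫⁻ x : EuclideanSpace ℝ (Fin d), ENNReal.ofReal (‖x‖ ^ (2 * j)) * g ‖x‖ := by
  obtain ⟨n, rfl⟩ : ∃ n, d = n + 1 := ⟨d - 1, by omega⟩
  have hfr : Module.finrank ℝ (EuclideanSpace ℝ (Fin (n + 1))) - 1 = n := by simp
  have hom1 : ∀ r : ℝ, 0 < r → ∀ x : EuclideanSpace ℝ (Fin (n + 1)),
      ENNReal.ofReal (⟪q, r • x⟫ ^ (2 * j)) =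
        ENNReal.ofReal (r ^ (2 * j)) * ENNReal.ofReal (⟪q, x⟫ ^ (2 * j)) := by
    intro r hr x
    rw [← ENNReal.ofReal_mul (by positivity), real_inner_smul_right, mul_pow]
  have hom2 : ∀ r : ℝ, 0 < r → ∀ x : EuclideanSpace ℝ (Fin (n + 1)),
      ENNReal.ofReal (‖r • x‖ ^ (2 * j)) =
        ENNReal.ofReal (r ^ (2 * j)) * ENNReal.ofReal (‖x‖ ^ (2 * j)) := by
    intro r hr x
    rw [← ENNReal.ofReal_mul (by positivity), norm_smul, mul_pow, Real.norm_of_nonneg hr.le]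
  have hom3 : ∀ r : ℝ, 0 < r → ∀ x : EuclideanSpace ℝ (Fin (n + 1)),
      (1 : ℝ≥0∞) = ENNReal.ofReal (r ^ 0) * 1 := by simp
  have p1 := fun {g : ℝ → ℝ≥0∞} (hg : Measurable g) =>
    lintegral_polar (volume : Measure (EuclideanSpace ℝ (Fin (n + 1))))
      (P := fun x => ENNReal.ofReal (⟪q, x⟫ ^ (2 * j))) (by fun_prop) hom1 hg
  have p2 := fun {g : ℝ → ℝ≥0∞} (hg : Measurable g) =>
    lintegral_polar (volume : Measure (EuclideanSpace ℝ (Fin (n + 1))))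
      (P := fun x => ENNReal.ofReal (‖x‖ ^ (2 * j))) (by fun_prop) hom2 hg
  have p3 := fun {g : ℝ → ℝ≥0∞} (hg : Measurable g) =>
    lintegral_polar (volume : Measure (EuclideanSpace ℝ (Fin (n + 1))))
      (P := fun x => 1) (by fun_prop) hom3 hg
  rw [p1 hg, p2 hg, ← mul_assoc]
  congr 1
  have hS : ∫⁻ ω : Metric.sphere (0 : EuclideanSpace ℝ (Fin (n + 1))) 1,
      ENNReal.ofReal (‖(ω : EuclideanSpace ℝ (Fin (n + 1)))‖ ^ (2 * j))
        ∂(volume : Measure (EuclideanSpace ℝ (Fin (n + 1)))).toSphere =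
      ∫⁻ ω : Metric.sphere (0 : EuclideanSpace ℝ (Fin (n + 1))) 1, 1
        ∂(volume : Measure (EuclideanSpace ℝ (Fin (n + 1)))).toSphere :=
    lintegral_congr fun ω => by simp
  rw [hS]
  -- The Gaussian test weight: `q1` yields the angular integral of `⟪q, ω⟫^{2j}`, and `q3`, via the
  -- case `j = 0` in `q4`, the area of the sphere in terms of the same constant `N`.
  have hg0 : Measurable fun r : ℝ => ENNReal.ofReal (Real.exp (-r ^ 2)) := by fun_prop
  have q1 := p1 hg0
  have q3 := p3 hg0
  have q4 := lintegral_inner_pow_mul_exp_neg_normSq hq 0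
  rw [lintegral_inner_pow_mul_exp_neg_normSq hq, lintegral_volumeIoiPow
    (f := fun r => ENNReal.ofReal (r ^ (2 * j)) * ENNReal.ofReal (Real.exp (-r ^ 2))) _
    (by fun_prop), hfr] at q1
  simp only [mul_zero, pow_zero, ENNReal.ofReal_one, one_mul, Nat.cast_zero, add_zero] at q4 q3
  rw [q4, lintegral_volumeIoiPow _ hg0, hfr] at q3
  have c1 : ∀ k : ℕ, ∫⁻ r in Set.Ioi (0 : ℝ), ENNReal.ofReal (r ^ n) * (ENNReal.ofReal (r ^ (2 * k)) *
      ENNReal.ofReal (Real.exp (-r ^ 2))) = ENNReal.ofReal (1 / 2 *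
        (pochhammer (((n + 1 : ℕ) : ℝ) / 2) k * Real.Gamma (((n + 1 : ℕ) : ℝ) / 2))) := by
    intro k
    rw [← Gamma_add_natCast_eq_pochhammer (by positivity), show (((n + 1 : ℕ) : ℝ) / 2 + k) =
      (((n + 2 * k : ℕ) : ℝ) + 1) / 2 by push_cast; ring, ← lintegral_pow_mul_exp_neg_sq]
    refine setLIntegral_congr_fun measurableSet_Ioi fun r hr => ?_
    have : (0 : ℝ) < r := hr
    rw [← ENNReal.ofReal_mul (by positivity), ← ENNReal.ofReal_mul (by positivity), pow_add]
    ring_nf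
  have c2 := c1 0
  simp only [mul_zero, pow_zero, ENNReal.ofReal_one, one_mul] at c2
  rw [c1] at q1
  rw [c2] at q3
  obtain ⟨N0, N1⟩ := lintegral_exp_neg_normSq n
  rw [Gamma_add_natCast_eq_pochhammer (by norm_num)] at q1
  set N := ∫⁻ y : EuclideanSpace ℝ (Fin n), ENNReal.ofReal (Real.exp (-‖y‖ ^ 2))
  set S1 := ∫⁻ ω : Metric.sphere (0 : EuclideanSpace ℝ (Fin (n + 1))) 1, _
    ∂(volume : Measure (EuclideanSpace ℝ (Fin (n + 1)))).toSphere
  set S0 := ∫⁻ ω : Metric.sphere (0 : EuclideanSpace ℝ (Fin (n + 1))) 1, 1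
    ∂(volume : Measure (EuclideanSpace ℝ (Fin (n + 1)))).toSphere
  have hG : 0 < Real.Gamma (((n + 1 : ℕ) : ℝ) / 2) := Real.Gamma_pos_of_pos (by positivity)
  have hG2 : 0 < Real.Gamma (1 / 2) := Real.Gamma_pos_of_pos (by positivity)
  have hp1 := pochhammer_pos (a := 1 / 2) (by norm_num) j
  have hp2 := pochhammer_pos (a := ((n + 1 : ℕ) : ℝ) / 2) (by positivity) j
  set G := Real.Gamma (((n + 1 : ℕ) : ℝ) / 2)
  set a := pochhammer (1 / 2) j
  set b := pochhammer (((n + 1 : ℕ) : ℝ) / 2) j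
  -- The common factor is positive and finite, so it can be cancelled in `[0, ∞]` afterwards.
  have key : S1 * ENNReal.ofReal (b * (1 / 2 * G)) =
      ENNReal.ofReal (‖q‖ ^ (2 * j) * (a / b)) * S0 * ENNReal.ofReal (b * (1 / 2 * G)) := by
    calc S1 * ENNReal.ofReal (b * (1 / 2 * G)) = S1 * ENNReal.ofReal (1 / 2 * (b * G)) := by
          congr 2; ring
      _ = ENNReal.ofReal (‖q‖ ^ (2 * j) * a) * (ENNReal.ofReal (Real.Gamma (1 / 2)) * N) := by
          rw [← q1, ENNReal.ofReal_mul hp1.le, ENNReal.ofReal_mul (by positivity)]; ring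
      _ = ENNReal.ofReal (‖q‖ ^ (2 * j) * a) * (S0 * ENNReal.ofReal (1 / 2 * G)) := by
          rw [q3]; simp [pochhammer]
      _ = _ := by
          rw [show ‖q‖ ^ (2 * j) * a = ‖q‖ ^ (2 * j) * (a / b) * b by field_simp,
            ENNReal.ofReal_mul (by positivity), ENNReal.ofReal_mul hp2.le]
          ring
  exact (ENNReal.mul_left_inj (by simpa using by positivity) ENNReal.ofReal_ne_top).1 key

/-! ### Pochhammer symbols and hypergeometric series -/

@[simp] lemma pochhammer_zero (a : ℝ) : pochhammer a 0 = 1 := by simp [pochhammer]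

lemma pochhammer_succ (a : ℝ) (n : ℕ) : pochhammer a (n + 1) = pochhammer a n * (a + n) := by
  simp [pochhammer, ascPochhammer_succ_eval]

lemma pochhammer_add (a : ℝ) (m n : ℕ) :
    pochhammer a (m + n) = pochhammer a m * pochhammer (a + m) n := by
  induction n with
  | zero => simp
  | succ n ih =>
    rw [← add_assoc, pochhammer_succ, pochhammer_succ, ih]
    push_cast; ring

lemma pochhammer_succ_left (a : ℝ) (n : ℕ) :
    pochhammer a (n + 1) = a * pochhammer (a + 1) n := by
  rw [add_comm, pochhammer_add]; simp [pochhammer_succ]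

lemma pochhammer_two_mul (a : ℝ) (n : ℕ) :
    pochhammer a (2 * n) = 4 ^ n * pochhammer (a / 2) n * pochhammer ((a + 1) / 2) n := by
  induction n with
  | zero => simp
  | succ n ih =>
    rw [show 2 * (n + 1) = 2 * n + 1 + 1 by ring, pochhammer_succ, pochhammer_succ, ih,
      pochhammer_succ, pochhammer_succ]
    push_cast; ring

lemma factorial_two_mul_eq_pochhammer (n : ℕ) :
    ((2 * n).factorial : ℝ) = 4 ^ n * n.factorial * pochhammer (1 / 2) n := by
  induction n with
  | zero => simp
  | succ n ih =>
    rw [show 2 * (n + 1) = 2 * n + 1 + 1 by ring, Nat.factorial_succ, Nat.factorial_succ,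
      Nat.cast_mul, Nat.cast_mul, ih, pochhammer_succ, Nat.factorial_succ]
    push_cast; ring

lemma pochhammer_neg_sub (a : ℝ) (m : ℕ) :
    pochhammer (1 - a - m) m = (-1) ^ m * pochhammer a m := by
  induction m generalizing a with
  | zero => simp
  | succ m ih =>
    rw [pochhammer_succ, pochhammer_succ_left a]
    have h := ih (a + 1)
    rw [show 1 - a - ((m + 1 : ℕ) : ℝ) = 1 - (a + 1) - m + 0 + (0 : ℝ) - 0 by push_cast; ring]
    simp only [add_zero, sub_zero, h]
    ring

/-- The Chu–Vandermonde identity. -/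
lemma sum_choose_mul_pochhammer_div (m : ℕ) : ∀ (b : ℝ) {c : ℝ}, 0 < c →
    ∑ j ∈ Finset.range (m + 1), (-1 : ℝ) ^ j * (m.choose j) * (pochhammer b j / pochhammer c j) =
      pochhammer (c - b) m / pochhammer c m := by
  induction m with
  | zero => intro b c hc; simp
  | succ m ih =>
    intro b c hc
    have h1 := ih b hc
    have h2 := ih (b + 1) (c := c + 1) (by linarith)
    have hstep : ∀ j : ℕ, pochhammer b (j + 1) / pochhammer c (j + 1) =
        b / c * (pochhammer (b + 1) j / pochhammer (c + 1) j) := by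
      intro j
      rw [pochhammer_succ_left, pochhammer_succ_left, mul_div_mul_comm]
    -- Pascal's rule splits the sum; the shifted half is the same sum with `b + 1` and `c + 1`.
    have e1 : ∑ j ∈ Finset.range (m + 1 + 1),
        (-1 : ℝ) ^ j * ((m + 1).choose j) * (pochhammer b j / pochhammer c j) =
        ∑ j ∈ Finset.range (m + 1), (-1 : ℝ) ^ j * (m.choose j) * (pochhammer b j / pochhammer c j)
        - b / c * ∑ j ∈ Finset.range (m + 1), (-1 : ℝ) ^ j * (m.choose j) *
          (pochhammer (b + 1) j / pochhammer (c + 1) j) := by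
      have e2 : ∑ j ∈ Finset.range (m + 1), (-1 : ℝ) ^ j * (m.choose j) *
          (pochhammer b j / pochhammer c j) = ∑ j ∈ Finset.range (m + 1 + 1),
          (-1 : ℝ) ^ j * (m.choose j) * (pochhammer b j / pochhammer c j) := by
        rw [Finset.sum_range_succ _ (m + 1)]; simp
      rw [e2, Finset.sum_range_succ' _ (m + 1), Finset.sum_range_succ' _ (m + 1), Finset.mul_sum,
        add_sub_right_comm, ← Finset.sum_sub_distrib]
      congr 1
      swap
      · simp
      refine Finset.sum_congr rfl fun j _ => ?_
      rw [hstep, Nat.choose_succ_succ]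
      push_cast; ring
    rw [e1, h1, h2, pochhammer_succ c m, show c + 1 - (b + 1) = c - b by ring]
    have p1 := pochhammer_pos hc m
    have p2 := pochhammer_pos (a := c + 1) (by linarith) m
    have p3 : pochhammer c m * (c + m) = c * pochhammer (c + 1) m := by
      rw [← pochhammer_succ, pochhammer_succ_left]
    have hcm : 0 < c + m := by positivity
    rw [pochhammer_succ, p3, div_mul_div_comm, mul_comm (pochhammer (c-b) m),
      ← mul_div_mul_left (pochhammer (c - b) m) (pochhammer c m) hcm.ne', mul_comm _ (pochhammer c m), p3]
    ring

/-- The quadratic-transformation coefficient identity. -/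
lemma sum_pochhammer_antidiagonal {l c : ℝ} (hc : 0 < c) (m : ℕ) :
    ∑ p ∈ Finset.HasAntidiagonal.antidiagonal m, pochhammer l (2 * p.1 + p.2) /
        ((p.1.factorial : ℝ) * p.2.factorial * pochhammer c p.1) * (-1) ^ p.2 =
      pochhammer l m * pochhammer (l + 1 - c) m / (m.factorial * pochhammer c m) := by
  -- On the antidiagonal `2j + (m - j) = m + j`, and `(l)_{m+j} = (l)_m (l+m)_j`, so Chu–Vandermonde
  -- applies with `b = l + m`.
  have h := sum_choose_mul_pochhammer_div m (l + m) hc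
  have h1 : pochhammer (c - (l + m)) m = (-1) ^ m * pochhammer (l + 1 - c) m := by
    rw [← pochhammer_neg_sub]; congr 1; ring
  rw [Finset.Nat.sum_antidiagonal_eq_sum_range_succ_mk]
  rw [h1] at h
  have h2 : pochhammer l m * pochhammer (l + 1 - c) m / (m.factorial * pochhammer c m) =
      pochhammer l m / m.factorial * (-1) ^ m *
        ((-1) ^ m * pochhammer (l + 1 - c) m / pochhammer c m) := by
    have : ((-1 : ℝ) ^ m) * (-1) ^ m = 1 := by rw [← mul_pow]; simp
    field_simp
    rw [← pow_mul, mul_comm m 2, pow_mul]; simp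
  rw [h2, ← h, Finset.mul_sum]
  refine Finset.sum_congr rfl fun j hj => ?_
  have hjm : j ≤ m := Nat.lt_succ_iff.1 (Finset.mem_range.1 hj)
  simp only []
  rw [show 2 * j + (m - j) = m + j by omega, pochhammer_add, Nat.cast_choose ℝ hjm]
  have h3 : ((-1 : ℝ)) ^ m = (-1) ^ (m - j) * (-1) ^ j := by rw [← pow_add]; congr 1; omega
  have h4 : ((-1 : ℝ) ^ j) * (-1) ^ j = 1 := by rw [← mul_pow]; simp
  have := pochhammer_pos hc j
  have f1 := Nat.cast_pos (α := ℝ).2 (Nat.factorial_pos m)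
  have f2 := Nat.cast_pos (α := ℝ).2 (Nat.factorial_pos j)
  have f3 := Nat.cast_pos (α := ℝ).2 (Nat.factorial_pos (m - j))
  rw [h3]
  field_simp
  rw [← pow_mul, mul_comm j 2, pow_mul]; simp

lemma hasSum_binomial_neg (l : ℝ) {x : ℝ} (hx : |x| < 1) :
    HasSum (fun n : ℕ => pochhammer l n / n.factorial * x ^ n) ((1 - x) ^ (-l)) := by
  have h := (Real.one_div_one_sub_rpow_hasFPowerSeriesOnBall_zero l).hasSum (y := x)
    (by simpa [enorm_eq_nnnorm] using! hx)
  have h1 : (1 - x) ^ (-l) = 1 / (1 - (0 + x)) ^ l := by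
    rw [zero_add, Real.rpow_neg (by linarith [(abs_lt.1 hx).2]), one_div]
  rw [h1]
  convert! h using 2 with n
  rw [FormalMultilinearSeries.ofScalars_apply_eq, ← Ring.multichoose_eq]
  have := Ring.factorial_nsmul_multichoose_eq_ascPochhammer l n
  rw [Polynomial.ascPochhammer_smeval_eq_eval] at this
  rw [pochhammer, ← this, nsmul_eq_mul]
  have f1 := Nat.cast_pos (α := ℝ).2 (Nat.factorial_pos n)
  simp only [smul_eq_mul]
  field_simp

lemma hypergeometric_hasSum {a b c : ℝ} (ha : 0 < a) (hb : 0 < b) (hc : 0 < c) {t : ℝ}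
    (ht : |t| < 1) :
    HasSum (fun n : ℕ => pochhammer a n * pochhammer b n / (n.factorial * pochhammer c n) * t ^ n)
      (ordinaryHypergeometric a b c t) ∧ AnalyticAt ℝ (ordinaryHypergeometric a b c) t := by
  have hr := ordinaryHypergeometricSeries_radius_eq_one (𝕂 := ℝ) ℝ a b c (fun k => by
    have : (0 : ℝ) ≤ k := Nat.cast_nonneg k
    refine ⟨?_, ?_, ?_⟩ <;> intro h <;> linarith)
  have hf := (ordinaryHypergeometricSeries ℝ a b c).hasFPowerSeriesOnBall (by rw [hr]; simp)
  rw [hr] at hf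
  have hmem : t ∈ Metric.eball (0 : ℝ) 1 := by simpa [enorm_eq_nnnorm] using! ht
  refine ⟨?_, hf.analyticAt_of_mem hmem⟩
  have h := hf.hasSum hmem
  rw [zero_add] at h
  convert! h using 2 with n
  rw [ordinaryHypergeometricSeries_apply_eq]
  simp only [pochhammer, smul_eq_mul]
  field_simp

/-- The duplication formula for `(l)_{2j}` supplies the factor `4^j` that turns `t` into `y w² / 4`.
It is used with `w = 1 + t` for the value and `w = 1 - t` for absolute convergence. -/
lemma hasSum_quadratic_hypergeometric {l c : ℝ} (hl : 0 < l) (hc : 0 < c) {y : ℝ} (hy : |y| < 1)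
    {w : ℝ} (hw : 0 < w) {t : ℝ} (hty : 4 * t = y * w ^ 2) :
    HasSum (fun j : ℕ => pochhammer l (2 * j) / (j.factorial * pochhammer c j) * t ^ j *
      w ^ (-(l + 2 * j))) (w ^ (-l) * ordinaryHypergeometric (l / 2) ((l + 1) / 2) c y) := by
  have h := ((hypergeometric_hasSum (a := l / 2) (b := (l + 1) / 2) (by positivity) (by positivity)
    hc hy).1).mul_left (w ^ (-l))
  convert! h using 2 with j
  have e1 : w ^ (-(l + 2 * j)) = w ^ (-l) / (w ^ 2) ^ j := by
    rw [neg_add, ← sub_eq_add_neg, Real.rpow_sub hw, ← pow_mul]; norm_cast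
  have e2 : 4 ^ j * t ^ j = y ^ j * (w ^ 2) ^ j := by rw [← mul_pow, ← mul_pow, hty]
  rw [e1, pochhammer_two_mul]
  have := pochhammer_pos hc j
  field_simp
  linear_combination (pochhammer (l / 2) j * pochhammer ((l + 1) / 2) j) * e2

/-- Expanding each `(1 + t)^{-(l+2j)}` in powers of `t` gives a double series. Summed by rows it is
the left side; summed along antidiagonals, `sum_pochhammer_antidiagonal` makes it the right side. -/
lemma quadratic_transformation_near_zero {l c : ℝ} (hl : 0 < l) (hc : 0 < c) (hlc : 0 < l + 1 - c)
    {t : ℝ} (ht0 : 0 < t) (ht : t < 1 / 8) :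
    (1 + t) ^ (-l) * ordinaryHypergeometric (l / 2) ((l + 1) / 2) c (4 * t / (1 + t) ^ 2) =
      ordinaryHypergeometric l (l + 1 - c) c t := by
  have ht1 : |t| < 1 := by rw [abs_of_pos ht0]; linarith
  have htn : |-t| < 1 := by rwa [abs_neg]
  have hyp : |4 * t / (1 + t) ^ 2| < 1 := by
    rw [abs_of_pos (by positivity), div_lt_one (by positivity)]; nlinarith
  have hym : |4 * t / (1 - t) ^ 2| < 1 := by
    have : 0 < (1 - t) ^ 2 := by apply pow_pos; linarith
    rw [abs_of_pos (by positivity), div_lt_one this]; nlinarith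
  have h1 := hasSum_quadratic_hypergeometric hl hc hyp (w := 1 + t) (by positivity) (t := t)
    (by field_simp)
  have h2 := hasSum_quadratic_hypergeometric hl hc hym (w := 1 - t) (by linarith) (t := t)
    (by have : 1 - t ≠ 0 := by linarith
        field_simp)
  set f : ℕ × ℕ → ℝ := fun p => pochhammer l (2 * p.1 + p.2) /
    ((p.1.factorial : ℝ) * p.2.factorial * pochhammer c p.1) * (-1) ^ p.2 * t ^ (p.1 + p.2) with hf
  have hfabs : ∀ p, |f p| = pochhammer l (2 * p.1) / (p.1.factorial * pochhammer c p.1) * t ^ p.1 *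
      (pochhammer (l + 2 * p.1) p.2 / p.2.factorial * t ^ p.2) := by
    intro p
    have q1 := pochhammer_pos hl (2 * p.1 + p.2)
    have q2 := pochhammer_pos hc p.1
    simp only [hf]
    rw [abs_mul, abs_mul, abs_of_pos (by positivity), abs_pow, abs_neg, abs_one, one_pow, mul_one,
      abs_of_pos (by positivity : 0 < t ^ (p.1 + p.2)), pochhammer_add, pow_add]
    push_cast
    field_simp
  have hfsum : Summable f := by
    rw [← summable_abs_iff]
    rw [summable_prod_of_nonneg (fun p => abs_nonneg _)]
    constructor
    · intro j
      simp only [hfabs]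
      exact ((hasSum_binomial_neg (l + 2 * j) ht1).summable).mul_left _
    -- The absolute values sum to the series with `1 - t` in place of `1 + t`. It converges when `4t
    -- < (1 - t)²`, which `t < 1/8` guarantees.
    · have : (fun j => ∑' k, |f (j, k)|) = fun j : ℕ => pochhammer l (2 * j) /
          (j.factorial * pochhammer c j) * t ^ j * (1 - t) ^ (-(l + 2 * j)) := by
        funext j
        simp only [hfabs]
        rw [tsum_mul_left, (hasSum_binomial_neg (l + 2 * j) ht1).tsum_eq]
      rw [this]
      exact h2.summable
  have hrow : ∀ j : ℕ, HasSum (fun k => f (j, k)) (pochhammer l (2 * j) /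
      (j.factorial * pochhammer c j) * t ^ j * (1 + t) ^ (-(l + 2 * j))) := by
    intro j
    have := (hasSum_binomial_neg (l + 2 * j) htn).mul_left
      (pochhammer l (2 * j) / (j.factorial * pochhammer c j) * t ^ j)
    rw [sub_neg_eq_add] at this
    convert! this using 2 with k
    have q2 := pochhammer_pos hc j
    simp only [hf]
    rw [pochhammer_add, pow_add, neg_pow t k]
    push_cast
    field_simp
  have hA := (hfsum.hasSum.prod_fiberwise hrow).unique h1
  have hB := Finset.HasAntidiagonal.sigmaAntidiagonalEquivProd.hasSum_iff.2 hfsum.hasSum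
  have hcol : ∀ m : ℕ, HasSum (fun p : Finset.HasAntidiagonal.antidiagonal m => f p)
      (pochhammer l m * pochhammer (l + 1 - c) m / (m.factorial * pochhammer c m) * t ^ m) := by
    intro m
    convert! Finset.hasSum (Finset.HasAntidiagonal.antidiagonal m) f using 1
    rw [← sum_pochhammer_antidiagonal hc, Finset.sum_mul]
    refine Finset.sum_congr rfl fun p hp => ?_
    simp only [hf, Finset.HasAntidiagonal.mem_antidiagonal.1 hp]
  have hC := hB.sigma hcol
  rw [← hA]
  exact hC.unique (hypergeometric_hasSum hl hlc hc ht1).1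

/-- A quadratic transformation of the Gauss hypergeometric function. -/
lemma quadratic_transformation {l c : ℝ} (hl : 0 < l) (hc : 0 < c) (hlc : 0 < l + 1 - c)
    {t : ℝ} (ht0 : 0 ≤ t) (ht : t < 1) :
    (1 + t) ^ (-l) * ordinaryHypergeometric (l / 2) ((l + 1) / 2) c (4 * t / (1 + t) ^ 2) =
      ordinaryHypergeometric l (l + 1 - c) c t := by
  -- The identity theorem carries the equality from a neighbourhood of `1/16` to the whole interval.
  -- The left end is chosen slightly below `0` so that `0` is an interior point. The inner argument
  -- stays below `1` because `(1 + t)² - 4t = (1 - t)²`.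
  have key : Set.EqOn (fun t : ℝ => (1 + t) ^ (-l) *
      ordinaryHypergeometric (l / 2) ((l + 1) / 2) c (4 * t / (1 + t) ^ 2))
      (fun t => ordinaryHypergeometric l (l + 1 - c) c t) (Set.Ioo (-1 / 10) 1) := by
    refine AnalyticOnNhd.eqOn_of_preconnected_of_eventuallyEq (𝕜 := ℝ) (z₀ := 1 / 16) ?_ ?_
      isPreconnected_Ioo (by norm_num) ?_
    · intro s hs
      have hs1 : 0 < 1 + s := by linarith [hs.1]
      refine AnalyticAt.mul ?_ ?_
      · have h1 : AnalyticAt ℝ (fun x : ℝ => Real.exp (Real.log (1 + x) * -l)) s := by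
          have h0 : AnalyticAt ℝ (fun x : ℝ => 1 + x) s := by fun_prop
          exact ((h0.log hs1).mul analyticAt_const).rexp
        refine h1.congr ?_
        filter_upwards [lt_mem_nhds hs.1] with x hx
        rw [Real.rpow_def_of_pos (by linarith)]
      · refine AnalyticAt.fun_comp (g := ordinaryHypergeometric (l / 2) ((l + 1) / 2) c)
          (f := fun t : ℝ => 4 * t / (1 + t) ^ 2) ?_ ?_
        · refine (hypergeometric_hasSum (by positivity) (by positivity) hc ?_).2
          have h2 : 0 < (1 + s) ^ 2 := by positivity
          have h3 : 0 < (1 - s) ^ 2 := by apply pow_pos; linarith [hs.2]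
          rw [abs_lt, lt_div_iff₀ h2, div_lt_iff₀ h2]
          constructor <;> nlinarith [hs.1, hs.2]
        · exact AnalyticAt.div (by fun_prop) (by fun_prop) (by positivity)
    · intro s hs
      refine (hypergeometric_hasSum hl hlc hc ?_).2
      rw [abs_lt]; constructor <;> linarith [hs.1, hs.2]
    · filter_upwards [Ioo_mem_nhds (show (0 : ℝ) < 1 / 16 by norm_num)
        (show (1 / 16 : ℝ) < 1 / 8 by norm_num)] with s hs
      exact quadratic_transformation_near_zero hl hc hlc hs.1 hs.2
  exact key ⟨by linarith, ht⟩

lemma tsum_ofReal_quadratic {l c : ℝ} (hl : 0 < l) (hc : 0 < c) (hlc : 0 < l + 1 - c)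
    {t : ℝ} (ht0 : 0 ≤ t) (ht : t < 1) :
    ∑' j : ℕ, ENNReal.ofReal (pochhammer l (2 * j) / (j.factorial * pochhammer c j) * t ^ j *
      (1 + t) ^ (-(l + 2 * j))) =
    ∑' m : ℕ, ENNReal.ofReal
      (pochhammer l m * pochhammer (l + 1 - c) m / (m.factorial * pochhammer c m) * t ^ m) := by
  have hyp : |4 * t / (1 + t) ^ 2| < 1 := by
    have : 0 < (1 - t) ^ 2 := by apply pow_pos; linarith
    rw [abs_of_nonneg (by positivity), div_lt_one (by positivity)]; nlinarith
  have h1 := hasSum_quadratic_hypergeometric hl hc hyp (w := 1 + t) (by positivity) (t := t)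
    (by field_simp)
  have h2 := (hypergeometric_hasSum hl hlc hc
    (show |t| < 1 by rw [abs_of_nonneg ht0]; exact ht)).1
  rw [quadratic_transformation hl hc hlc ht0 ht] at h1
  rw [← ENNReal.ofReal_tsum_of_nonneg _ h1.summable, ← ENNReal.ofReal_tsum_of_nonneg _ h2.summable,
    h1.tsum_eq, h2.tsum_eq]
  · intro n
    have := pochhammer_pos hl n
    have := pochhammer_pos hc n
    have := pochhammer_pos hlc n
    positivity
  · intro n
    have := pochhammer_pos hl (2 * n)
    have := pochhammer_pos hc n
    positivity

/-! ### Radial integrals over Euclidean space -/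

lemma unitBallVol_pos (d : ℕ) : 0 < unitBallVol d := by
  rw [unitBallVol, ballVol, measureReal_def]
  exact ENNReal.toReal_pos (Metric.measure_ball_pos _ _ one_pos).ne' measure_ball_lt_top.ne

lemma ballVol_eq (d : ℕ) {ρ : ℝ} (hρ : 0 < ρ) : ballVol d ρ = unitBallVol d * ρ ^ d := by
  rw [unitBallVol, ballVol, ballVol, measureReal_def, measureReal_def,
    Measure.addHaar_ball_of_pos _ _ hρ, ENNReal.toReal_mul,
    ENNReal.toReal_ofReal (by positivity)]
  simp [mul_comm]

lemma volume_ball_eq_ofReal {d : ℕ} (x : EuclideanSpace ℝ (Fin d)) (ρ : ℝ) :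
    volume (Metric.ball x ρ) = ENNReal.ofReal (ballVol d ρ) := by
  rw [Measure.addHaar_ball_center, ballVol, ofReal_measureReal measure_ball_lt_top.ne]

lemma lintegral_radial {d : ℕ} (hd : 1 ≤ d) {g : ℝ → ℝ≥0∞} (hg : Measurable g) :
    ∫⁻ x : EuclideanSpace ℝ (Fin d), g ‖x‖ = ENNReal.ofReal (d * unitBallVol d) *
      ∫⁻ r in Set.Ioi (0 : ℝ), ENNReal.ofReal (r ^ (d - 1)) * g r := by
  have : NeZero d := ⟨by omega⟩
  have h := lintegral_polar (volume : Measure (EuclideanSpace ℝ (Fin d))) (P := fun _ => 1)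
    (by fun_prop) (k := 0) (by simp) hg
  simp only [one_mul, pow_zero, ENNReal.ofReal_one, lintegral_const,
    Measure.toSphere_apply_univ] at h
  rw [h, lintegral_volumeIoiPow _ hg, volume_ball_eq_ofReal,
    ENNReal.ofReal_mul (Nat.cast_nonneg _), ENNReal.ofReal_natCast]
  simp [unitBallVol]

lemma setLIntegral_ball_radial {d : ℕ} (hd : 1 ≤ d) (ρ : ℝ) {g : ℝ → ℝ≥0∞} (hg : Measurable g) :
    ∫⁻ x in Metric.ball (0 : EuclideanSpace ℝ (Fin d)) ρ, g ‖x‖ =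
      ENNReal.ofReal (d * unitBallVol d) *
        ∫⁻ r in Set.Ioo (0 : ℝ) ρ, ENNReal.ofReal (r ^ (d - 1)) * g r := by
  have h := lintegral_radial hd (g := (Set.Iio ρ).indicator g) (hg.indicator measurableSet_Iio)
  have e1 : ∀ x : EuclideanSpace ℝ (Fin d), (Set.Iio ρ).indicator g ‖x‖ =
      (Metric.ball (0 : EuclideanSpace ℝ (Fin d)) ρ).indicator (fun x => g ‖x‖) x := by
    intro x; simp [Set.indicator]
  rw [lintegral_congr e1, lintegral_indicator measurableSet_ball] at h
  have e2 : ∀ r : ℝ, ENNReal.ofReal (r ^ (d - 1)) * (Set.Iio ρ).indicator g r =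
      (Set.Iio ρ).indicator (fun r => ENNReal.ofReal (r ^ (d - 1)) * g r) r := by
    intro r; simp [Set.indicator]
  rw [h, lintegral_congr e2, setLIntegral_indicator measurableSet_Iio, Set.inter_comm,
    Set.Ioi_inter_Iio]

lemma setLIntegral_ball_norm_pow {d : ℕ} (hd : 1 ≤ d) {ρ : ℝ} (hρ : 0 < ρ) (m : ℕ) :
    ∫⁻ x in Metric.ball (0 : EuclideanSpace ℝ (Fin d)) ρ, ENNReal.ofReal (‖x‖ ^ (2 * m)) =
      ENNReal.ofReal (ballVol d ρ * (ρ ^ (2 * m) * (d / (d + 2 * m)))) := by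
  rw [setLIntegral_ball_radial hd ρ (g := fun r => ENNReal.ofReal (r ^ (2 * m))) (by fun_prop)]
  have h1 : ∫⁻ r in Set.Ioo (0 : ℝ) ρ, ENNReal.ofReal (r ^ (d - 1)) * ENNReal.ofReal (r ^ (2 * m)) =
      ENNReal.ofReal (ρ ^ (d + 2 * m) / (d + 2 * m)) := by
    have h2 : ∀ r ∈ Set.Ioo (0 : ℝ) ρ, ENNReal.ofReal (r ^ (d - 1)) * ENNReal.ofReal (r ^ (2 * m)) =
        ENNReal.ofReal (r ^ (d - 1 + 2 * m)) := by
      intro r hr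
      rw [← ENNReal.ofReal_mul (pow_nonneg hr.1.le _), pow_add]
    rw [setLIntegral_congr_fun measurableSet_Ioo h2, setLIntegral_congr Ioo_ae_eq_Ioc,
      ← ofReal_integral_eq_lintegral_ofReal
        (intervalIntegral.intervalIntegrable_pow _).1, ← intervalIntegral.integral_of_le hρ.le,
      integral_pow]
    · rw [show d - 1 + 2 * m + 1 = d + 2 * m by omega, zero_pow (by omega)]
      congr 1
      have : ((d - 1 + 2 * m : ℕ) : ℝ) + 1 = d + 2 * m := by
        rw [← Nat.cast_succ, Nat.succ_eq_add_one, show d - 1 + 2 * m + 1 = d + 2 * m by omega]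
        push_cast; ring
      rw [this, sub_zero]
    · filter_upwards [ae_restrict_mem measurableSet_Ioc] with r hr
      exact pow_nonneg hr.1.le _
  have hu := unitBallVol_pos d
  rw [h1, ← ENNReal.ofReal_mul (by positivity), ballVol_eq d hρ]
  congr 1
  rw [pow_add]
  ring

/-! ### The mean of a power of the distance over a ball -/

lemma hasSum_binomial_even (l : ℝ) {w : ℝ} (hw : |w| < 1) :
    HasSum (fun j : ℕ => pochhammer l (2 * j) / (2 * j).factorial * (2 * w ^ (2 * j)))
      ((1 - w) ^ (-l) + (1 + w) ^ (-l)) := by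
  have h1 := hasSum_binomial_neg l hw
  have h2 := hasSum_binomial_neg l (x := -w) (by rwa [abs_neg])
  rw [sub_neg_eq_add] at h2
  have h3 := h1.add h2
  have hinj : Function.Injective (fun j : ℕ => 2 * j) := fun a b h => by simpa using h
  rw [← hinj.hasSum_iff] at h3
  · convert! h3 using 2 with j
    simp only [Function.comp_apply, even_two_mul, Even.neg_pow]
    ring
  · intro n hn
    have : Odd n := by
      rw [← Nat.not_even_iff_odd]
      rintro ⟨k, hk⟩
      exact hn ⟨k, by simp only []; omega⟩
    rw [this.neg_pow]
    ring

/-- With `N = ‖q‖² + ‖x‖²` and `w = 2⟪q, x⟫ / N` one has `‖q ± x‖² = N (1 ± w)`, and `‖x‖ < ‖q‖`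
forces `|w| < 1`. Adding the two signs removes the odd powers of `w`, so all remaining terms are
nonnegative and Tonelli applies without further estimates. -/
lemma symmetrized_power_eq_tsum {E : Type*} [NormedAddCommGroup E] [InnerProductSpace ℝ E]
    {l : ℝ} (hl : 0 < l) {q x : E} (hx : ‖x‖ < ‖q‖) :
    ENNReal.ofReal ((‖q + x‖ ^ 2) ^ (-l)) + ENNReal.ofReal ((‖q - x‖ ^ 2) ^ (-l)) =
      2 * ∑' j : ℕ, ENNReal.ofReal (⟪q, x⟫ ^ (2 * j)) * ENNReal.ofReal
        (pochhammer l (2 * j) / (j.factorial * pochhammer (1 / 2) j) *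
          (‖q‖ ^ 2 + ‖x‖ ^ 2) ^ (-(l + 2 * j))) := by
  have hq : 0 < ‖q‖ := (norm_nonneg x).trans_lt hx
  set N := ‖q‖ ^ 2 + ‖x‖ ^ 2 with hN
  have hNpos : 0 < N := by positivity
  set w := 2 * ⟪q, x⟫ / N with hw
  have hw1 : |w| < 1 := by
    rw [hw, abs_div, abs_of_pos hNpos, div_lt_one hNpos, abs_mul, abs_two]
    have := abs_real_inner_le_norm q x
    nlinarith [sq_nonneg (‖q‖ - ‖x‖), sub_pos.2 hx, mul_pos (sub_pos.2 hx) (sub_pos.2 hx)]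
  have e1 : ‖q + x‖ ^ 2 = N * (1 + w) := by
    rw [norm_add_sq_real, hw]; field_simp; ring
  have e2 : ‖q - x‖ ^ 2 = N * (1 - w) := by
    rw [norm_sub_sq_real, hw]; field_simp; ring
  have h1 : 0 < 1 + w := by linarith [(abs_lt.1 hw1).1]
  have h2 : 0 < 1 - w := by linarith [(abs_lt.1 hw1).2]
  have hs := (hasSum_binomial_even l hw1).mul_left (N ^ (-l))
  rw [e1, e2, Real.mul_rpow hNpos.le h1.le, Real.mul_rpow hNpos.le h2.le,
    ← ENNReal.ofReal_add (by positivity) (by positivity), ← mul_add, add_comm, ← hs.tsum_eq,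
    ENNReal.ofReal_tsum_of_nonneg _ hs.summable, ← ENNReal.tsum_mul_left]
  · refine tsum_congr fun j => ?_
    have p1 := pochhammer_pos hl (2 * j)
    have p2 := pochhammer_pos (a := 1 / 2) (by norm_num) j
    have p3 : 0 ≤ ⟪q, x⟫ ^ (2 * j) := by rw [pow_mul]; positivity
    rw [← ENNReal.ofReal_mul p3, show (2 : ℝ≥0∞) = ENNReal.ofReal 2 by simp,
      ← ENNReal.ofReal_mul (by norm_num)]
    congr 1
    have e3 : N ^ (-(l + 2 * j)) = N ^ (-l) / N ^ (2 * j) := by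
      rw [neg_add, ← sub_eq_add_neg, Real.rpow_sub hNpos]; norm_cast
    rw [e3, factorial_two_mul_eq_pochhammer, hw, div_pow, mul_pow, pow_mul (2 : ℝ)]
    norm_num
    field_simp
  · intro j
    have p1 := pochhammer_pos hl (2 * j)
    have p3 : 0 ≤ w ^ (2 * j) := by rw [pow_mul]; positivity
    positivity

lemma setLIntegral_ball_neg {d : ℕ} (ρ : ℝ) (g : EuclideanSpace ℝ (Fin d) → ℝ≥0∞) :
    ∫⁻ x in Metric.ball (0 : EuclideanSpace ℝ (Fin d)) ρ, g (-x) =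
      ∫⁻ x in Metric.ball (0 : EuclideanSpace ℝ (Fin d)) ρ, g x := by
  have := (Measure.measurePreserving_neg
    (volume : Measure (EuclideanSpace ℝ (Fin d)))).setLIntegral_comp_preimage_emb
    (MeasurableEquiv.neg _).measurableEmbedding g (Metric.ball 0 ρ)
  rw [← this]
  congr 2
  ext x; simp

/-- The integral of `x ↦ |q + x|^{-2l}` over a ball that does not contain `-q`. -/
lemma setLIntegral_ball_norm_add_rpow {d : ℕ} (hd : 1 ≤ d) {l : ℝ} (hl : 0 < l)
    (hlc : 0 < l + 1 - d / 2) {q : EuclideanSpace ℝ (Fin d)} {ρ : ℝ} (hρ : 0 < ρ) (hq : ρ ≤ ‖q‖) :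
    ∫⁻ x in Metric.ball (0 : EuclideanSpace ℝ (Fin d)) ρ, ENNReal.ofReal ((‖q + x‖ ^ 2) ^ (-l)) =
      ENNReal.ofReal (ballVol d ρ) * ∑' m : ℕ, ENNReal.ofReal
        (pochhammer l m * pochhammer (l + 1 - d / 2) m /
          (m.factorial * pochhammer ((d + 2) / 2) m) * ρ ^ (2 * m) *
          (‖q‖ ^ 2) ^ (-(l + m))) := by
  have hq0 : 0 < ‖q‖ := hρ.trans_le hq
  have hd0 : (0 : ℝ) < d / 2 := by positivity
  set B := Metric.ball (0 : EuclideanSpace ℝ (Fin d)) ρ with hB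
  -- The ball is invariant under `x ↦ -x`, so twice the integral equals the integral of the
  -- symmetrized integrand.
  have step1 : ∫⁻ x in B, ENNReal.ofReal ((‖q + x‖ ^ 2) ^ (-l)) =
      ∫⁻ x in B, ∑' j : ℕ, ENNReal.ofReal (⟪q, x⟫ ^ (2 * j)) * ENNReal.ofReal
        (pochhammer l (2 * j) / (j.factorial * pochhammer (1 / 2) j) *
          (‖q‖ ^ 2 + ‖x‖ ^ 2) ^ (-(l + 2 * j))) := by
    have h2 : 2 * ∫⁻ x in B, ENNReal.ofReal ((‖q + x‖ ^ 2) ^ (-l)) = 2 * ∫⁻ x in B,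
        ∑' j : ℕ, ENNReal.ofReal (⟪q, x⟫ ^ (2 * j)) * ENNReal.ofReal
        (pochhammer l (2 * j) / (j.factorial * pochhammer (1 / 2) j) *
          (‖q‖ ^ 2 + ‖x‖ ^ 2) ^ (-(l + 2 * j))) := by
      have h3 := setLIntegral_ball_neg ρ
        (fun x : EuclideanSpace ℝ (Fin d) => ENNReal.ofReal ((‖q + x‖ ^ 2) ^ (-l)))
      rw [← lintegral_const_mul' 2 (fun x => ∑' _, _) (by norm_num), two_mul]
      nth_rw 2 [← h3]
      rw [← lintegral_add_left (by fun_prop)]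
      refine setLIntegral_congr_fun measurableSet_ball fun x hx => ?_
      have hx' : ‖x‖ < ‖q‖ := (by simpa [hB] using hx : ‖x‖ < ρ).trans_le hq
      simp only [← sub_eq_add_neg]
      exact symmetrized_power_eq_tsum hl hx'
    exact (ENNReal.mul_right_inj (by norm_num) (by norm_num)).1 h2
  -- The spherical moment replaces `⟪q, x⟫^{2j}` by `‖q‖^{2j} ‖x‖^{2j}` and the denominator
  -- `(1/2)_j` by `(d/2)_j`.
  have step2 : ∀ j : ℕ, ∫⁻ x in B, ENNReal.ofReal (⟪q, x⟫ ^ (2 * j)) * ENNReal.ofReal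
        (pochhammer l (2 * j) / (j.factorial * pochhammer (1 / 2) j) *
          (‖q‖ ^ 2 + ‖x‖ ^ 2) ^ (-(l + 2 * j))) =
      ∫⁻ x in B, ENNReal.ofReal ((‖q‖ ^ 2) ^ (-l)) * ENNReal.ofReal
        (pochhammer l (2 * j) / (j.factorial * pochhammer (d / 2) j) * (‖x‖ ^ 2 / ‖q‖ ^ 2) ^ j *
          (1 + ‖x‖ ^ 2 / ‖q‖ ^ 2) ^ (-(l + 2 * j))) := by
    intro j
    have hm := lintegral_inner_pow_mul_radial hd (norm_pos_iff.1 hq0) j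
      (g := (Set.Iio ρ).indicator fun r => ENNReal.ofReal
        (pochhammer l (2 * j) / (j.factorial * pochhammer (1 / 2) j) *
          (‖q‖ ^ 2 + r ^ 2) ^ (-(l + 2 * j))))
      (Measurable.indicator (by fun_prop) measurableSet_Iio)
    have e1 : ∀ (P : EuclideanSpace ℝ (Fin d) → ℝ≥0∞) (x : EuclideanSpace ℝ (Fin d)),
        P x * (Set.Iio ρ).indicator (fun r => ENNReal.ofReal
        (pochhammer l (2 * j) / (j.factorial * pochhammer (1 / 2) j) *
          (‖q‖ ^ 2 + r ^ 2) ^ (-(l + 2 * j)))) ‖x‖ = B.indicator (fun x => P x * ENNReal.ofReal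
        (pochhammer l (2 * j) / (j.factorial * pochhammer (1 / 2) j) *
          (‖q‖ ^ 2 + ‖x‖ ^ 2) ^ (-(l + 2 * j)))) x := by
      intro P x; simp [Set.indicator, hB]
    rw [lintegral_congr (e1 fun x => ENNReal.ofReal (⟪q, x⟫ ^ (2 * j))),
      lintegral_congr (e1 fun x => ENNReal.ofReal (‖x‖ ^ (2 * j))),
      lintegral_indicator measurableSet_ball, lintegral_indicator measurableSet_ball] at hm
    rw [hm, ← lintegral_const_mul _ (by fun_prop)]
    refine setLIntegral_congr_fun measurableSet_ball fun x _ => ?_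
    have p1 := pochhammer_pos hl (2 * j)
    have p2 := pochhammer_pos (a := 1 / 2) (by norm_num) j
    have p3 := pochhammer_pos hd0 j
    have e4 : (‖q‖ ^ 2 + ‖x‖ ^ 2) ^ (-(l + 2 * j)) =
        (‖q‖ ^ 2) ^ (-l) / ‖q‖ ^ (4 * j) * (1 + ‖x‖ ^ 2 / ‖q‖ ^ 2) ^ (-(l + 2 * j)) := by
      rw [show ‖q‖ ^ 2 + ‖x‖ ^ 2 = ‖q‖ ^ 2 * (1 + ‖x‖ ^ 2 / ‖q‖ ^ 2) by field_simp,
        Real.mul_rpow (by positivity) (by positivity), neg_add, ← sub_eq_add_neg,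
        Real.rpow_sub (by positivity)]
      congr 2
      norm_cast
      rw [← pow_mul]; congr 1; ring
    rw [← ENNReal.ofReal_mul (by positivity), ← ENNReal.ofReal_mul (by positivity),
      ← ENNReal.ofReal_mul (by positivity), e4]
    congr 1
    rw [div_pow, ← pow_mul, ← pow_mul, show ‖q‖ ^ (4 * j) = ‖q‖ ^ (2 * j) * ‖q‖ ^ (2 * j) by
      rw [← pow_add]; congr 1; ring]
    field_simp
  -- The quadratic transformation with `c = d/2` at `t = ‖x‖² / ‖q‖² < 1` leaves a pure power series
  -- in `‖x‖²`.
  have step3 : ∀ x ∈ B, ∑' j : ℕ, ENNReal.ofReal ((‖q‖ ^ 2) ^ (-l)) * ENNReal.ofReal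
        (pochhammer l (2 * j) / (j.factorial * pochhammer (d / 2) j) * (‖x‖ ^ 2 / ‖q‖ ^ 2) ^ j *
          (1 + ‖x‖ ^ 2 / ‖q‖ ^ 2) ^ (-(l + 2 * j))) =
      ∑' m : ℕ, ENNReal.ofReal (pochhammer l m * pochhammer (l + 1 - d / 2) m /
          (m.factorial * pochhammer (d / 2) m) * (‖q‖ ^ 2) ^ (-(l + m))) *
            ENNReal.ofReal (‖x‖ ^ (2 * m)) := by
    intro x hx
    have hx' : ‖x‖ < ‖q‖ := (by simpa [hB] using hx : ‖x‖ < ρ).trans_le hq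
    rw [ENNReal.tsum_mul_left, tsum_ofReal_quadratic hl hd0 hlc (by positivity)
      (by rw [div_lt_one (by positivity)]; gcongr), ← ENNReal.tsum_mul_left]
    refine tsum_congr fun m => ?_
    have p1 := pochhammer_pos hl m
    have p2 := pochhammer_pos hlc m
    have p3 := pochhammer_pos hd0 m
    rw [← ENNReal.ofReal_mul (by positivity), ← ENNReal.ofReal_mul (by positivity), neg_add l,
      ← sub_eq_add_neg, Real.rpow_sub (by positivity), Real.rpow_natCast, div_pow, pow_mul]
    congr 1
    field_simp
  rw [step1, lintegral_tsum (fun j => by fun_prop), tsum_congr step2,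
    ← lintegral_tsum (fun j => by fun_prop), setLIntegral_congr_fun measurableSet_ball step3,
    lintegral_tsum (fun j => by fun_prop), ← ENNReal.tsum_mul_left]
  refine tsum_congr fun m => ?_
  have p1 := pochhammer_pos hl m
  have p2 := pochhammer_pos hlc m
  have p3 := pochhammer_pos hd0 m
  have p4 := pochhammer_pos (a := ((d : ℝ) + 2) / 2) (by positivity) m
  have hv : 0 ≤ ballVol d ρ := measureReal_nonneg
  rw [lintegral_const_mul _ (by fun_prop), setLIntegral_ball_norm_pow hd hρ,
    ← ENNReal.ofReal_mul (by positivity), ← ENNReal.ofReal_mul hv]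
  congr 1
  -- The radial factor `d / (d + 2m)` raises the lower parameter from `d/2` to `(d + 2)/2`.
  have p5 : (d / 2 : ℝ) * pochhammer ((d + 2) / 2) m = pochhammer (d / 2) m * (d / 2 + m) := by
    rw [← pochhammer_succ, pochhammer_succ_left]; congr 2; ring
  have p6 : pochhammer (((d : ℝ) + 2) / 2) m = pochhammer (d / 2) m * (d / 2 + m) / (d / 2) := by
    rw [eq_div_iff hd0.ne', ← p5]; ring
  rw [p6]
  have : (0 : ℝ) < d / 2 + m := by positivity
  have : (0 : ℝ) < d + 2 * m := by positivity
  field_simp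

/-! ### The interaction of two balls -/

lemma appellHTerm_nonneg (d : ℕ) {t : ℝ} (ht : 0 ≤ t) (p : ℕ × ℕ) : 0 ≤ appellHTerm d t p := by
  have h1 := pochhammer_pos (a := 3 / 2) (by norm_num) (p.1 + p.2)
  have h2 := pochhammer_pos (a := ((d : ℝ) + 1) / 2) (by positivity) (p.1 + p.2)
  have h3 := pochhammer_pos (a := ((d : ℝ) + 2) / 2) (by positivity) p.1
  have h4 := pochhammer_pos (a := ((d : ℝ) + 2) / 2) (by positivity) p.2
  unfold appellHTerm appellF4Term
  positivity

lemma one_div_norm_pow_eq_rpow {E : Type*} [NormedAddCommGroup E] (d : ℕ) (z : E) :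
    1 / ‖z‖ ^ (d + 1) = (‖z‖ ^ 2) ^ (-(((d : ℝ) + 1) / 2)) := by
  rcases (norm_nonneg z).eq_or_lt with h | h
  · rw [← h, zero_pow (by norm_num), zero_pow (by norm_num), Real.zero_rpow (by
      have : (0 : ℝ) ≤ d := Nat.cast_nonneg d
      intro h; linarith), div_zero]
  · rw [Real.rpow_neg (by positivity), one_div, ← Real.rpow_natCast ‖z‖ 2, ← Real.rpow_mul h.le,
      ← Real.rpow_natCast]
    congr 2
    push_cast; ring

/-- The ball formula is used twice: in `y` with centre `q + x` and `l = (d+1)/2`, then in `x` with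
centre `q` and exponent `l + m`. Since `l + 1 - d/2 = 3/2`, the Pochhammer symbols multiply to those
of the Appell series. Touching balls are included, as `‖q + x‖ ≥ ρ` is all that the inner step
needs. -/
lemma lintegral_ball_ball_interaction {d : ℕ} (hd : 1 ≤ d) {q : EuclideanSpace ℝ (Fin d)} {ρ : ℝ}
    (hρ : 0 < ρ) (hq : 2 * ρ ≤ ‖q‖) :
    ∫⁻ x in Metric.ball (0 : EuclideanSpace ℝ (Fin d)) ρ,
      ∫⁻ y in Metric.ball (0 : EuclideanSpace ℝ (Fin d)) ρ,
        ENNReal.ofReal (1 / ‖q + x + y‖ ^ (d + 1)) =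
      ENNReal.ofReal (ballVol d ρ ^ 2 / ‖q‖ ^ (d + 1)) *
        ∑' p : ℕ × ℕ, ENNReal.ofReal (appellHTerm d (ρ ^ 2 / ‖q‖ ^ 2) p) := by
  have hq0 : 0 < ‖q‖ := by linarith
  have hv : 0 ≤ ballVol d ρ := measureReal_nonneg
  set l : ℝ := ((d : ℝ) + 1) / 2 with hl
  have hl0 : 0 < l := by positivity
  have hlc : 0 < l + 1 - d / 2 := by rw [hl]; ring_nf; norm_num
  set B := Metric.ball (0 : EuclideanSpace ℝ (Fin d)) ρ with hB
  have step1 : ∀ x ∈ B, ∫⁻ y in B, ENNReal.ofReal (1 / ‖q + x + y‖ ^ (d + 1)) =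
      ∑' m : ℕ, ENNReal.ofReal (ballVol d ρ * (pochhammer l m * pochhammer (l + 1 - d / 2) m /
          (m.factorial * pochhammer ((d + 2) / 2) m) * ρ ^ (2 * m))) *
          ENNReal.ofReal ((‖q + x‖ ^ 2) ^ (-(l + m))) := by
    intro x hx
    have hx' : ‖x‖ < ρ := by simpa [hB] using hx
    have hqx : ρ ≤ ‖q + x‖ := by
      have := norm_sub_le_norm_add q x
      linarith
    simp_rw [one_div_norm_pow_eq_rpow]
    rw [setLIntegral_ball_norm_add_rpow hd hl0 hlc hρ hqx, ← ENNReal.tsum_mul_left]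
    refine tsum_congr fun m => ?_
    have p1 := pochhammer_pos hl0 m
    have p2 := pochhammer_pos hlc m
    have p4 := pochhammer_pos (a := ((d : ℝ) + 2) / 2) (by positivity) m
    rw [ENNReal.ofReal_mul (p := _ * ρ ^ (2 * m)) (by positivity), ← mul_assoc,
      ← ENNReal.ofReal_mul hv]
  rw [setLIntegral_congr_fun measurableSet_ball step1, lintegral_tsum (fun j => by fun_prop),
    ENNReal.tsum_prod', ← ENNReal.tsum_mul_left]
  refine tsum_congr fun m => ?_
  have hm : 0 < l + m := by positivity
  have hmc : 0 < l + m + 1 - d / 2 := by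
    have : (0 : ℝ) ≤ m := Nat.cast_nonneg m
    linarith
  rw [lintegral_const_mul _ (by fun_prop), setLIntegral_ball_norm_add_rpow hd hm hmc hρ (by linarith),
    ← ENNReal.tsum_mul_left, ← ENNReal.tsum_mul_left, ← ENNReal.tsum_mul_left]
  refine tsum_congr fun n => ?_
  have p1 := pochhammer_pos hl0 m
  have p2 := pochhammer_pos hlc m
  have p3 := pochhammer_pos hm n
  have p4 := pochhammer_pos hmc n
  have p5 := pochhammer_pos (a := ((d : ℝ) + 2) / 2) (by positivity) m
  have p6 := pochhammer_pos (a := ((d : ℝ) + 2) / 2) (by positivity) n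
  rw [← ENNReal.ofReal_mul hv, ← ENNReal.ofReal_mul (by positivity),
    ← ENNReal.ofReal_mul (by positivity)]
  congr 1
  unfold appellHTerm appellF4Term
  have e1 : (‖q‖ ^ 2) ^ (-(l + m + n)) = 1 / ‖q‖ ^ (d + 1) / (‖q‖ ^ 2) ^ (m + n) := by
    rw [one_div_norm_pow_eq_rpow, add_assoc, neg_add, ← sub_eq_add_neg,
      Real.rpow_sub (by positivity), ← hl, ← Nat.cast_add, Real.rpow_natCast]
  have e2 : (3 / 2 : ℝ) = l + 1 - d / 2 := by rw [hl]; ring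
  rw [e1, e2, ← hl, pochhammer_add _ m n, pochhammer_add _ m n, show l + m + 1 - (d : ℝ) / 2 =
    l + 1 - d / 2 + m by ring, div_pow, div_pow, pow_add (‖q‖ ^ 2), pow_mul, pow_mul]
  rw [show l + m + 1 - (d : ℝ) / 2 = l + 1 - d / 2 + m by ring] at p4
  field_simp

/-- The volume of the intersection of two balls of radius `ρ` whose centres differ by `z`. -/
def ballOverlap {d : ℕ} (ρ : ℝ) (z : EuclideanSpace ℝ (Fin d)) : ℝ :=
  volume.real (Metric.ball 0 ρ ∩ Metric.ball z ρ)

lemma ofReal_ballOverlap {d : ℕ} (ρ : ℝ) (z : EuclideanSpace ℝ (Fin d)) :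
    ENNReal.ofReal (ballOverlap ρ z) = volume (Metric.ball 0 ρ ∩ Metric.ball z ρ) :=
  ofReal_measureReal (measure_inter_lt_top_of_left_ne_top measure_ball_lt_top.ne).ne

lemma ballOverlap_nonneg {d : ℕ} (ρ : ℝ) (z : EuclideanSpace ℝ (Fin d)) : 0 ≤ ballOverlap ρ z :=
  measureReal_nonneg

lemma ofReal_ballOverlap_eq_lintegral {d : ℕ} (ρ : ℝ) (z : EuclideanSpace ℝ (Fin d)) :
    ENNReal.ofReal (ballOverlap ρ z) = ∫⁻ x in Metric.ball (0 : EuclideanSpace ℝ (Fin d)) ρ,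
      (Metric.ball (0 : EuclideanSpace ℝ (Fin d)) ρ).indicator 1 (z - x) := by
  have e : ∀ x, (Metric.ball (0 : EuclideanSpace ℝ (Fin d)) ρ).indicator (1 : EuclideanSpace ℝ (Fin d) → ℝ≥0∞) (z - x) =
      (Metric.ball z ρ).indicator 1 x := by
    intro x; simp [Set.indicator, dist_eq_norm, norm_sub_rev]
  simp_rw [e]
  rw [lintegral_indicator_one measurableSet_ball, Measure.restrict_apply measurableSet_ball,
    Set.inter_comm, ofReal_ballOverlap]

/-- The overlap is the convolution of the indicator of the ball with itself; the substitution `z = q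
+ x + y` gives the double integral. -/
lemma lintegral_ballOverlap_mul {d : ℕ} (ρ : ℝ) (q : EuclideanSpace ℝ (Fin d))
    {f : EuclideanSpace ℝ (Fin d) → ℝ≥0∞} (hf : Measurable f) :
    ∫⁻ z, ENNReal.ofReal (ballOverlap ρ (z - q)) * f z =
      ∫⁻ x in Metric.ball (0 : EuclideanSpace ℝ (Fin d)) ρ,
        ∫⁻ y in Metric.ball (0 : EuclideanSpace ℝ (Fin d)) ρ, f (q + x + y) := by
  have hm : Measurable (Function.uncurry fun z x : EuclideanSpace ℝ (Fin d) =>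
      (Metric.ball (0 : EuclideanSpace ℝ (Fin d)) ρ).indicator (1 : EuclideanSpace ℝ (Fin d) → ℝ≥0∞) (z - q - x) * f z) := by
    refine Measurable.mul ?_ (hf.comp measurable_fst)
    exact (measurable_one.indicator measurableSet_ball).comp
      ((measurable_fst.sub_const q).sub measurable_snd)
  have e1 : ∀ z, ENNReal.ofReal (ballOverlap ρ (z - q)) * f z =
      ∫⁻ x in Metric.ball (0 : EuclideanSpace ℝ (Fin d)) ρ,
        (Metric.ball (0 : EuclideanSpace ℝ (Fin d)) ρ).indicator 1 (z - q - x) * f z := by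
    intro z
    rw [ofReal_ballOverlap_eq_lintegral, lintegral_mul_const]
    exact (measurable_one.indicator measurableSet_ball).comp (by fun_prop)
  simp_rw [e1]
  rw [lintegral_lintegral_swap hm.aemeasurable]
  refine lintegral_congr fun x => ?_
  rw [← lintegral_add_right_eq_self _ (q + x), ← lintegral_indicator measurableSet_ball]
  refine lintegral_congr fun y => ?_
  have : y + (q + x) - q - x = y := by abel
  rw [this, add_comm y]
  by_cases hy : y ∈ Metric.ball (0 : EuclideanSpace ℝ (Fin d)) ρ <;> simp [Set.indicator, hy]

lemma lintegral_ballOverlap_div {d : ℕ} (hd : 1 ≤ d) {q : EuclideanSpace ℝ (Fin d)} {ρ : ℝ}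
    (hρ : 0 < ρ) (hq : 2 * ρ ≤ ‖q‖) :
    ∫⁻ z, ENNReal.ofReal (ballOverlap ρ (z - q) / ‖z‖ ^ (d + 1)) =
      ENNReal.ofReal (ballVol d ρ ^ 2 / ‖q‖ ^ (d + 1)) *
        ∑' p : ℕ × ℕ, ENNReal.ofReal (appellHTerm d (ρ ^ 2 / ‖q‖ ^ 2) p) := by
  rw [← lintegral_ball_ball_interaction hd hρ hq, ← lintegral_ballOverlap_mul ρ q
    (f := fun z => ENNReal.ofReal (1 / ‖z‖ ^ (d + 1))) (by fun_prop)]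
  refine lintegral_congr fun z => ?_
  rw [← ENNReal.ofReal_mul (ballOverlap_nonneg _ _)]
  congr 1; ring

/-! ### The volume of the intersection of two balls -/

/-- The profile `(ρ² - s²)_+^{n/2}` of the slices of a ball of dimension `n + 1`. -/
def sliceProfile (n : ℕ) (ρ s : ℝ) : ℝ := Real.sqrt (ρ ^ 2 - s ^ 2) ^ n

lemma continuous_sliceProfile (n : ℕ) (ρ : ℝ) : Continuous (sliceProfile n ρ) := by
  unfold sliceProfile; fun_prop

lemma sliceProfile_nonneg (n : ℕ) (ρ s : ℝ) : 0 ≤ sliceProfile n ρ s := by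
  unfold sliceProfile; positivity

/-- Slices perpendicular to `u` are balls of dimension `n` and radius `√(ρ² - s²)`. The set `T` is
fixed only up to null sets, so that open and closed caps are covered at once. -/
lemma volume_cap {n : ℕ} {u : EuclideanSpace ℝ (Fin (n + 1))} (hu : ‖u‖ = 1) {ρ : ℝ} (hρ : 0 < ρ)
    {h : ℝ} (h1 : -ρ ≤ h) (h2 : h ≤ ρ) {T : Set ℝ} (hTm : MeasurableSet T)
    (hT : T =ᵐ[volume] Set.Ioi h) :
    volume {x : EuclideanSpace ℝ (Fin (n + 1)) | ⟪u, x⟫ ∈ T ∧ ‖x‖ < ρ} =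
      ENNReal.ofReal (unitBallVol n * ∫ s in h..ρ, sliceProfile n ρ s) := by
  have hmS : MeasurableSet {p : ℝ × ℝ | p.1 ∈ T ∧ p.2 < ρ ^ 2} :=
    (measurable_fst hTm).inter (measurableSet_lt measurable_snd measurable_const)
  have hl := lintegral_inner_normSq hu
    (F := {p : ℝ × ℝ | p.1 ∈ T ∧ p.2 < ρ ^ 2}.indicator 1) (measurable_one.indicator hmS)
  have e1 : ∀ x : EuclideanSpace ℝ (Fin (n + 1)),
      {p : ℝ × ℝ | p.1 ∈ T ∧ p.2 < ρ ^ 2}.indicator (1 : ℝ × ℝ → ℝ≥0∞) (⟪u, x⟫, ‖x‖ ^ 2) =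
      {x : EuclideanSpace ℝ (Fin (n + 1)) | ⟪u, x⟫ ∈ T ∧ ‖x‖ < ρ}.indicator 1 x := by
    intro x
    have : ‖x‖ ^ 2 < ρ ^ 2 ↔ ‖x‖ < ρ := sq_lt_sq₀ (norm_nonneg _) hρ.le
    have hiff : (⟪u, x⟫, ‖x‖ ^ 2) ∈ {p : ℝ × ℝ | p.1 ∈ T ∧ p.2 < ρ ^ 2} ↔
        x ∈ {x : EuclideanSpace ℝ (Fin (n + 1)) | ⟪u, x⟫ ∈ T ∧ ‖x‖ < ρ} := and_congr_right' this
    by_cases hx : x ∈ {x : EuclideanSpace ℝ (Fin (n + 1)) | ⟪u, x⟫ ∈ T ∧ ‖x‖ < ρ}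
    · rw [Set.indicator_of_mem hx, Set.indicator_of_mem (hiff.2 hx)]; rfl
    · rw [Set.indicator_of_notMem hx, Set.indicator_of_notMem (mt hiff.1 hx)]
  have hm1 : MeasurableSet {x : EuclideanSpace ℝ (Fin (n + 1)) | ⟪u, x⟫ ∈ T ∧ ‖x‖ < ρ} :=
    ((by fun_prop : Measurable fun x : EuclideanSpace ℝ (Fin (n + 1)) => ⟪u, x⟫) hTm).inter
      (measurableSet_lt measurable_norm measurable_const)
  rw [lintegral_congr e1, lintegral_indicator_one hm1] at hl
  rw [hl]
  have e2 : ∀ s : ℝ, ∫⁻ y : EuclideanSpace ℝ (Fin n),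
      {p : ℝ × ℝ | p.1 ∈ T ∧ p.2 < ρ ^ 2}.indicator (1 : ℝ × ℝ → ℝ≥0∞) (s, s ^ 2 + ‖y‖ ^ 2) =
      T.indicator (fun s => (Set.Ioo (-ρ) ρ).indicator
        (fun s => ENNReal.ofReal (unitBallVol n * sliceProfile n ρ s)) s) s := by
    intro s
    by_cases hs : s ∈ T
    · by_cases hs2 : s ∈ Set.Ioo (-ρ) ρ
      · have hpos : 0 < ρ ^ 2 - s ^ 2 := by nlinarith [hs2.1, hs2.2]
        have e3 : ∀ y : EuclideanSpace ℝ (Fin n),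
            {p : ℝ × ℝ | p.1 ∈ T ∧ p.2 < ρ ^ 2}.indicator (1 : ℝ × ℝ → ℝ≥0∞) (s, s ^ 2 + ‖y‖ ^ 2) =
            (Metric.ball (0 : EuclideanSpace ℝ (Fin n)) (Real.sqrt (ρ ^ 2 - s ^ 2))).indicator 1 y := by
          intro y
          have : s ^ 2 + ‖y‖ ^ 2 < ρ ^ 2 ↔ ‖y‖ < Real.sqrt (ρ ^ 2 - s ^ 2) := by
            rw [Real.lt_sqrt (norm_nonneg _), lt_sub_iff_add_lt']
          simp [Set.indicator, hs, this]
        rw [lintegral_congr e3, lintegral_indicator_one measurableSet_ball, volume_ball_eq_ofReal,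
          ballVol_eq n (Real.sqrt_pos.2 hpos)]
        simp [hs, hs2, sliceProfile]
      · have e3 : ∀ y : EuclideanSpace ℝ (Fin n),
            {p : ℝ × ℝ | p.1 ∈ T ∧ p.2 < ρ ^ 2}.indicator (1 : ℝ × ℝ → ℝ≥0∞)
              (s, s ^ 2 + ‖y‖ ^ 2) = 0 := by
          intro y
          have h3 : ρ ^ 2 ≤ s ^ 2 := by
            by_contra hlt
            exact hs2 (abs_lt.1 (abs_lt_of_sq_lt_sq (not_le.1 hlt) hρ.le))
          have : ¬ s ^ 2 + ‖y‖ ^ 2 < ρ ^ 2 := by nlinarith [sq_nonneg ‖y‖]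
          simp [Set.indicator, this]
        rw [lintegral_congr e3]
        simp [hs, hs2]
    · simp [hs]
  rw [lintegral_congr e2, lintegral_indicator hTm, setLIntegral_congr hT,
    setLIntegral_indicator measurableSet_Ioo]
  have e4 : Set.Ioo (-ρ) ρ ∩ Set.Ioi h = Set.Ioo h ρ := by
    ext s; simp only [Set.mem_inter_iff, Set.mem_Ioo, Set.mem_Ioi]
    constructor
    · rintro ⟨⟨_, h4⟩, h5⟩; exact ⟨h5, h4⟩
    · rintro ⟨h4, h5⟩; exact ⟨⟨by linarith, h5⟩, h4⟩
  have hu := unitBallVol_pos n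
  rw [e4, setLIntegral_congr Ioo_ae_eq_Ioc, ← intervalIntegral.integral_const_mul,
    intervalIntegral.integral_of_le h2, ofReal_integral_eq_lintegral_ofReal]
  · exact ((continuous_const.mul (continuous_sliceProfile n ρ)).intervalIntegrable _ _).1
  · exact Eventually.of_forall fun s => mul_nonneg hu.le (sliceProfile_nonneg _ _ _)

/-- `Φ(r) = 2 ω_n ∫_0^{r/2} (ρ² - s²)_+^{n/2} ds`. -/
def overlapLoss (n : ℕ) (ρ r : ℝ) : ℝ :=
  2 * (unitBallVol n * ∫ s in (0 : ℝ)..(r / 2), sliceProfile n ρ s)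

lemma intervalIntegrable_sliceProfile (n : ℕ) (ρ a b : ℝ) :
    IntervalIntegrable (sliceProfile n ρ) volume a b :=
  (continuous_sliceProfile n ρ).intervalIntegrable _ _

lemma ballVol_succ_eq_integral (n : ℕ) {ρ : ℝ} (hρ : 0 < ρ) :
    ballVol (n + 1) ρ = overlapLoss n ρ (2 * ρ) := by
  have h := volume_cap (u := (EuclideanSpace.single 0 1 : EuclideanSpace ℝ (Fin (n + 1))))
    (by simp) hρ (h := -ρ) le_rfl (by linarith) measurableSet_Ioi (ae_eq_refl _)
  have e : {x : EuclideanSpace ℝ (Fin (n + 1)) |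
      ⟪(EuclideanSpace.single 0 1 : EuclideanSpace ℝ (Fin (n + 1))), x⟫ ∈ Set.Ioi (-ρ) ∧ ‖x‖ < ρ} =
      Metric.ball 0 ρ := by
    ext x
    simp only [Set.mem_ofPred_eq, Set.mem_Ioi, mem_ball_zero_iff, and_iff_right_iff_imp]
    intro hx
    have := abs_real_inner_le_norm
      (EuclideanSpace.single 0 1 : EuclideanSpace ℝ (Fin (n + 1))) x
    rw [show ‖(EuclideanSpace.single 0 1 : EuclideanSpace ℝ (Fin (n + 1)))‖ = 1 by simp,
      one_mul] at this
    linarith [(abs_le.1 this).1]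
  have hu := unitBallVol_pos n
  have hsym : ∫ s in (-ρ)..0, sliceProfile n ρ s = ∫ s in (0 : ℝ)..ρ, sliceProfile n ρ s := by
    have := intervalIntegral.integral_comp_neg (f := sliceProfile n ρ) (a := 0) (b := ρ)
    rw [neg_zero] at this
    rw [← this]
    simp [sliceProfile]
  have hpos : 0 ≤ ∫ s in (-ρ)..ρ, sliceProfile n ρ s :=
    intervalIntegral.integral_nonneg (by linarith) fun s _ => sliceProfile_nonneg n ρ s
  have hbv : 0 ≤ ballVol (n + 1) ρ := measureReal_nonneg
  rw [e, volume_ball_eq_ofReal, ENNReal.ofReal_eq_ofReal_iff hbv (by positivity),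
    ← intervalIntegral.integral_add_adjacent_intervals (intervalIntegrable_sliceProfile n ρ _ 0)
      (intervalIntegrable_sliceProfile n ρ _ _), hsym] at h
  rw [h, overlapLoss, mul_div_cancel_left₀ _ two_ne_zero]
  ring

/-- The hyperplane bisecting the segment from `0` to `z` cuts the lens into two caps, which `x ↦ z -
x` exchanges. One of them is closed along the cut. -/
lemma ballOverlap_eq_cap {n : ℕ} {ρ : ℝ} (hρ : 0 < ρ) {z : EuclideanSpace ℝ (Fin (n + 1))}
    (hz0 : z ≠ 0) (hz : ‖z‖ ≤ 2 * ρ) :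
    ballOverlap ρ z = 2 * (unitBallVol n * ∫ s in (‖z‖ / 2)..ρ, sliceProfile n ρ s) := by
  set r := ‖z‖ with hr
  have hr0 : 0 < r := norm_pos_iff.2 hz0
  set u := r⁻¹ • z with hu
  have hun : ‖u‖ = 1 := by simp [hu, norm_smul, ← hr, abs_of_pos hr0, hr0.ne']
  have hzu : z = r • u := by simp [hu, smul_smul, hr0.ne']
  have huz : ⟪u, z⟫ = r := by rw [hzu, real_inner_smul_right, real_inner_self_eq_norm_sq, hun]; simp
  have hdist : ∀ x, ‖x - z‖ ^ 2 = ‖x‖ ^ 2 - 2 * r * ⟪u, x⟫ + r ^ 2 := by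
    intro x
    rw [norm_sub_sq_real, ← hr]
    conv_lhs => rw [hzu, real_inner_smul_right, real_inner_comm]
    ring
  set I := Metric.ball (0 : EuclideanSpace ℝ (Fin (n + 1))) ρ ∩ Metric.ball z ρ with hI
  have hmem : ∀ x, x ∈ I ↔ ‖x‖ < ρ ∧ ‖x - z‖ < ρ := by
    intro x; simp [hI, dist_eq_norm]
  set H := {x : EuclideanSpace ℝ (Fin (n + 1)) | r / 2 < ⟪u, x⟫} with hH
  have hHm : MeasurableSet H := measurableSet_lt measurable_const (by fun_prop)
  have c1 := volume_cap hun hρ (h := r / 2) (by linarith) (by linarith) measurableSet_Ioi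
    (ae_eq_refl _)
  have c2 := volume_cap hun hρ (h := r / 2) (by linarith) (by linarith) measurableSet_Ici
    (Ioi_ae_eq_Ici).symm
  have p1 : I ∩ H = {x | ⟪u, x⟫ ∈ Set.Ioi (r / 2) ∧ ‖x‖ < ρ} := by
    ext x
    simp only [Set.mem_inter_iff, hmem, hH, Set.mem_ofPred_eq, Set.mem_Ioi]
    constructor
    · rintro ⟨⟨h1, _⟩, h2⟩; exact ⟨h2, h1⟩
    · rintro ⟨h2, h1⟩
      refine ⟨⟨h1, lt_of_pow_lt_pow_left₀ 2 hρ.le ?_⟩, h2⟩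
      rw [hdist]
      nlinarith [norm_nonneg x]
  have p2 : volume (I \ H) = volume {x | ⟪u, x⟫ ∈ Set.Ici (r / 2) ∧ ‖x‖ < ρ} := by
    have hmp : MeasurePreserving (fun x : EuclideanSpace ℝ (Fin (n + 1)) => z - x) volume volume :=
      Measure.measurePreserving_sub_left volume z
    have hme : MeasurableSet {x : EuclideanSpace ℝ (Fin (n + 1)) |
        ⟪u, x⟫ ∈ Set.Ici (r / 2) ∧ ‖x‖ < ρ} :=
      (measurableSet_le measurable_const (by fun_prop)).inter
        (measurableSet_lt measurable_norm measurable_const)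
    rw [← hmp.measure_preimage hme.nullMeasurableSet]
    congr 1
    ext x
    simp only [Set.mem_sdiff, hmem, hH, Set.mem_ofPred_eq, Set.mem_preimage, Set.mem_Ici,
      inner_sub_right, huz, norm_sub_rev z x]
    constructor
    · rintro ⟨⟨_, h1⟩, h2⟩; exact ⟨by linarith, h1⟩
    · rintro ⟨h2, h1⟩
      have h3 : ⟪u, x⟫ ≤ r / 2 := by linarith
      refine ⟨⟨lt_of_pow_lt_pow_left₀ 2 hρ.le ?_, h1⟩, by linarith⟩
      have := hdist x
      nlinarith [norm_nonneg (x - z)]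
  have hun' := unitBallVol_pos n
  have hpos : 0 ≤ ∫ s in (r / 2)..ρ, sliceProfile n ρ s :=
    intervalIntegral.integral_nonneg (by linarith) fun s _ => sliceProfile_nonneg n ρ s
  have hvol : volume I = ENNReal.ofReal (2 * (unitBallVol n * ∫ s in (r / 2)..ρ, sliceProfile n ρ s)) := by
    rw [← measure_inter_add_sdiff I hHm, p2, p1, c1, c2, ← ENNReal.ofReal_add (by positivity)
      (by positivity), two_mul]
  rw [ballOverlap, measureReal_def, ← hI, hvol, ENNReal.toReal_ofReal (by positivity)]

lemma ballOverlap_zero {d : ℕ} (ρ : ℝ) : ballOverlap ρ (0 : EuclideanSpace ℝ (Fin d)) = ballVol d ρ := by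
  simp [ballOverlap, ballVol]

lemma ballOverlap_eq_zero {d : ℕ} {ρ : ℝ} {z : EuclideanSpace ℝ (Fin d)} (hz : 2 * ρ ≤ ‖z‖) :
    ballOverlap ρ z = 0 := by
  have : Metric.ball (0 : EuclideanSpace ℝ (Fin d)) ρ ∩ Metric.ball z ρ = ∅ := by
    ext x
    simp only [Set.mem_inter_iff, Metric.mem_ball, dist_eq_norm,
      Set.mem_empty_iff_false, iff_false, not_and, not_lt]
    intro hx
    have := norm_sub_norm_le z x
    rw [sub_zero] at hx
    rw [norm_sub_rev] at this
    linarith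
  simp [ballOverlap, this]

lemma ballOverlap_eq_sub {n : ℕ} {ρ : ℝ} (hρ : 0 < ρ) {z : EuclideanSpace ℝ (Fin (n + 1))}
    (hz : ‖z‖ ≤ 2 * ρ) :
    ballOverlap ρ z = ballVol (n + 1) ρ - overlapLoss n ρ ‖z‖ := by
  rcases eq_or_ne z 0 with rfl | hz0
  · simp [ballOverlap_zero, overlapLoss]
  · rw [ballOverlap_eq_cap hρ hz0 hz, ballVol_succ_eq_integral n hρ, overlapLoss, overlapLoss,
      mul_div_cancel_left₀ _ two_ne_zero,
      ← intervalIntegral.integral_add_adjacent_intervals (intervalIntegrable_sliceProfile n ρ 0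
        (‖z‖ / 2)) (intervalIntegrable_sliceProfile n ρ _ ρ)]
    ring

lemma hasDerivAt_overlapLoss (n : ℕ) (ρ r : ℝ) :
    HasDerivAt (overlapLoss n ρ) (unitBallVol n * sliceProfile n ρ (r / 2)) r := by
  have h1 : HasDerivAt (fun u => ∫ s in (0 : ℝ)..u, sliceProfile n ρ s)
      (sliceProfile n ρ (r / 2)) (r / 2) :=
    intervalIntegral.integral_hasDerivAt_right (intervalIntegrable_sliceProfile n ρ _ _)
      (continuous_sliceProfile n ρ).aestronglyMeasurable.stronglyMeasurableAtFilter
      (continuous_sliceProfile n ρ).continuousAt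
  have h2 : HasDerivAt (fun r : ℝ => r / 2) (1 / 2) r := (hasDerivAt_id r).div_const 2
  have h3 := ((h1.comp r h2).const_mul (unitBallVol n)).const_mul 2
  convert! h3 using 1
  ring

/-- A quantitative bound for the overlap of two balls that barely intersect. -/
lemma ballOverlap_le {n : ℕ} {ρ : ℝ} (hρ : 0 < ρ) {z : EuclideanSpace ℝ (Fin (n + 1))} {δ : ℝ}
    (hδ0 : 0 ≤ δ) (hδ : δ < 2 * ρ) (hz : 2 * ρ - δ ≤ ‖z‖) :
    ballOverlap ρ z ≤ unitBallVol n * δ * Real.sqrt (ρ * δ) ^ n := by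
  have hu := unitBallVol_pos n
  by_cases hz2 : 2 * ρ ≤ ‖z‖
  · rw [ballOverlap_eq_zero hz2]; positivity
  · push Not at hz2
    have hz0 : z ≠ 0 := by
      rintro rfl; rw [norm_zero] at hz; linarith
    rw [ballOverlap_eq_cap hρ hz0 hz2.le]
    -- Here `ρ - s ≤ δ/2` and `ρ + s ≤ 2ρ`, hence `ρ² - s² ≤ ρδ`.
    have hb : ∀ s ∈ Set.Icc (‖z‖ / 2) ρ, sliceProfile n ρ s ≤ Real.sqrt (ρ * δ) ^ n := by
      intro s hs
      unfold sliceProfile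
      refine pow_le_pow_left₀ (Real.sqrt_nonneg _) (Real.sqrt_le_sqrt ?_) n
      nlinarith [hs.1, hs.2]
    have h1 := intervalIntegral.integral_mono_on (by linarith : ‖z‖ / 2 ≤ ρ)
      (intervalIntegrable_sliceProfile n ρ _ _)
      (intervalIntegrable_const (μ := volume) (c := Real.sqrt (ρ * δ) ^ n)) hb
    rw [intervalIntegral.integral_const, smul_eq_mul] at h1
    have h2 : (ρ - ‖z‖ / 2) * Real.sqrt (ρ * δ) ^ n ≤ δ / 2 * Real.sqrt (ρ * δ) ^ n := by
      gcongr; linarith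
    calc 2 * (unitBallVol n * ∫ s in (‖z‖ / 2)..ρ, sliceProfile n ρ s)
        ≤ 2 * (unitBallVol n * (δ / 2 * Real.sqrt (ρ * δ) ^ n)) := by gcongr; linarith
      _ = _ := by ring

/-! ### The self-energy of a ball -/

/-- Bernoulli's inequality together with `√(1 - w) ≥ 1 - w` on `[0, 1]`; for `w > 1` the root is `0`
by convention. The linear bound in `w` removes the singularities at the origin below. -/
lemma one_sub_sqrt_pow_le (n : ℕ) {w : ℝ} (hw : 0 ≤ w) :
    0 ≤ 1 - Real.sqrt (1 - w) ^ n ∧ 1 - Real.sqrt (1 - w) ^ n ≤ n * w := by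
  have hs1 : Real.sqrt (1 - w) ≤ 1 := by rw [Real.sqrt_le_one]; linarith
  refine ⟨sub_nonneg.2 (pow_le_one₀ (Real.sqrt_nonneg _) hs1), ?_⟩
  rcases Nat.eq_zero_or_pos n with rfl | hn
  · simp
  · have hn1 : (1 : ℝ) ≤ n := by exact_mod_cast hn
    by_cases hw1 : w ≤ 1
    · have h1 : 1 - w ≤ Real.sqrt (1 - w) := by
        refine Real.le_sqrt_of_sq_le ?_
        nlinarith
      have h2 := one_add_mul_le_pow (a := -w) (by linarith) n
      have h3 := pow_le_pow_left₀ (by linarith : 0 ≤ 1 - w) h1 n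
      rw [← sub_eq_add_neg] at h2
      linarith
    · have : 0 ≤ Real.sqrt (1 - w) ^ n := by positivity
      nlinarith

lemma sliceProfile_eq (n : ℕ) {ρ : ℝ} (hρ : 0 < ρ) (s : ℝ) :
    sliceProfile n ρ (s / 2) = ρ ^ n * Real.sqrt (1 - (s / (2 * ρ)) ^ 2) ^ n := by
  rw [sliceProfile, ← mul_pow]
  congr 1
  rw [show ρ ^ 2 - (s / 2) ^ 2 = ρ ^ 2 * (1 - (s / (2 * ρ)) ^ 2) by field_simp,
    Real.sqrt_mul (by positivity), Real.sqrt_sq hρ.le]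

/-- The function `(c - ω_n (ρ² - s²/4)_+^{n/2}) / s`, where `c = ω_n ρ^n`. -/
def profileQuotient (n : ℕ) (ρ s : ℝ) : ℝ :=
  (unitBallVol n * ρ ^ n - unitBallVol n * sliceProfile n ρ (s / 2)) / s

/-- The numerator is of order `s²`, so the quotient tends to `0`, which is also its value at `s = 0`
under division by zero. This makes it continuous. -/
lemma abs_profileQuotient_le (n : ℕ) {ρ : ℝ} (hρ : 0 < ρ) (s : ℝ) :
    |profileQuotient n ρ s| ≤ unitBallVol n * ρ ^ n * n / (2 * ρ) ^ 2 * |s| := by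
  have hu := unitBallVol_pos n
  obtain ⟨h1, h2⟩ := one_sub_sqrt_pow_le n (sq_nonneg (s / (2 * ρ)))
  rcases eq_or_ne s 0 with rfl | hs
  · simp [profileQuotient]
  rw [profileQuotient, sliceProfile_eq n hρ, ← mul_assoc, ← mul_one_sub, abs_div,
    div_le_iff₀ (abs_pos.2 hs), abs_of_nonneg (by positivity)]
  calc _ ≤ unitBallVol n * ρ ^ n * (n * (s / (2 * ρ)) ^ 2) := by gcongr
    _ = _ := by rw [mul_assoc _ |s|, ← sq, sq_abs, div_pow]; ring

lemma continuous_profileQuotient (n : ℕ) {ρ : ℝ} (hρ : 0 < ρ) : Continuous (profileQuotient n ρ) := by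
  rw [continuous_iff_continuousAt]
  intro s
  rcases eq_or_ne s 0 with rfl | hs
  · have h0 : profileQuotient n ρ 0 = 0 := by simp [profileQuotient]
    rw [ContinuousAt, h0]
    refine squeeze_zero_norm (fun s => abs_profileQuotient_le n hρ s) ?_
    have : Continuous fun s : ℝ => unitBallVol n * ρ ^ n * n / (2 * ρ) ^ 2 * |s| := by fun_prop
    simpa using this.tendsto 0
  · unfold profileQuotient
    have := continuous_sliceProfile n ρ
    exact ContinuousAt.div (by fun_prop) continuousAt_id hs

lemma genHarmonic_eq (n : ℕ) :
    genHarmonic ((n : ℝ) / 2) = ∫ w in (0 : ℝ)..1, (1 - Real.sqrt (1 - w) ^ n) / w := by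
  have h := intervalIntegral.integral_comp_sub_left (a := 0) (b := 1)
    (fun w : ℝ => (1 - Real.sqrt (1 - w) ^ n) / w) 1
  simp only [sub_zero, sub_self, sub_sub_cancel] at h
  rw [← h, genHarmonic]
  refine intervalIntegral.integral_congr fun t ht => ?_
  rw [Set.uIcc_of_le zero_le_one] at ht
  rw [Real.sqrt_eq_rpow, ← Real.rpow_natCast, ← Real.rpow_mul ht.1]
  congr 3
  ring

/-- The substitution `w = (s / 2ρ)²` gives `ds / s = dw / (2w)`, the origin of the factor `1/2` in
front of the harmonic number. -/
lemma integral_profileQuotient (n : ℕ) {ρ : ℝ} (hρ : 0 < ρ) :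
    ∫ s in (0 : ℝ)..(2 * ρ), profileQuotient n ρ s =
      unitBallVol n * ρ ^ n * (genHarmonic ((n : ℝ) / 2) / 2) := by
  set G : ℝ → ℝ := fun w => (1 - Real.sqrt (1 - w) ^ n) / w with hG
  have hr : 0 < 2 * ρ := by positivity
  have e : ∀ s : ℝ, (G ∘ fun s => (s / (2 * ρ)) ^ 2) s * (2 * (s / (2 * ρ)) * (1 / (2 * ρ))) *
      (unitBallVol n * ρ ^ n / 2) = profileQuotient n ρ s := by
    intro s
    rcases eq_or_ne s 0 with rfl | hs
    · simp [profileQuotient]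
    simp only [hG, Function.comp_apply, profileQuotient, sliceProfile_eq n hρ]
    field_simp
  have hGint : IntegrableOn G (Set.Icc 0 1) := by
    refine Measure.integrableOn_of_bounded (M := n) (by simp) ?_ ?_
    · have : Measurable G := by rw [hG]; fun_prop
      exact this.aestronglyMeasurable
    · filter_upwards [ae_restrict_mem measurableSet_Icc] with w hw
      obtain ⟨h1, h2⟩ := one_sub_sqrt_pow_le n hw.1
      rcases hw.1.eq_or_lt with h0 | h0
      · simp [hG, ← h0]
      · rw [hG, Real.norm_eq_abs, abs_of_nonneg (by positivity), div_le_iff₀ h0]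
        exact h2
  have h := intervalIntegral.integral_comp_mul_deriv''' (a := 0) (b := 2 * ρ)
    (f := fun s => (s / (2 * ρ)) ^ 2) (f' := fun s => 2 * (s / (2 * ρ)) * (1 / (2 * ρ))) (g := G)
    (by fun_prop) ?_ ?_ ?_ ?_
  · have hc : ∫ s in (0 : ℝ)..(2 * ρ), profileQuotient n ρ s =
        (∫ s in (0 : ℝ)..(2 * ρ), (G ∘ fun s => (s / (2 * ρ)) ^ 2) s *
          (2 * (s / (2 * ρ)) * (1 / (2 * ρ)))) * (unitBallVol n * ρ ^ n / 2) := by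
      rw [← intervalIntegral.integral_mul_const]
      exact intervalIntegral.integral_congr fun s _ => (e s).symm
    rw [hc, h, genHarmonic_eq, div_self hr.ne']
    norm_num
    ring
  · intro x _
    have := ((hasDerivAt_id x).div_const (2 * ρ)).pow 2
    exact HasDerivAt.hasDerivWithinAt (by simpa using! this)
  · rw [min_eq_left hr.le, max_eq_right hr.le]
    refine ContinuousOn.div (by fun_prop) continuousOn_id ?_
    rintro w ⟨s, hs, rfl⟩
    have := hs.1
    change (s / (2 * ρ)) ^ 2 ≠ 0
    positivity
  · refine hGint.mono_set ?_
    rw [Set.uIcc_of_le hr.le]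
    rintro w ⟨s, hs, rfl⟩
    have h1 : s / (2 * ρ) ≤ 1 := (div_le_one hr).2 hs.2
    have h2 : 0 ≤ s / (2 * ρ) := div_nonneg hs.1 hr.le
    exact ⟨by positivity, pow_le_one₀ h2 h1⟩
  · have : ContinuousOn (fun s => (G ∘ fun s => (s / (2 * ρ)) ^ 2) s *
        (2 * (s / (2 * ρ)) * (1 / (2 * ρ)))) (Set.uIcc 0 (2 * ρ)) := by
      have hu := unitBallVol_pos n
      have hc : (fun s => (G ∘ fun s => (s / (2 * ρ)) ^ 2) s * (2 * (s / (2 * ρ)) * (1 / (2 * ρ)))) =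
          fun s => profileQuotient n ρ s / (unitBallVol n * ρ ^ n / 2) := by
        funext s
        rw [← e s, mul_div_cancel_right₀ _ (by positivity)]
      rw [hc]
      exact ((continuous_profileQuotient n hρ).div_const _).continuousOn
    exact this.integrableOn_compact isCompact_uIcc

/-- Antiderivative of `r ↦ (c r - Φ(r)) / r²`. -/
lemma integral_near_part (n : ℕ) {ρ : ℝ} (hρ : 0 < ρ) :
    IntervalIntegrable (fun r => (unitBallVol n * ρ ^ n * r - overlapLoss n ρ r) / r ^ 2)
      volume 0 (2 * ρ) ∧
    ∫ r in (0 : ℝ)..(2 * ρ), (unitBallVol n * ρ ^ n * r - overlapLoss n ρ r) / r ^ 2 =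
      unitBallVol n * ρ ^ n * (genHarmonic ((n : ℝ) / 2) / 2) -
        (unitBallVol n * ρ ^ n - overlapLoss n ρ (2 * ρ) / (2 * ρ)) := by
  set c := unitBallVol n * ρ ^ n with hc
  have hr : 0 < 2 * ρ := by positivity
  have hu := unitBallVol_pos n
  set D : ℝ → ℝ := fun r => c * r - overlapLoss n ρ r with hD
  have hDd : ∀ r, HasDerivAt D (c - unitBallVol n * sliceProfile n ρ (r / 2)) r := by
    intro r
    have := ((hasDerivAt_id r).const_mul c).sub (hasDerivAt_overlapLoss n ρ r)
    simpa [hD] using! this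
  have hDc : Continuous D := continuous_iff_continuousAt.2 fun r => (hDd r).continuousAt
  have hD0 : D 0 = 0 := by simp [hD, overlapLoss]
  have hPd : ∀ r, HasDerivAt (fun r => ∫ s in (0 : ℝ)..r, profileQuotient n ρ s)
      (profileQuotient n ρ r) r := fun r =>
    intervalIntegral.integral_hasDerivAt_right
      ((continuous_profileQuotient n hρ).intervalIntegrable _ _)
      (continuous_profileQuotient n hρ).aestronglyMeasurable.stronglyMeasurableAtFilter
      (continuous_profileQuotient n hρ).continuousAt
  -- Integration by parts: `D / r²` is the derivative of `-D / r` plus `D' / r`, and `D' / r` is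
  -- `profileQuotient`.
  set g : ℝ → ℝ := fun r => (∫ s in (0 : ℝ)..r, profileQuotient n ρ s) - D r / r with hg
  have hgd : ∀ r, 0 < r → HasDerivAt g (D r / r ^ 2) r := by
    intro r hr
    have := (hPd r).sub ((hDd r).div (hasDerivAt_id r) hr.ne')
    refine this.congr_deriv ?_
    simp only [profileQuotient, id, ← hc]
    field_simp
    ring
  have hgc : Continuous g := by
    refine (continuous_iff_continuousAt.2 fun r => (hPd r).continuousAt).sub ?_
    rw [continuous_iff_continuousAt]
    intro r
    rcases eq_or_ne r 0 with rfl | hr0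
    -- At the origin `D / r` tends to `D'(0) = 0`, in agreement with the default value of the
    -- quotient.
    · rw [continuousAt_iff_punctured_nhds]
      have := (hasDerivAt_iff_tendsto_slope_zero.1 (hDd 0))
      simp only [zero_add, hD0, sub_zero, smul_eq_mul, zero_div, div_zero] at this ⊢
      have h0 : c - unitBallVol n * sliceProfile n ρ 0 = 0 := by
        simp [sliceProfile, hc, Real.sqrt_sq hρ.le]
      rw [h0] at this
      exact this.congr fun t => by rw [div_eq_inv_mul]
    · exact hDc.continuousAt.div continuousAt_id hr0
  -- Nonnegativity of `D / r²` makes it integrable as the derivative of a continuous function,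
  -- without a separate bound at `0`.
  have hDnn : ∀ r, 0 < r → 0 ≤ D r := by
    have hmono : MonotoneOn D (Set.Ici 0) := by
      refine monotoneOn_of_deriv_nonneg (convex_Ici 0) hDc.continuousOn
        (fun r _ => (hDd r).differentiableAt.differentiableWithinAt) fun r _ => ?_
      rw [(hDd r).deriv, hc, sliceProfile_eq n hρ, ← mul_assoc, ← mul_one_sub]
      have := (one_sub_sqrt_pow_le n (sq_nonneg (r / (2 * ρ)))).1
      positivity
    intro r hr
    rw [← hD0]
    exact hmono (by simp) hr.le hr.le
  have hint : IntervalIntegrable (fun r => D r / r ^ 2) volume 0 (2 * ρ) := by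
    refine intervalIntegral.intervalIntegrable_deriv_of_nonneg hgc.continuousOn
      (fun r hr' => hgd r ?_) (fun r hr' => ?_)
    · rw [min_eq_left hr.le] at hr'; exact hr'.1
    · rw [min_eq_left hr.le] at hr'
      have := hDnn r hr'.1
      positivity
  refine ⟨hint, ?_⟩
  have hval := intervalIntegral.integral_eq_sub_of_hasDerivAt_of_le hr.le hgc.continuousOn
    (fun r hr' => hgd r hr'.1) hint
  simp only [hg, intervalIntegral.integral_same, hD0, div_zero, sub_zero,
    integral_profileQuotient n hρ, ← hc] at hval
  change ∫ r in (0 : ℝ)..(2 * ρ), D r / r ^ 2 = _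
  rw [hval]
  simp only [hD]
  field_simp

/-- The price of moving the cutoff of the linear compensator: the integral of `c / r` between the
two radii. -/
lemma integral_cutoff_difference (c : ℝ) {a b : ℝ} (ha : 0 < a) (hb : 0 < b) :
    IntegrableOn (fun r => ((if r < a then c * r else 0) - (if r < b then c * r else 0)) / r ^ 2)
      (Set.Ioi 0) ∧
    ∫ r in Set.Ioi (0 : ℝ), ((if r < a then c * r else 0) - (if r < b then c * r else 0)) / r ^ 2 =
      c * (Real.log a - Real.log b) := by
  wlog hab : a ≤ b generalizing a b
  · obtain ⟨h1, h2⟩ := this hb ha (le_of_not_ge hab)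
    have e : (fun r : ℝ => ((if r < a then c * r else 0) - (if r < b then c * r else 0)) / r ^ 2) =
        fun r => -(((if r < b then c * r else 0) - (if r < a then c * r else 0)) / r ^ 2) := by
      funext r; ring
    rw [e]
    refine ⟨h1.neg, ?_⟩
    rw [integral_neg, h2]; ring
  · have e : Set.EqOn (fun r : ℝ => ((if r < a then c * r else 0) -
        (if r < b then c * r else 0)) / r ^ 2) ((Set.Ico a b).indicator fun r => -c * (1 / r))
        (Set.Ioi 0) := by
      intro r hr
      have hr' : (0 : ℝ) < r := hr
      by_cases h1 : r < a
      · have h2 : r < b := h1.trans_le hab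
        have h3 : r ∉ Set.Ico a b := fun h => absurd h.1 (not_le.2 h1)
        simp [h1, h2, h3]
      · by_cases h2 : r < b
        · have h3 : r ∈ Set.Ico a b := ⟨not_lt.1 h1, h2⟩
          simp only [h1, h2, if_true, if_false, Set.indicator_of_mem h3]
          field_simp; ring
        · have h3 : r ∉ Set.Ico a b := fun h => h2 h.2
          simp [h1, h2, h3]
    have hii : IntervalIntegrable (fun r : ℝ => -c * (1 / r)) volume a b := by
      refine ContinuousOn.intervalIntegrable ?_
      rw [Set.uIcc_of_le hab]
      refine ContinuousOn.mul continuousOn_const (ContinuousOn.div continuousOn_const continuousOn_id ?_)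
      intro x hx; exact (ha.trans_le hx.1).ne'
    have hio : IntegrableOn (fun r : ℝ => -c * (1 / r)) (Set.Ico a b) :=
      (intervalIntegrable_iff_integrableOn_Ico_of_le hab).1 hii
    have hsub : Set.Ioi (0 : ℝ) ∩ Set.Ico a b = Set.Ico a b :=
      Set.inter_eq_right.2 fun r hr => ha.trans_le hr.1
    constructor
    · refine (integrableOn_congr_fun e measurableSet_Ioi).2 ?_
      exact ((integrable_indicator_iff measurableSet_Ico).2 hio).integrableOn
    · rw [setIntegral_congr_fun measurableSet_Ioi e, setIntegral_indicator measurableSet_Ico, hsub,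
        setIntegral_congr_set (Ico_ae_eq_Ioc), ← intervalIntegral.integral_of_le hab,
        intervalIntegral.integral_const_mul, integral_one_div_of_pos ha hb,
        Real.log_div hb.ne' ha.ne']
      ring

/-- With the cutoff placed at `2ρ`, where the overlap ends, the tail `-Φ(2ρ) / (2ρ)` cancels the
boundary term of the near part. Returning the cutoff to `1` contributes `-log (2ρ)`. -/
lemma integral_self_energy_radial (n : ℕ) {ρ : ℝ} (hρ : 0 < ρ) :
    IntegrableOn (fun r => ((if r < 1 then unitBallVol n * ρ ^ n * r else 0) -
      overlapLoss n ρ (min r (2 * ρ))) / r ^ 2) (Set.Ioi 0) ∧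
    ∫ r in Set.Ioi (0 : ℝ), ((if r < 1 then unitBallVol n * ρ ^ n * r else 0) -
      overlapLoss n ρ (min r (2 * ρ))) / r ^ 2 =
      unitBallVol n * ρ ^ n * (genHarmonic ((n : ℝ) / 2) / 2 - 1 - Real.log (2 * ρ)) := by
  set c := unitBallVol n * ρ ^ n with hc
  have hr : 0 < 2 * ρ := by positivity
  obtain ⟨k1, k2⟩ := integral_cutoff_difference c one_pos hr
  obtain ⟨m1, m2⟩ := integral_near_part n hρ
  set K1 : ℝ → ℝ := fun r => ((if r < 2 * ρ then c * r else 0) -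
    overlapLoss n ρ (min r (2 * ρ))) / r ^ 2 with hK1
  have e1 : Set.EqOn K1 (fun r => (c * r - overlapLoss n ρ r) / r ^ 2) (Set.Ioo 0 (2 * ρ)) := by
    intro r hr'
    simp [hK1, hr'.2, min_eq_left hr'.2.le]
  have e2 : Set.EqOn K1 (fun r => -overlapLoss n ρ (2 * ρ) * r ^ (-2 : ℝ)) (Set.Ioi (2 * ρ)) := by
    intro r hr'
    have h1 : 2 * ρ < r := hr'
    have h2 : 0 < r := hr.trans h1
    simp only [hK1, not_lt.2 h1.le, if_false, min_eq_right h1.le]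
    rw [Real.rpow_neg h2.le]
    norm_cast
    rw [zero_sub, div_eq_mul_inv]
  have i1 : IntegrableOn K1 (Set.Ioc 0 (2 * ρ)) := by
    rw [integrableOn_Ioc_iff_integrableOn_Ioo]
    refine (integrableOn_congr_fun e1 measurableSet_Ioo).2 ?_
    exact m1.1.mono_set Set.Ioo_subset_Ioc_self
  have i2 : IntegrableOn K1 (Set.Ioi (2 * ρ)) :=
    (integrableOn_congr_fun e2 measurableSet_Ioi).2
      ((integrableOn_Ioi_rpow_of_lt (by norm_num) hr).const_mul _)
  have hun : Set.Ioc 0 (2 * ρ) ∪ Set.Ioi (2 * ρ) = Set.Ioi 0 := Set.Ioc_union_Ioi_eq_Ioi hr.le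
  have i3 : IntegrableOn K1 (Set.Ioi 0) := by rw [← hun]; exact i1.union i2
  have e3 : (fun r => ((if r < 1 then c * r else 0) -
      overlapLoss n ρ (min r (2 * ρ))) / r ^ 2) = fun r => K1 r +
      ((if r < 1 then c * r else 0) - (if r < 2 * ρ then c * r else 0)) / r ^ 2 := by
    funext r; simp only [hK1]; ring
  rw [e3]
  refine ⟨i3.add k1, ?_⟩
  rw [integral_add i3 k1, k2, ← hun, setIntegral_union (Set.Ioc_disjoint_Ioi le_rfl)
    measurableSet_Ioi i1 i2, setIntegral_congr_fun measurableSet_Ioi e2, integral_const_mul,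
    integral_Ioi_rpow_of_lt (by norm_num) hr, integral_Ioc_eq_integral_Ioo,
    setIntegral_congr_fun measurableSet_Ioo e1, ← integral_Ioc_eq_integral_Ioo,
    ← intervalIntegral.integral_of_le hr.le, m2, Real.log_one]
  have : (2 * ρ) ^ (-2 + 1 : ℝ) = 1 / (2 * ρ) := by
    norm_num [Real.rpow_neg_one]
  rw [this]
  field_simp
  ring

/-- The contribution of a single ball to the energy integrand. -/
def selfIntegrand {d : ℕ} (ρ : ℝ) (z : EuclideanSpace ℝ (Fin d)) : ℝ :=
  (ballOverlap ρ z - ballVol d ρ +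
    (if ‖z‖ < 1 then unitBallVol (d - 1) * ρ ^ (d - 1) * ‖z‖ else 0)) / ‖z‖ ^ (d + 1)

lemma integral_selfIntegrand {d : ℕ} (hd : 1 ≤ d) {ρ : ℝ} (hρ : 0 < ρ) :
    Integrable (selfIntegrand ρ : EuclideanSpace ℝ (Fin d) → ℝ) ∧
    ∫ z : EuclideanSpace ℝ (Fin d), selfIntegrand ρ z = -unitBallVol (d - 1) *
      (Real.log (2 * ρ) + 1 - 1 / 2 * genHarmonic (((d : ℝ) - 1) / 2)) * sphereArea d ρ := by
  obtain ⟨n, rfl⟩ : ∃ n, d = n + 1 := ⟨d - 1, by omega⟩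
  simp only [Nat.add_sub_cancel]
  obtain ⟨h1, h2⟩ := integral_self_energy_radial n hρ
  set F : ℝ → ℝ := fun r => ((if r < 1 then unitBallVol n * ρ ^ n * r else 0) -
      overlapLoss n ρ (min r (2 * ρ))) / r ^ (n + 2) with hF
  have e1 : (selfIntegrand ρ : EuclideanSpace ℝ (Fin (n + 1)) → ℝ) = fun z => F ‖z‖ := by
    funext z
    have : ballOverlap ρ z = ballVol (n + 1) ρ - overlapLoss n ρ (min ‖z‖ (2 * ρ)) := by
      rcases le_total ‖z‖ (2 * ρ) with h | h
      · rw [min_eq_left h, ballOverlap_eq_sub hρ h]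
      · rw [min_eq_right h, ballOverlap_eq_zero h, ballVol_succ_eq_integral n hρ, sub_self]
    simp only [selfIntegrand, hF, this, Nat.add_sub_cancel]
    congr 1
    ring
  have e2 : Set.EqOn (fun r : ℝ => r ^ (Module.finrank ℝ (EuclideanSpace ℝ (Fin (n + 1))) - 1) • F r)
      (fun r => ((if r < 1 then unitBallVol n * ρ ^ n * r else 0) -
      overlapLoss n ρ (min r (2 * ρ))) / r ^ 2) (Set.Ioi 0) := by
    intro r hr
    have hr' : (0 : ℝ) < r := hr
    simp only [hF, finrank_euclideanSpace_fin, Nat.add_sub_cancel, smul_eq_mul, pow_add]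
    field_simp
  rw [e1]
  constructor
  · rw [integrable_fun_norm_addHaar, integrableOn_congr_fun e2 measurableSet_Ioi]
    exact h1
  · rw [integral_fun_norm_addHaar, setIntegral_congr_fun measurableSet_Ioi e2, h2,
      finrank_euclideanSpace_fin, nsmul_eq_mul, smul_eq_mul, sphereArea, unitBallVol, ballVol]
    simp only [unitBallVol, ballVol, Nat.add_sub_cancel]
    push_cast
    rw [add_sub_cancel_right]
    ring

/-! ### Bravais lattices -/

lemma bravais_eq_span_basis {d : ℕ} {v : Fin d → EuclideanSpace ℝ (Fin d)}
    (hv : LinearIndependent ℝ v) :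
    ∃ b : Module.Basis (Fin d) ℝ (EuclideanSpace ℝ (Fin d)), ⇑b = v := by
  rcases Nat.eq_zero_or_pos d with rfl | hd
  · exact ⟨Module.Basis.empty _, funext fun i => i.elim0⟩
  · have : Nonempty (Fin d) := ⟨⟨0, hd⟩⟩
    exact ⟨basisOfLinearIndependentOfCardEqFinrank hv (by simp), by simp⟩

lemma exists_fundamentalDomain {d : ℕ} {v : Fin d → EuclideanSpace ℝ (Fin d)}
    (hv : LinearIndependent ℝ v) :
    ∃ D : Set (EuclideanSpace ℝ (Fin d)), MeasurableSet D ∧ Bornology.IsBounded D ∧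
      IsAddFundamentalDomain (bravais v).toAddSubgroup D volume ∧
      volume D = ENNReal.ofReal (cellVol v) ∧ 0 < cellVol v := by
  obtain ⟨b, rfl⟩ := bravais_eq_span_basis hv
  have hb := ZSpan.fundamentalDomain_isBounded b
  have h1 : volume (ZSpan.fundamentalDomain b) = volume (parallelepiped b) :=
    measure_congr (ZSpan.fundamentalDomain_ae_parallelepiped b volume)
  have h2 : volume (ZSpan.fundamentalDomain b) < ∞ := hb.measure_lt_top
  have h3 : volume (ZSpan.fundamentalDomain b) = ENNReal.ofReal (cellVol b) := by
    rw [cellVol, ofReal_measureReal (h1 ▸ h2.ne), h1]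
  refine ⟨_, ZSpan.fundamentalDomain_measurableSet b, hb, ZSpan.isAddFundamentalDomain' b volume,
    h3, ?_⟩
  have h4 := ZSpan.measure_fundamentalDomain_ne_zero b
    (μ := (volume : Measure (EuclideanSpace ℝ (Fin d))))
  rw [h3] at h4
  simpa using h4

lemma finite_bravais_inter {d : ℕ} {v : Fin d → EuclideanSpace ℝ (Fin d)}
    (hv : LinearIndependent ℝ v) (r : ℝ) :
    {q | q ∈ bravais v ∧ ‖q‖ ≤ r}.Finite := by
  obtain ⟨b, rfl⟩ := bravais_eq_span_basis hv
  have h := ZSpan.setFinite_inter b (s := Metric.closedBall 0 r) Metric.isBounded_closedBall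
  refine h.subset ?_
  rintro q ⟨h1, h2⟩
  exact ⟨by simpa using h2, h1⟩

lemma countable_bravais {d : ℕ} {v : Fin d → EuclideanSpace ℝ (Fin d)}
    (hv : LinearIndependent ℝ v) : (bravais v : Set (EuclideanSpace ℝ (Fin d))).Countable := by
  have h : (bravais v : Set (EuclideanSpace ℝ (Fin d))) =
      ⋃ n : ℕ, {q | q ∈ bravais v ∧ ‖q‖ ≤ n} := by
    ext q
    simp only [SetLike.mem_coe, Set.mem_iUnion, Set.mem_ofPred_eq, exists_and_left, iff_self_and]
    exact fun _ => exists_nat_ge _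
  rw [h]
  exact Set.countable_iUnion fun n => (finite_bravais_inter hv n).countable

lemma countable_bravaisNonzero {d : ℕ} {v : Fin d → EuclideanSpace ℝ (Fin d)}
    (hv : LinearIndependent ℝ v) : (bravaisNonzero v).Countable :=
  (countable_bravais hv).mono fun _ h => h.1

/-- The set `Ω = ⋃_{q ∈ Λ} B_ρ(q)`. -/
def ballUnion {d : ℕ} (v : Fin d → EuclideanSpace ℝ (Fin d)) (ρ : ℝ) :
    Set (EuclideanSpace ℝ (Fin d)) := ⋃ q ∈ bravais v, Metric.ball q ρ

lemma isOpen_ballUnion {d : ℕ} (v : Fin d → EuclideanSpace ℝ (Fin d)) (ρ : ℝ) :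
    IsOpen (ballUnion v ρ) := isOpen_biUnion fun _ _ => Metric.isOpen_ball

lemma mem_ballUnion {d : ℕ} {v : Fin d → EuclideanSpace ℝ (Fin d)} {ρ : ℝ}
    {x : EuclideanSpace ℝ (Fin d)} : x ∈ ballUnion v ρ ↔ ∃ q ∈ bravais v, ‖x - q‖ < ρ := by
  simp [ballUnion, dist_eq_norm]

lemma add_mem_ballUnion {d : ℕ} {v : Fin d → EuclideanSpace ℝ (Fin d)} {ρ : ℝ}
    {q : EuclideanSpace ℝ (Fin d)} (hq : q ∈ bravais v) (x : EuclideanSpace ℝ (Fin d)) :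
    x + q ∈ ballUnion v ρ ↔ x ∈ ballUnion v ρ := by
  rw [mem_ballUnion, mem_ballUnion]
  constructor
  · rintro ⟨p, hp, h⟩
    exact ⟨p - q, sub_mem hp hq, by rwa [sub_sub_eq_add_sub]⟩
  · rintro ⟨p, hp, h⟩
    exact ⟨p + q, add_mem hp hq, by rwa [add_sub_add_right_eq_sub]⟩

lemma latticeBalls_eq {d : ℕ} (v : Fin d → EuclideanSpace ℝ (Fin d)) (ρ : ℝ) :
    latticeBalls v ρ = (ballUnion v ρ).indicator fun _ => 1 := rfl

lemma latticeBalls_add {d : ℕ} (v : Fin d → EuclideanSpace ℝ (Fin d)) (ρ : ℝ)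
    {q : EuclideanSpace ℝ (Fin d)} (hq : q ∈ bravais v) (x : EuclideanSpace ℝ (Fin d)) :
    latticeBalls v ρ (x + q) = latticeBalls v ρ x := by
  classical
  simp [latticeBalls_eq, Set.indicator_apply, add_mem_ballUnion hq]

lemma measurable_latticeBalls {d : ℕ} (v : Fin d → EuclideanSpace ℝ (Fin d)) (ρ : ℝ) :
    Measurable (latticeBalls v ρ) :=
  measurable_const.indicator (isOpen_ballUnion v ρ).measurableSet

lemma BallsFit.two_mul_le_norm {d : ℕ} {v : Fin d → EuclideanSpace ℝ (Fin d)} {ρ : ℝ}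
    (h : BallsFit v ρ) {q : EuclideanSpace ℝ (Fin d)} (hq : q ∈ bravaisNonzero v) :
    2 * ρ ≤ ‖q‖ := by
  have := h.2 q hq.1 0 (zero_mem _) hq.2
  rw [dist_zero_right] at this
  linarith

lemma ballsFit_iff {d : ℕ} {v : Fin d → EuclideanSpace ℝ (Fin d)} {ρ : ℝ} :
    BallsFit v ρ ↔ 0 < ρ ∧ ∀ q ∈ bravaisNonzero v, 2 * ρ ≤ ‖q‖ := by
  refine ⟨fun h => ⟨h.1, fun q hq => h.two_mul_le_norm hq⟩, fun h => ⟨h.1, fun p hp q hq hpq => ?_⟩⟩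
  have := h.2 (p - q) ⟨sub_mem hp hq, sub_ne_zero.2 hpq⟩
  rw [dist_eq_norm]; linarith

lemma BallsFit.disjoint_ball {d : ℕ} {v : Fin d → EuclideanSpace ℝ (Fin d)} {ρ : ℝ}
    (h : BallsFit v ρ) {p q : EuclideanSpace ℝ (Fin d)} (hp : p ∈ bravais v) (hq : q ∈ bravais v)
    (hpq : p ≠ q) : Disjoint (Metric.ball p ρ) (Metric.ball q ρ) := by
  refine Metric.ball_disjoint_ball ?_
  have := h.2 p hp q hq hpq
  linarith

/-! ### Averages of periodic functions over large cubes -/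

lemma setLIntegral_fundamentalDomain_translate {d : ℕ} {v : Fin d → EuclideanSpace ℝ (Fin d)}
    {D : Set (EuclideanSpace ℝ (Fin d))}
    (hv : LinearIndependent ℝ v)
    (hD : IsAddFundamentalDomain (bravais v).toAddSubgroup D volume)
    {f : EuclideanSpace ℝ (Fin d) → ℝ≥0∞}
    (hf : ∀ q ∈ bravais v, ∀ x, f (x + q) = f x) (x : EuclideanSpace ℝ (Fin d)) :
    ∫⁻ y in D, f (x + y) = ∫⁻ y in D, f y := by
  have : Countable (bravais v).toAddSubgroup := (countable_bravais hv).to_subtype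
  have hDx : IsAddFundamentalDomain (bravais v).toAddSubgroup (x +ᵥ D) volume :=
    hD.vadd_of_comm x
  rw [← hDx.setLIntegral_eq hD f fun g y => by
    rw [AddSubgroup.vadd_def, vadd_eq_add, add_comm]; exact hf _ g.2 _]
  have h := (measurePreserving_add_left volume x).setLIntegral_comp_emb
    (measurableEmbedding_addLeft x) f D
  rw [← Set.image_vadd]
  exact h

/-- Averaging over all shifts in a period cell gives an exact identity for any set `A`. The limit
over cubes then only needs a comparison of shifted cubes with larger and smaller ones. -/
lemma setLIntegral_fundamentalDomain_add_cube {d : ℕ} {v : Fin d → EuclideanSpace ℝ (Fin d)}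
    (hv : LinearIndependent ℝ v) {D : Set (EuclideanSpace ℝ (Fin d))}
    (hD : IsAddFundamentalDomain (bravais v).toAddSubgroup D volume)
    {f : EuclideanSpace ℝ (Fin d) → ℝ≥0∞} (hfm : Measurable f)
    (hf : ∀ q ∈ bravais v, ∀ x, f (x + q) = f x) (A : Set (EuclideanSpace ℝ (Fin d))) :
    ∫⁻ y in D, ∫⁻ x in A, f (x + y) = volume A * ∫⁻ y in D, f y := by
  rw [lintegral_lintegral_swap (by exact (hfm.comp (measurable_snd.add measurable_fst)).aemeasurable)]
  simp_rw [setLIntegral_fundamentalDomain_translate hv hD hf]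
  rw [setLIntegral_const, mul_comm]

lemma volume_cube {d : ℕ} {R : ℝ} (hR : 0 ≤ R) : volume (cube d R) = ENNReal.ofReal ((2 * R) ^ d) := by
  have h : cube d R = WithLp.ofLp ⁻¹' (Set.Icc (fun _ : Fin d => -R) fun _ => R) := by
    ext x
    simp [cube, Set.mem_Icc, Pi.le_def, abs_le, forall_and]
  rw [h, (PiLp.volume_preserving_ofLp (Fin d)).measure_preimage measurableSet_Icc.nullMeasurableSet,
    Real.volume_Icc_pi]
  simp [ENNReal.ofReal_pow (show 0 ≤ 2 * R by positivity), ← two_mul]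

lemma setLIntegral_translate {d : ℕ} (f : EuclideanSpace ℝ (Fin d) → ℝ≥0∞)
    (A : Set (EuclideanSpace ℝ (Fin d))) (y : EuclideanSpace ℝ (Fin d)) :
    ∫⁻ x in A, f (x + y) = ∫⁻ x in (· + y) '' A, f x :=
  (measurePreserving_add_right volume y).setLIntegral_comp_emb (measurableEmbedding_addRight y) f A

/-- Upper and lower bounds for the integral of a periodic function over a cube. -/
lemma cube_integral_bounds {d : ℕ} {v : Fin d → EuclideanSpace ℝ (Fin d)}
    (hv : LinearIndependent ℝ v) {D : Set (EuclideanSpace ℝ (Fin d))}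
    (hDm : MeasurableSet D)
    (hD : IsAddFundamentalDomain (bravais v).toAddSubgroup D volume) {δ : ℝ}
    (hδ : ∀ y ∈ D, ‖y‖ ≤ δ) {f : EuclideanSpace ℝ (Fin d) → ℝ≥0∞} (hfm : Measurable f)
    (hf : ∀ q ∈ bravais v, ∀ x, f (x + q) = f x) (R : ℝ) :
    (∫⁻ x in cube d R, f x) * volume D ≤ volume (cube d (R + δ)) * ∫⁻ y in D, f y ∧
    volume (cube d (R - δ)) * ∫⁻ y in D, f y ≤ (∫⁻ x in cube d R, f x) * volume D := by
  have hcoord : ∀ y ∈ D, ∀ i, |y i| ≤ δ := fun y hy i =>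
    (by simpa using! PiLp.norm_apply_le y i : |y i| ≤ ‖y‖).trans (hδ y hy)
  rw [← setLIntegral_fundamentalDomain_add_cube hv hD hfm hf,
    ← setLIntegral_fundamentalDomain_add_cube hv hD hfm hf, ← setLIntegral_const]
  constructor
  · refine setLIntegral_mono' hDm fun y hy => ?_
    rw [setLIntegral_translate]
    refine lintegral_mono_set fun x hx => ⟨x - y, fun i => ?_, by simp⟩
    have h1 := abs_sub (x i) (y i)
    have h2 := hx i
    have h3 := hcoord y hy i
    rw [PiLp.sub_apply]; linarith
  · refine setLIntegral_mono' hDm fun y hy => ?_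
    rw [setLIntegral_translate]
    refine lintegral_mono_set ?_
    rintro _ ⟨x, hx, rfl⟩ i
    have h1 := abs_add_le (x i) (y i)
    have h2 := hx i
    have h3 := hcoord y hy i
    simp only [PiLp.add_apply]; linarith

/-- A cell of diameter of order `δ` changes the cube `R` to `R ± δ`, so the average is squeezed
between the cell mean times `((R ± δ) / R)^d`. -/
lemma tendsto_cube_average {d : ℕ} {v : Fin d → EuclideanSpace ℝ (Fin d)}
    (hv : LinearIndependent ℝ v) {D : Set (EuclideanSpace ℝ (Fin d))}
    (hDm : MeasurableSet D) (hDb : Bornology.IsBounded D)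
    (hD : IsAddFundamentalDomain (bravais v).toAddSubgroup D volume)
    (hDv : volume D = ENNReal.ofReal (cellVol v)) (hcell : 0 < cellVol v)
    {f : EuclideanSpace ℝ (Fin d) → ℝ} (hfm : Measurable f) (hf0 : ∀ x, 0 ≤ f x)
    (hf1 : ∀ x, f x ≤ 1) (hf : ∀ q ∈ bravais v, ∀ x, f (x + q) = f x) :
    Tendsto (fun R => ⨍ x in cube d R, f x) atTop
      (𝓝 ((∫⁻ y in D, ENNReal.ofReal (f y)).toReal / cellVol v)) := by
  obtain ⟨δ', hδ'⟩ := hDb.exists_norm_le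
  set δ := max δ' 0 with hδdef
  have hδ0 : 0 ≤ δ := le_max_right _ _
  have hδ : ∀ y ∈ D, ‖y‖ ≤ δ := fun y hy => (hδ' y hy).trans (le_max_left _ _)
  have hfin : ∀ A : Set (EuclideanSpace ℝ (Fin d)), volume A ≠ ∞ →
      ∫⁻ y in A, ENNReal.ofReal (f y) ≠ ∞ := by
    intro A hA
    refine ne_top_of_le_ne_top hA ?_
    calc ∫⁻ y in A, ENNReal.ofReal (f y) ≤ ∫⁻ y in A, 1 :=
          lintegral_mono fun y => by simpa using hf1 y
      _ = volume A := by simp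
  have hFD : volume D ≠ ∞ := by rw [hDv]; exact ENNReal.ofReal_ne_top
  set F := (∫⁻ y in D, ENNReal.ofReal (f y)).toReal with hF
  have hFe : ∫⁻ y in D, ENNReal.ofReal (f y) = ENNReal.ofReal F :=
    (ENNReal.ofReal_toReal (hfin D hFD)).symm
  have hF0 : 0 ≤ F := ENNReal.toReal_nonneg
  have key : ∀ R, δ < R → ⨍ x in cube d R, f x ≤ ((R + δ) / R) ^ d * (F / cellVol v) ∧
      ((R - δ) / R) ^ d * (F / cellVol v) ≤ ⨍ x in cube d R, f x := by
    intro R hR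
    have hR0 : 0 < R := hδ0.trans_lt hR
    have hcR : volume (cube d R) ≠ ∞ := by rw [volume_cube hR0.le]; exact ENNReal.ofReal_ne_top
    obtain ⟨b1, b2⟩ := cube_integral_bounds hv hDm hD hδ (f := fun x => ENNReal.ofReal (f x))
      (by fun_prop) (fun q hq x => by simp only [hf q hq x]) R
    set I := ∫ x in cube d R, f x with hI
    have hI0 : 0 ≤ I := integral_nonneg hf0
    have hIe : ∫⁻ x in cube d R, ENNReal.ofReal (f x) = ENNReal.ofReal I := by
      rw [hI, integral_eq_lintegral_of_nonneg_ae (Eventually.of_forall hf0)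
        hfm.aestronglyMeasurable, ENNReal.ofReal_toReal (hfin _ hcR)]
    rw [hIe, hDv, hFe, volume_cube (by linarith), ← ENNReal.ofReal_mul hI0,
      ← ENNReal.ofReal_mul (by positivity), ENNReal.ofReal_le_ofReal_iff (by positivity)] at b1
    rw [hIe, hDv, hFe, volume_cube (by linarith), ← ENNReal.ofReal_mul hI0,
      ← ENNReal.ofReal_mul (pow_nonneg (by linarith) _),
      ENNReal.ofReal_le_ofReal_iff (by positivity)] at b2
    have havg : ⨍ x in cube d R, f x = I / (2 * R) ^ d := by
      rw [setAverage_eq, measureReal_def, volume_cube hR0.le,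
        ENNReal.toReal_ofReal (by positivity), smul_eq_mul, ← hI]
      field_simp
    have e : ∀ x : ℝ, (x / R) ^ d * (F / cellVol v) =
        ((2 * x) ^ d * F / cellVol v) / (2 * R) ^ d := by
      intro x
      rw [mul_pow, mul_pow, div_pow]; field_simp
    rw [havg, e, e]
    constructor
    · gcongr; rwa [le_div_iff₀ hcell]
    · gcongr; rwa [div_le_iff₀ hcell]
  have lim : ∀ s : ℝ, Tendsto (fun R : ℝ => ((R + s) / R) ^ d * (F / cellVol v)) atTop
      (𝓝 (F / cellVol v)) := by
    intro s
    have h1 : Tendsto (fun R : ℝ => (R + s) / R) atTop (𝓝 1) := by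
      have h2 : Tendsto (fun R : ℝ => 1 + s * R⁻¹) atTop (𝓝 (1 + s * 0)) :=
        (tendsto_inv_atTop_zero.const_mul s).const_add 1
      rw [mul_zero, add_zero] at h2
      refine h2.congr' ?_
      filter_upwards [eventually_gt_atTop 0] with R hR
      field_simp
    simpa using (h1.pow d).mul_const (F / cellVol v)
  refine tendsto_of_tendsto_of_tendsto_of_le_of_le' (lim (-δ)) (lim δ) ?_ ?_
  · filter_upwards [eventually_gt_atTop δ] with R hR
    simpa [sub_eq_add_neg] using (key R hR).2
  · filter_upwards [eventually_gt_atTop δ] with R hR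
    exact (key R hR).1

/-! ### The autocorrelation of a lattice of balls -/

/-- The volume of `B_ρ ∩ (Ω - z)`. -/
def cellCorrelation {d : ℕ} (v : Fin d → EuclideanSpace ℝ (Fin d)) (ρ : ℝ)
    (z : EuclideanSpace ℝ (Fin d)) : ℝ :=
  volume.real (Metric.ball 0 ρ ∩ {x | x + z ∈ ballUnion v ρ})

/-- Unfolding: the lattice translates of the parts of `Ω` in `D` reassemble the single ball `B_ρ`,
up to null sets. Disjointness of the balls ensures that each point is counted once. -/
lemma setLIntegral_fundamentalDomain_correlation {d : ℕ} {v : Fin d → EuclideanSpace ℝ (Fin d)}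
    (hv : LinearIndependent ℝ v) {ρ : ℝ} (hρ : BallsFit v ρ)
    {D : Set (EuclideanSpace ℝ (Fin d))}
    (hD : IsAddFundamentalDomain (bravais v).toAddSubgroup D volume)
    (z : EuclideanSpace ℝ (Fin d)) :
    (∫⁻ x in D, ENNReal.ofReal (latticeBalls v ρ (x + z) * latticeBalls v ρ x)).toReal =
      cellCorrelation v ρ z := by
  classical
  have : Countable (bravais v).toAddSubgroup := (countable_bravais hv).to_subtype
  set S := Metric.ball 0 ρ ∩ {x | x + z ∈ ballUnion v ρ} with hS
  have hSm : MeasurableSet S :=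
    measurableSet_ball.inter (measurable_add_const z (isOpen_ballUnion v ρ).measurableSet)
  have hmemS : ∀ (g : (bravais v).toAddSubgroup) (x : EuclideanSpace ℝ (Fin d)),
      g +ᵥ x ∈ S ↔ ‖(g : EuclideanSpace ℝ (Fin d)) + x‖ < ρ ∧ x + z ∈ ballUnion v ρ := by
    intro g x
    rw [AddSubgroup.vadd_def, vadd_eq_add, hS, Set.mem_inter_iff, mem_ball_zero_iff]
    refine and_congr_right' ?_
    rw [Set.mem_ofPred_eq, add_assoc, add_comm (g : EuclideanSpace ℝ (Fin d))]
    exact add_mem_ballUnion g.2 _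
  have h1 : volume S = ∑' g : (bravais v).toAddSubgroup, ∫⁻ x in D, S.indicator 1 (g +ᵥ x) := by
    rw [← lintegral_indicator_one hSm, hD.lintegral_eq_tsum'']
  rw [cellCorrelation, measureReal_def, ← hS, h1, ← lintegral_tsum]
  swap
  · intro g
    exact ((measurable_one.indicator hSm).comp (measurable_const_vadd g)).aemeasurable
  congr 1
  refine lintegral_congr fun x => ?_
  rw [latticeBalls_eq]
  by_cases hx : x ∈ ballUnion v ρ
  · obtain ⟨p, hp, hxp⟩ := mem_ballUnion.1 hx
    have hmem : -p ∈ (bravais v).toAddSubgroup := neg_mem hp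
    -- Only the translation moving the centre `p` of the ball around `x` to the origin contributes.
    rw [tsum_eq_single ⟨-p, hmem⟩]
    · by_cases hz : x + z ∈ ballUnion v ρ
      · have h2 : ((⟨-p, hmem⟩ : (bravais v).toAddSubgroup) +ᵥ x) ∈ S := by
          rw [hmemS]
          exact ⟨by simpa [neg_add_eq_sub] using hxp, hz⟩
        rw [Set.indicator_of_mem h2, Set.indicator_of_mem hz, Set.indicator_of_mem hx]
        simp
      · have h2 : ((⟨-p, hmem⟩ : (bravais v).toAddSubgroup) +ᵥ x) ∉ S := by
          rw [hmemS]
          exact fun h => hz h.2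
        rw [Set.indicator_of_notMem h2, Set.indicator_of_notMem hz]
        simp
    · intro g hg
      refine Set.indicator_of_notMem ?_ _
      rw [hmemS]
      rintro ⟨h2, -⟩
      have h3 : -(g : EuclideanSpace ℝ (Fin d)) ≠ p := by
        intro h; apply hg; ext1; simp [← h]
      have := hρ.disjoint_ball (neg_mem g.2 : -(g : EuclideanSpace ℝ (Fin d)) ∈ bravais v) hp h3
      refine Set.disjoint_left.1 this (?_ : x ∈ _) ?_
      · simpa [dist_eq_norm, add_comm] using h2
      · simpa [dist_eq_norm] using hxp
  · rw [Set.indicator_of_notMem hx, mul_zero, ENNReal.ofReal_zero, eq_comm, ENNReal.tsum_eq_zero]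
    intro g
    refine Set.indicator_of_notMem ?_ _
    rw [hmemS]
    rintro ⟨h2, -⟩
    refine hx (mem_ballUnion.2 ⟨-g, neg_mem g.2, ?_⟩)
    rwa [sub_neg_eq_add, add_comm]

lemma latticeBalls_mem_Icc {d : ℕ} (v : Fin d → EuclideanSpace ℝ (Fin d)) (ρ : ℝ)
    (x : EuclideanSpace ℝ (Fin d)) : latticeBalls v ρ x ∈ Set.Icc (0 : ℝ) 1 := by
  rw [latticeBalls_eq]
  by_cases h : x ∈ ballUnion v ρ <;> simp [h]

lemma tendsto_cubeCorrelation {d : ℕ} {v : Fin d → EuclideanSpace ℝ (Fin d)}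
    (hv : LinearIndependent ℝ v) {ρ : ℝ} (hρ : BallsFit v ρ) (z : EuclideanSpace ℝ (Fin d)) :
    Tendsto (cubeCorrelation (latticeBalls v ρ) z) atTop
      (𝓝 (cellCorrelation v ρ z / cellVol v)) := by
  obtain ⟨D, hDm, hDb, hD, hDv, hcell⟩ := exists_fundamentalDomain hv
  rw [← setLIntegral_fundamentalDomain_correlation hv hρ hD z]
  have hm := measurable_latticeBalls v ρ
  refine tendsto_cube_average hv hDm hDb hD hDv hcell (by fun_prop)
    (fun x => mul_nonneg (latticeBalls_mem_Icc v ρ _).1 (latticeBalls_mem_Icc v ρ _).1)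
    (fun x => mul_le_one₀ (latticeBalls_mem_Icc v ρ _).2 (latticeBalls_mem_Icc v ρ _).1
      (latticeBalls_mem_Icc v ρ _).2) fun q hq x => ?_
  rw [add_right_comm, latticeBalls_add v ρ hq, latticeBalls_add v ρ hq]

lemma autocorr_latticeBalls {d : ℕ} {v : Fin d → EuclideanSpace ℝ (Fin d)}
    (hv : LinearIndependent ℝ v) {ρ : ℝ} (hρ : BallsFit v ρ) (z : EuclideanSpace ℝ (Fin d)) :
    autocorr (latticeBalls v ρ) z = cellCorrelation v ρ z / cellVol v :=
  (tendsto_cubeCorrelation hv hρ z).limUnder_eq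

/-- The overlap of `B_ρ` with the translates of the balls around the nonzero lattice points. -/
def neighbourOverlap {d : ℕ} (v : Fin d → EuclideanSpace ℝ (Fin d)) (ρ : ℝ)
    (z : EuclideanSpace ℝ (Fin d)) : ℝ :=
  ∑' q : bravaisNonzero v, ballOverlap ρ (z - (q : EuclideanSpace ℝ (Fin d)))

lemma ballOverlap_neg {d : ℕ} (ρ : ℝ) (z : EuclideanSpace ℝ (Fin d)) :
    ballOverlap ρ (-z) = ballOverlap ρ z := by
  rw [ballOverlap, ballOverlap, measureReal_def, measureReal_def,
    ← (Measure.measurePreserving_neg volume).measure_preimage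
      (measurableSet_ball.inter measurableSet_ball).nullMeasurableSet]
  congr 2
  ext x
  simp [dist_eq_norm, sub_eq_add_neg]

lemma volume_cellCorrelation {d : ℕ} {v : Fin d → EuclideanSpace ℝ (Fin d)}
    (hv : LinearIndependent ℝ v) {ρ : ℝ} (hρ : BallsFit v ρ) (z : EuclideanSpace ℝ (Fin d)) :
    volume (Metric.ball 0 ρ ∩ {x | x + z ∈ ballUnion v ρ}) =
      ENNReal.ofReal (ballOverlap ρ z) +
        ∑' q : bravaisNonzero v, ENNReal.ofReal (ballOverlap ρ (z - (q : EuclideanSpace ℝ (Fin d)))) := by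
  have hball : ∀ q : EuclideanSpace ℝ (Fin d), ENNReal.ofReal (ballOverlap ρ (z - q)) =
      volume (Metric.ball 0 ρ ∩ Metric.ball (q - z) ρ) := by
    intro q
    rw [← ofReal_ballOverlap, ← ballOverlap_neg, neg_sub]
  have hset : Metric.ball 0 ρ ∩ {x | x + z ∈ ballUnion v ρ} =
      (Metric.ball 0 ρ ∩ Metric.ball (0 - z) ρ) ∪
        ⋃ q ∈ bravaisNonzero v, Metric.ball 0 ρ ∩ Metric.ball (q - z) ρ := by
    ext x
    have hm : ∀ q, x ∈ Metric.ball (q - z) ρ ↔ ‖x + z - q‖ < ρ := by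
      intro q; rw [Metric.mem_ball, dist_eq_norm]; congr! 2; abel
    simp only [Set.mem_inter_iff, Set.mem_union, Set.mem_iUnion, Set.mem_ofPred_eq, mem_ballUnion, hm,
      exists_prop]
    constructor
    · rintro ⟨h1, q, hq, h2⟩
      by_cases h0 : q = 0
      · subst h0; exact Or.inl ⟨h1, h2⟩
      · exact Or.inr ⟨q, ⟨hq, h0⟩, h1, h2⟩
    · rintro (⟨h1, h2⟩ | ⟨q, hq, h1, h2⟩)
      · exact ⟨h1, 0, zero_mem _, h2⟩
      · exact ⟨h1, q, hq.1, h2⟩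
  have hdis : ∀ p ∈ bravais v, ∀ q ∈ bravais v, p ≠ q →
      Disjoint (Metric.ball 0 ρ ∩ Metric.ball (p - z) ρ) (Metric.ball 0 ρ ∩ Metric.ball (q - z) ρ) := by
    intro p hp q hq hpq
    refine Disjoint.mono Set.inter_subset_right Set.inter_subset_right (Metric.ball_disjoint_ball ?_)
    have := hρ.2 p hp q hq hpq
    rw [dist_sub_right]; linarith
  have hz := hball 0
  rw [sub_zero] at hz
  rw [hset, measure_union, measure_biUnion (countable_bravaisNonzero hv), hz]
  · simp_rw [hball]
  · intro p hp q hq hpq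
    exact hdis p hp.1 q hq.1 hpq
  · exact fun q _ => measurableSet_ball.inter measurableSet_ball
  · rw [Set.disjoint_iUnion₂_right]
    exact fun q hq => hdis 0 (zero_mem _) q hq.1 (Ne.symm hq.2)
  · exact MeasurableSet.biUnion (countable_bravaisNonzero hv)
      fun q _ => measurableSet_ball.inter measurableSet_ball

/-- The overlaps are volumes of disjoint pieces of one ball, which gives both their summability and
the bound by `|B_ρ|`. -/
lemma neighbourOverlap_facts {d : ℕ} {v : Fin d → EuclideanSpace ℝ (Fin d)}
    (hv : LinearIndependent ℝ v) {ρ : ℝ} (hρ : BallsFit v ρ) (z : EuclideanSpace ℝ (Fin d)) :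
    ENNReal.ofReal (neighbourOverlap v ρ z) =
      ∑' q : bravaisNonzero v, ENNReal.ofReal (ballOverlap ρ (z - (q : EuclideanSpace ℝ (Fin d)))) ∧
    cellCorrelation v ρ z = ballOverlap ρ z + neighbourOverlap v ρ z ∧
    0 ≤ neighbourOverlap v ρ z ∧ neighbourOverlap v ρ z ≤ ballVol d ρ := by
  have h := volume_cellCorrelation hv hρ z
  have hle : volume (Metric.ball 0 ρ ∩ {x | x + z ∈ ballUnion v ρ}) ≤
      ENNReal.ofReal (ballVol d ρ) := by
    rw [← volume_ball_eq_ofReal (0 : EuclideanSpace ℝ (Fin d))]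
    exact measure_mono Set.inter_subset_left
  have hle2 : ∑' q : bravaisNonzero v, ENNReal.ofReal (ballOverlap ρ (z - (q : EuclideanSpace ℝ (Fin d)))) ≤
      ENNReal.ofReal (ballVol d ρ) := le_trans (by rw [h]; exact le_add_self) hle
  have hfin : ∑' q : bravaisNonzero v, ENNReal.ofReal (ballOverlap ρ (z - (q : EuclideanSpace ℝ (Fin d)))) ≠ ∞ :=
    ne_top_of_le_ne_top ENNReal.ofReal_ne_top hle2
  have hsum : Summable fun q : bravaisNonzero v => ballOverlap ρ (z - (q : EuclideanSpace ℝ (Fin d))) := by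
    have := ENNReal.summable_toReal hfin
    simpa only [ENNReal.toReal_ofReal (ballOverlap_nonneg _ _)] using this
  have he : ENNReal.ofReal (neighbourOverlap v ρ z) =
      ∑' q : bravaisNonzero v, ENNReal.ofReal (ballOverlap ρ (z - (q : EuclideanSpace ℝ (Fin d)))) :=
    ENNReal.ofReal_tsum_of_nonneg (fun q => ballOverlap_nonneg _ _) hsum
  have hnn : 0 ≤ neighbourOverlap v ρ z := tsum_nonneg fun q => ballOverlap_nonneg _ _
  refine ⟨he, ?_, hnn, ?_⟩
  · rw [cellCorrelation, measureReal_def, h, ← he,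
      ← ENNReal.ofReal_add (ballOverlap_nonneg _ _) hnn,
      ENNReal.toReal_ofReal (add_nonneg (ballOverlap_nonneg _ _) hnn)]
  · rw [← he] at hle2
    exact (ENNReal.ofReal_le_ofReal_iff measureReal_nonneg).1 hle2

/-! ### The contribution of the neighbouring balls -/

lemma measurable_ballOverlap {d : ℕ} (ρ : ℝ) :
    Measurable (ballOverlap ρ : EuclideanSpace ℝ (Fin d) → ℝ) := by
  have h : Measurable fun z : EuclideanSpace ℝ (Fin d) => ENNReal.ofReal (ballOverlap ρ z) := by
    simp_rw [ofReal_ballOverlap_eq_lintegral]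
    refine Measurable.lintegral_prod_right' (f := fun p : EuclideanSpace ℝ (Fin d) ×
      EuclideanSpace ℝ (Fin d) => (Metric.ball (0 : EuclideanSpace ℝ (Fin d)) ρ).indicator
        (1 : EuclideanSpace ℝ (Fin d) → ℝ≥0∞) (p.1 - p.2)) ?_
    exact (measurable_one.indicator measurableSet_ball).comp (measurable_fst.sub measurable_snd)
  simpa only [ENNReal.toReal_ofReal (ballOverlap_nonneg _ _)] using h.ennreal_toReal

lemma measurable_neighbourOverlap {d : ℕ} {v : Fin d → EuclideanSpace ℝ (Fin d)}
    (hv : LinearIndependent ℝ v) {ρ : ℝ} (hρ : BallsFit v ρ) :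
    Measurable (neighbourOverlap v ρ) := by
  have : Countable (bravaisNonzero v) := (countable_bravaisNonzero hv).to_subtype
  have h : Measurable fun z => ENNReal.ofReal (neighbourOverlap v ρ z) := by
    simp_rw [(neighbourOverlap_facts hv hρ _).1]
    refine Measurable.tsum fun q => ?_
    exact ((measurable_ballOverlap ρ).comp (measurable_sub_const _)).ennreal_ofReal
  simpa only [ENNReal.toReal_ofReal (neighbourOverlap_facts hv hρ _).2.2.1] using h.ennreal_toReal

/-- A shift by `z` makes touching balls overlap in a lens of thickness at most `|z|` and width of
order `√(ρ|z|)`; for `d ≥ 2` at least one such width enters, and only finitely many neighbours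
matter. On the line there is no width to gain from, so a strict gap is required, and then the
overlap vanishes near `0`. -/
lemma neighbourOverlap_le_near_zero {d : ℕ} (hd : 1 ≤ d) {v : Fin d → EuclideanSpace ℝ (Fin d)}
    (hv : LinearIndependent ℝ v) {ρ : ℝ} (hρ : BallsFit v ρ)
    (h1 : d = 1 → ∀ q ∈ bravaisNonzero v, 2 * ρ < ‖q‖) :
    ∃ δ C : ℝ, 0 < δ ∧ δ < 2 * ρ ∧ 0 ≤ C ∧
      ∀ z, ‖z‖ < δ → neighbourOverlap v ρ z ≤ C * (‖z‖ * Real.sqrt ‖z‖) := by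
  have hρ0 := hρ.1
  have hT : {q | q ∈ bravais v ∧ ‖q‖ ≤ 2 * ρ + 1}.Finite := finite_bravais_inter hv _
  by_cases hd1 : d = 1
  · have hT' : {q | q ∈ bravaisNonzero v ∧ ‖q‖ ≤ 2 * ρ + 1}.Finite :=
      hT.subset fun q hq => ⟨hq.1.1, hq.2⟩
    have hev : ∀ᶠ ε in 𝓝[>] (0 : ℝ), ∀ q ∈ {q | q ∈ bravaisNonzero v ∧ ‖q‖ ≤ 2 * ρ + 1},
        2 * ρ + ε ≤ ‖q‖ := by
      rw [eventually_all_finite hT']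
      intro q hq
      have h2 := h1 hd1 q hq.1
      filter_upwards [nhdsWithin_le_nhds (Iio_mem_nhds (show 0 < ‖q‖ - 2 * ρ by linarith))]
        with ε hε
      have : ε < ‖q‖ - 2 * ρ := hε
      linarith
    obtain ⟨δ, hδ, hδ0, hδ1⟩ := (hev.and (Ioo_mem_nhdsGT (show 0 < min 1 (2 * ρ) by positivity))).exists
    refine ⟨δ, 0, hδ0, hδ1.trans_le (min_le_right _ _), le_rfl, fun z hz => ?_⟩
    have : ∀ q : bravaisNonzero v, ballOverlap ρ (z - (q : EuclideanSpace ℝ (Fin d))) = 0 := by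
      intro q
      apply ballOverlap_eq_zero
      have h3 := norm_sub_norm_le (q : EuclideanSpace ℝ (Fin d)) z
      rw [norm_sub_rev] at h3
      have h4 : 2 * ρ + δ ≤ ‖(q : EuclideanSpace ℝ (Fin d))‖ := by
        by_cases h5 : ‖(q : EuclideanSpace ℝ (Fin d))‖ ≤ 2 * ρ + 1
        · exact hδ q ⟨q.2, h5⟩
        · have := hδ1.trans_le (min_le_left _ _)
          linarith
      linarith
    simp [neighbourOverlap, this]
  · obtain ⟨n, rfl⟩ : ∃ n, d = n + 1 := ⟨d - 1, by omega⟩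
    have hn : n ≠ 0 := by rintro rfl; exact hd1 rfl
    have hT' : {q : bravaisNonzero v | ‖(q : EuclideanSpace ℝ (Fin (n + 1)))‖ ≤ 2 * ρ + 1}.Finite := by
      refine Set.Finite.of_finite_image (f := Subtype.val) (hT.subset ?_) Subtype.val_injective.injOn
      rintro _ ⟨q, hq, rfl⟩
      exact ⟨q.2.1, hq⟩
    have hu := unitBallVol_pos n
    set N := hT'.toFinset.card
    -- The bound `1` confines the relevant neighbours to the finite set, `ρ` keeps `δ` below `2ρ`,
    -- and `1/ρ` gives `√(ρ‖z‖) ≤ 1`, so its power `n ≥ 1` can be replaced by the first power.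
    refine ⟨min (min 1 ρ) (1 / ρ), N * (unitBallVol n * Real.sqrt ρ), by positivity, ?_,
      by positivity, fun z hz => ?_⟩
    · have := min_le_left (min 1 ρ) (1 / ρ)
      have := min_le_right 1 ρ
      linarith
    have hz1 : ‖z‖ < 1 := hz.trans_le ((min_le_left _ _).trans (min_le_left _ _))
    have hz2 : ‖z‖ < ρ := hz.trans_le ((min_le_left _ _).trans (min_le_right _ _))
    have hz3 : ρ * ‖z‖ ≤ 1 := by
      have := (hz.trans_le (min_le_right _ _)).le
      rw [le_div_iff₀ hρ0] at this
      linarith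
    have hterm : ∀ q : bravaisNonzero v,
        ballOverlap ρ (z - (q : EuclideanSpace ℝ (Fin (n + 1)))) ≤
          unitBallVol n * Real.sqrt ρ * (‖z‖ * Real.sqrt ‖z‖) := by
      intro q
      have h3 := norm_sub_norm_le (q : EuclideanSpace ℝ (Fin (n + 1))) z
      rw [norm_sub_rev] at h3
      have h4 := hρ.two_mul_le_norm q.2
      refine (ballOverlap_le hρ0 (norm_nonneg z) (by linarith) (by linarith)).trans ?_
      have h5 : Real.sqrt (ρ * ‖z‖) ^ n ≤ Real.sqrt (ρ * ‖z‖) :=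
        pow_le_of_le_one (Real.sqrt_nonneg _) (by rw [Real.sqrt_le_one]; exact hz3) hn
      rw [Real.sqrt_mul hρ0.le] at h5 ⊢
      calc _ ≤ unitBallVol n * ‖z‖ * (Real.sqrt ρ * Real.sqrt ‖z‖) := by gcongr
        _ = _ := by ring
    have hsum : neighbourOverlap v ρ z =
        ∑ q ∈ hT'.toFinset, ballOverlap ρ (z - (q : EuclideanSpace ℝ (Fin (n + 1)))) := by
      refine tsum_eq_sum fun q hq => ballOverlap_eq_zero ?_
      have h3 := norm_sub_norm_le (q : EuclideanSpace ℝ (Fin (n + 1))) z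
      rw [norm_sub_rev] at h3
      have h4 : 2 * ρ + 1 < ‖(q : EuclideanSpace ℝ (Fin (n + 1)))‖ := by
        rw [Set.Finite.mem_toFinset] at hq
        exact not_le.1 hq
      linarith
    rw [hsum]
    refine (Finset.sum_le_card_nsmul _ _ _ fun q _ => hterm q).trans ?_
    rw [nsmul_eq_mul, mul_assoc (N : ℝ)]

/-- With the Jacobian `r^{d-1}` the majorant is `C r^{-1/2}` near the origin and `|B_ρ| r^{-2}` at
infinity. -/
lemma integrable_neighbourOverlap_div {d : ℕ} (hd : 1 ≤ d)
    {v : Fin d → EuclideanSpace ℝ (Fin d)} (hv : LinearIndependent ℝ v) {ρ : ℝ} (hρ : BallsFit v ρ)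
    (h1 : d = 1 → ∀ q ∈ bravaisNonzero v, 2 * ρ < ‖q‖) :
    Integrable fun z => neighbourOverlap v ρ z / ‖z‖ ^ (d + 1) := by
  obtain ⟨δ, C, hδ, -, hC, hb⟩ := neighbourOverlap_le_near_zero hd hv hρ h1
  have : NeZero d := ⟨by omega⟩
  set g : ℝ → ℝ := fun r => (if r < δ then C * (r * Real.sqrt r) else ballVol d ρ) / r ^ (d + 1)
    with hg
  have hgi : Integrable fun z : EuclideanSpace ℝ (Fin d) => g ‖z‖ := by
    rw [integrable_fun_norm_addHaar, finrank_euclideanSpace_fin,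
      ← Set.Ioo_union_Ici_eq_Ioi hδ]
    refine IntegrableOn.union ?_ ?_
    · have e : Set.EqOn (fun r : ℝ => r ^ (d - 1) • g r) (fun r => C * r ^ (-(1 / 2) : ℝ))
          (Set.Ioo 0 δ) := by
        intro r hr
        have hr0 := hr.1
        simp only [hg, hr.2, if_true, smul_eq_mul]
        rw [Real.rpow_neg hr0.le, ← Real.sqrt_eq_rpow, show d + 1 = (d - 1) + 2 by omega, pow_add]
        have hs := Real.sqrt_pos.2 hr0
        have hss := Real.mul_self_sqrt hr0.le
        field_simp
        nlinarith
      rw [integrableOn_congr_fun e measurableSet_Ioo, ← integrableOn_Ioc_iff_integrableOn_Ioo,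
        ← intervalIntegrable_iff_integrableOn_Ioc_of_le hδ.le]
      exact (intervalIntegral.intervalIntegrable_rpow' (by norm_num)).const_mul C
    · have e : Set.EqOn (fun r : ℝ => r ^ (d - 1) • g r) (fun r => ballVol d ρ * r ^ (-2 : ℝ))
          (Set.Ici δ) := by
        intro r hr
        have hr1 : δ ≤ r := hr
        have hr0 : 0 < r := hδ.trans_le hr1
        simp only [hg, not_lt.2 hr1, if_false, smul_eq_mul]
        rw [Real.rpow_neg hr0.le, show d + 1 = (d - 1) + 2 by omega, pow_add]
        norm_cast
        field_simp
      rw [integrableOn_congr_fun e measurableSet_Ici, integrableOn_Ici_iff_integrableOn_Ioi]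
      exact (integrableOn_Ioi_rpow_of_lt (by norm_num) hδ).const_mul _
  refine hgi.mono' ?_ (Eventually.of_forall fun z => ?_)
  · exact ((measurable_neighbourOverlap hv hρ).div (by fun_prop)).aestronglyMeasurable
  · obtain ⟨-, -, f3, f4⟩ := neighbourOverlap_facts hv hρ z
    rw [Real.norm_eq_abs, abs_of_nonneg (by positivity)]
    simp only [hg]
    gcongr
    split_ifs with h
    · exact hb z h
    · exact f4

/-! ### Energy of a lattice of balls -/

/-- Near `0` only the loss of overlap of the ball with itself is of first order; the neighbours
contribute `O(t^{3/2})`. -/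
lemma hasDerivWithinAt_autocorr {d : ℕ} (hd : 1 ≤ d)
    {v : Fin d → EuclideanSpace ℝ (Fin d)} (hv : LinearIndependent ℝ v) {ρ : ℝ} (hρ : BallsFit v ρ)
    (h1 : d = 1 → ∀ q ∈ bravaisNonzero v, 2 * ρ < ‖q‖) (z : EuclideanSpace ℝ (Fin d)) :
    HasDerivWithinAt (fun t : ℝ => autocorr (latticeBalls v ρ) (t • z))
      (-(unitBallVol (d - 1) * ρ ^ (d - 1) * ‖z‖) / cellVol v) (Set.Ici 0) 0 := by
  obtain ⟨δ, C, hδ, hδρ, hC, hb⟩ := neighbourOverlap_le_near_zero hd hv hρ h1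
  obtain ⟨n, rfl⟩ : ∃ n, d = n + 1 := ⟨d - 1, by omega⟩
  rw [Nat.add_sub_cancel]
  have hρ0 := hρ.1
  have hsmall : ∀ᶠ t in 𝓝[Set.Ici 0] (0 : ℝ), 0 ≤ t ∧ ‖t • z‖ < δ := by
    refine (eventually_mem_nhdsWithin).and (nhdsWithin_le_nhds ?_)
    have hc : Continuous fun t : ℝ => ‖t • z‖ := by fun_prop
    exact hc.continuousAt.eventually_lt_const (by simpa using hδ)
  have hΦ : HasDerivWithinAt (fun t : ℝ => ballVol (n + 1) ρ - overlapLoss n ρ (t * ‖z‖))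
      (-(unitBallVol n * ρ ^ n * ‖z‖)) (Set.Ici 0) 0 := by
    have h2 : HasDerivAt (fun t : ℝ => t * ‖z‖) ‖z‖ 0 := by
      simpa using (hasDerivAt_id (0 : ℝ)).mul_const ‖z‖
    have h3 := hasDerivAt_overlapLoss n ρ (0 * ‖z‖)
    have h4 := (h3.comp (0 : ℝ) h2).const_sub (ballVol (n + 1) ρ)
    refine (h4.congr_deriv ?_).hasDerivWithinAt
    simp [sliceProfile, Real.sqrt_sq hρ0.le]
  have hS0 : neighbourOverlap v ρ 0 = 0 := by
    refine le_antisymm ?_ (neighbourOverlap_facts hv hρ 0).2.2.1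
    simpa using hb 0 (by simpa using hδ)
  have hS : HasDerivWithinAt (fun t : ℝ => neighbourOverlap v ρ (t • z)) 0 (Set.Ici 0) 0 := by
    rw [← hasDerivWithinAt_Ioi_iff_Ici, hasDerivWithinAt_iff_tendsto_slope' (by simp)]
    have hlim : Tendsto (fun t : ℝ => C * (‖z‖ * Real.sqrt (t * ‖z‖))) (𝓝[Set.Ioi 0] 0) (𝓝 0) := by
      have hc : Continuous fun t : ℝ => C * (‖z‖ * Real.sqrt (t * ‖z‖)) := by fun_prop
      have := hc.tendsto 0
      simp only [zero_mul, Real.sqrt_zero, mul_zero] at this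
      exact this.mono_left nhdsWithin_le_nhds
    have hsmall' : ∀ᶠ t in 𝓝[Set.Ioi 0] (0 : ℝ), 0 < t ∧ ‖t • z‖ < δ :=
      (eventually_mem_nhdsWithin).and ((hsmall.filter_mono
        (nhdsWithin_mono 0 Set.Ioi_subset_Ici_self)).mono fun t ht => ht.2)
    refine squeeze_zero' ?_ ?_ hlim
    · filter_upwards [hsmall'] with t ht
      have := (neighbourOverlap_facts hv hρ (t • z)).2.2.1
      rw [slope_def_field, zero_smul, hS0, sub_zero, sub_zero]
      exact div_nonneg this ht.1.le
    · filter_upwards [hsmall'] with t ht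
      rw [slope_def_field, zero_smul, hS0, sub_zero, sub_zero, div_le_iff₀ ht.1]
      refine (hb _ ht.2).trans_eq ?_
      rw [norm_smul, Real.norm_of_nonneg ht.1.le]
      ring
  have hsum := (hΦ.add hS).div_const (cellVol v)
  rw [add_zero] at hsum
  have heq : ∀ t : ℝ, 0 ≤ t → ‖t • z‖ < δ → autocorr (latticeBalls v ρ) (t • z) =
      (ballVol (n + 1) ρ - overlapLoss n ρ (t * ‖z‖) + neighbourOverlap v ρ (t • z)) / cellVol v := by
    intro t ht htz
    rw [autocorr_latticeBalls hv hρ, (neighbourOverlap_facts hv hρ _).2.1,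
      ballOverlap_eq_sub hρ0 (by linarith), norm_smul, Real.norm_of_nonneg ht]
  refine hsum.congr_of_eventuallyEq ?_ (heq 0 le_rfl (by simpa using hδ))
  filter_upwards [hsmall] with t ht
  exact heq t ht.1 ht.2

lemma neighbourOverlap_zero {d : ℕ} {v : Fin d → EuclideanSpace ℝ (Fin d)} {ρ : ℝ}
    (hρ : BallsFit v ρ) : neighbourOverlap v ρ 0 = 0 := by
  have : ∀ q : bravaisNonzero v, ballOverlap ρ (0 - (q : EuclideanSpace ℝ (Fin d))) = 0 := by
    intro q
    rw [zero_sub, ballOverlap_neg]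
    exact ballOverlap_eq_zero (hρ.two_mul_le_norm q.2)
  rw [neighbourOverlap, tsum_congr this, tsum_zero]

lemma energyIntegrand_latticeBalls {d : ℕ} (hd : 1 ≤ d)
    {v : Fin d → EuclideanSpace ℝ (Fin d)} (hv : LinearIndependent ℝ v) {ρ : ℝ} (hρ : BallsFit v ρ)
    (h1 : d = 1 → ∀ q ∈ bravaisNonzero v, 2 * ρ < ‖q‖) (z : EuclideanSpace ℝ (Fin d)) :
    energyIntegrand (kernelOne d) (latticeBalls v ρ) z =
      (selfIntegrand ρ z + neighbourOverlap v ρ z / ‖z‖ ^ (d + 1)) / cellVol v := by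
  have hder : dirDerivZero (autocorr (latticeBalls v ρ)) z =
      -(unitBallVol (d - 1) * ρ ^ (d - 1) * ‖z‖) / cellVol v :=
    (hasDerivWithinAt_autocorr hd hv hρ h1 z).derivWithin
      ((uniqueDiffOn_Ici 0).uniqueDiffWithinAt Set.self_mem_Ici)
  rw [energyIntegrand, hder, autocorr_latticeBalls hv hρ, autocorr_latticeBalls hv hρ,
    (neighbourOverlap_facts hv hρ _).2.1, (neighbourOverlap_facts hv hρ _).2.1, ballOverlap_zero,
    neighbourOverlap_zero hρ, selfIntegrand, kernelOne, pow_succ]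
  split_ifs <;> simp only [div_eq_mul_inv, mul_inv] <;> ring

/-- Tonelli identifies the integral with the double series in `[0, ∞]`. Its finiteness forces every
Appell series and the lattice sum to converge, so neither lattice points nor coefficients have to be
estimated. -/
lemma integral_neighbourOverlap_div {d : ℕ} (hd : 1 ≤ d)
    {v : Fin d → EuclideanSpace ℝ (Fin d)} (hv : LinearIndependent ℝ v) {ρ : ℝ} (hρ : BallsFit v ρ)
    (h1 : d = 1 → ∀ q ∈ bravaisNonzero v, 2 * ρ < ‖q‖) :
    (∀ q ∈ bravaisNonzero v, Summable (appellHTerm d (ρ ^ 2 / ‖q‖ ^ 2))) ∧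
    Summable (latticeTerm v ρ) ∧
    ∫ z, neighbourOverlap v ρ z / ‖z‖ ^ (d + 1) =
      (∑' q : bravaisNonzero v, latticeTerm v ρ q) * ballVol d ρ ^ 2 := by
  have hρ0 := hρ.1
  have hB : 0 < ballVol d ρ := by
    rw [ballVol_eq d hρ0]; exact mul_pos (unitBallVol_pos d) (pow_pos hρ0 d)
  have hint := integrable_neighbourOverlap_div hd hv hρ h1
  have : Countable (bravaisNonzero v) := (countable_bravaisNonzero hv).to_subtype
  have hpt : ∀ z, ENNReal.ofReal (neighbourOverlap v ρ z / ‖z‖ ^ (d + 1)) =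
      ∑' q : bravaisNonzero v,
        ENNReal.ofReal (ballOverlap ρ (z - (q : EuclideanSpace ℝ (Fin d))) / ‖z‖ ^ (d + 1)) := by
    intro z
    rw [div_eq_mul_inv, ENNReal.ofReal_mul (neighbourOverlap_facts hv hρ z).2.2.1,
      (neighbourOverlap_facts hv hρ z).1, ← ENNReal.tsum_mul_right]
    refine tsum_congr fun q => ?_
    rw [div_eq_mul_inv, ENNReal.ofReal_mul (ballOverlap_nonneg _ _)]
  have hlin : ∫⁻ z, ENNReal.ofReal (neighbourOverlap v ρ z / ‖z‖ ^ (d + 1)) =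
      ∑' q : bravaisNonzero v,
        ENNReal.ofReal (ballVol d ρ ^ 2 / ‖(q : EuclideanSpace ℝ (Fin d))‖ ^ (d + 1)) *
          ∑' p : ℕ × ℕ, ENNReal.ofReal
            (appellHTerm d (ρ ^ 2 / ‖(q : EuclideanSpace ℝ (Fin d))‖ ^ 2) p) := by
    simp_rw [hpt]
    rw [lintegral_tsum]
    · exact tsum_congr fun q => lintegral_ballOverlap_div hd hρ0 (hρ.two_mul_le_norm q.2)
    · intro q
      have := (measurable_ballOverlap (d := d) ρ).comp
        (measurable_sub_const (q : EuclideanSpace ℝ (Fin d)))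
      exact ((this.div (by fun_prop)).ennreal_ofReal).aemeasurable
  have hnn : ∀ z, 0 ≤ neighbourOverlap v ρ z / ‖z‖ ^ (d + 1) := fun z =>
    div_nonneg (neighbourOverlap_facts hv hρ z).2.2.1 (by positivity)
  have hfin : ∫⁻ z, ENNReal.ofReal (neighbourOverlap v ρ z / ‖z‖ ^ (d + 1)) ≠ ∞ := by
    have := hint.hasFiniteIntegral
    rw [hasFiniteIntegral_iff_ofReal (Eventually.of_forall hnn)] at this
    exact this.ne
  rw [hlin] at hfin
  have hq0 : ∀ q : bravaisNonzero v, 0 < ‖(q : EuclideanSpace ℝ (Fin d))‖ := fun q =>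
    norm_pos_iff.2 q.2.2
  have hH0 : ∀ (q : bravaisNonzero v) p,
      0 ≤ appellHTerm d (ρ ^ 2 / ‖(q : EuclideanSpace ℝ (Fin d))‖ ^ 2) p := fun q p =>
    appellHTerm_nonneg d (by positivity) p
  have hsum : ∀ q : bravaisNonzero v,
      Summable (appellHTerm d (ρ ^ 2 / ‖(q : EuclideanSpace ℝ (Fin d))‖ ^ 2)) := by
    intro q
    have h2 := ENNReal.ne_top_of_tsum_ne_top hfin q
    have h3 : ∑' p : ℕ × ℕ, ENNReal.ofReal
        (appellHTerm d (ρ ^ 2 / ‖(q : EuclideanSpace ℝ (Fin d))‖ ^ 2) p) ≠ ∞ := by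
      intro h
      rw [h] at h2
      refine h2 (ENNReal.mul_top ?_)
      rw [Ne, ENNReal.ofReal_eq_zero, not_le]
      have := hq0 q
      positivity
    simpa only [ENNReal.toReal_ofReal (hH0 q _)] using ENNReal.summable_toReal h3
  have hterm : ∀ q : bravaisNonzero v,
      ENNReal.ofReal (ballVol d ρ ^ 2 / ‖(q : EuclideanSpace ℝ (Fin d))‖ ^ (d + 1)) *
        ∑' p : ℕ × ℕ, ENNReal.ofReal
          (appellHTerm d (ρ ^ 2 / ‖(q : EuclideanSpace ℝ (Fin d))‖ ^ 2) p) =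
      ENNReal.ofReal (ballVol d ρ ^ 2 * latticeTerm v ρ q) := by
    intro q
    rw [← ENNReal.ofReal_tsum_of_nonneg (hH0 q) (hsum q), ← ENNReal.ofReal_mul (by positivity)]
    congr 1
    rw [latticeTerm, appellH]
    ring
  have hlt0 : ∀ q : bravaisNonzero v, 0 ≤ latticeTerm v ρ q := fun q =>
    div_nonneg (tsum_nonneg (hH0 q)) (by positivity)
  have hlt1 : ∀ q : bravaisNonzero v, 0 ≤ ballVol d ρ ^ 2 * latticeTerm v ρ q := fun q =>
    mul_nonneg (by positivity) (hlt0 q)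
  simp_rw [hterm] at hfin hlin
  have hS : Summable fun q => ballVol d ρ ^ 2 * latticeTerm v ρ q := by
    simpa only [ENNReal.toReal_ofReal (hlt1 _)] using ENNReal.summable_toReal hfin
  refine ⟨fun q hq => hsum ⟨q, hq⟩, (summable_mul_left_iff (by positivity)).1 hS, ?_⟩
  rw [integral_eq_lintegral_of_nonneg_ae (Eventually.of_forall hnn) hint.aestronglyMeasurable, hlin,
    ← ENNReal.ofReal_tsum_of_nonneg hlt1 hS, ENNReal.toReal_ofReal (tsum_nonneg hlt1), tsum_mul_left,
    mul_comm]

lemma limitEnergy_latticeBalls {d : ℕ} (hd : 1 ≤ d)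
    {v : Fin d → EuclideanSpace ℝ (Fin d)} (hv : LinearIndependent ℝ v) {ρ : ℝ} (hρ : BallsFit v ρ)
    (h1 : d = 1 → ∀ q ∈ bravaisNonzero v, 2 * ρ < ‖q‖) :
    EnergyWellDefined (kernelOne d) (latticeBalls v ρ) ∧
    limitEnergy (kernelOne d) (latticeBalls v ρ) =
      -unitBallVol (d - 1) *
          (Real.log (2 * ρ) + 1 - 1 / 2 * genHarmonic (((d : ℝ) - 1) / 2)) *
          (sphereArea d ρ / cellVol v) +
        latticeInteraction v ρ * ballVol d ρ ^ 2 := by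
  obtain ⟨s1, s2⟩ := integral_selfIntegrand hd hρ.1
  have n1 := integrable_neighbourOverlap_div hd hv hρ h1
  have n2 := (integral_neighbourOverlap_div hd hv hρ h1).2.2
  have he := funext (energyIntegrand_latticeBalls hd hv hρ h1)
  refine ⟨⟨measurable_latticeBalls v ρ, fun z => ⟨_, tendsto_cubeCorrelation hv hρ z⟩,
    fun z => (hasDerivWithinAt_autocorr hd hv hρ h1 z).differentiableWithinAt, ?_⟩, ?_⟩
  · rw [he]
    exact (s1.add n1).div_const _
  · rw [limitEnergy, he, integral_div, integral_add s1 n1, s2, n2, latticeInteraction]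
    ring

/-! ### Touching intervals on the line -/

/-- In units of the generator, an uncovered point has distance at least `1/2` from every integer,
hence is a half-integer; these form a countable set. -/
lemma measure_compl_ballUnion_of_touching {v : Fin 1 → EuclideanSpace ℝ (Fin 1)}
    (hv : LinearIndependent ℝ v) {ρ : ℝ}
    (h : ∃ q ∈ bravaisNonzero v, ‖q‖ ≤ 2 * ρ) : volume (ballUnion v ρ)ᶜ = 0 := by
  have hv0 : v 0 ≠ 0 := hv.ne_zero 0
  have hr : Set.range v = {v 0} := by
    ext x; simp [Fin.exists_fin_one, eq_comm]
  have hmem : ∀ x, x ∈ bravais v ↔ ∃ k : ℤ, k • v 0 = x := by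
    intro x
    rw [bravais, hr, Submodule.mem_span_singleton]
  have hnorm : ‖v 0‖ ≤ 2 * ρ := by
    obtain ⟨q, hq, hqρ⟩ := h
    obtain ⟨k, rfl⟩ := (hmem q).1 hq.1
    have hk : k ≠ 0 := by rintro rfl; exact hq.2 (zero_smul _ _)
    rw [← Int.cast_smul_eq_zsmul ℝ, norm_smul] at hqρ
    have h1 : (1 : ℝ) ≤ ‖(k : ℝ)‖ := by
      rw [Real.norm_eq_abs]
      exact_mod_cast Int.one_le_abs hk
    have := norm_nonneg (v 0)
    nlinarith
  have hn0 : 0 < ‖v 0‖ := norm_pos_iff.2 hv0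
  refine Set.Countable.measure_zero ((Set.countable_range
    fun k : ℤ => ((k : ℝ) + 1 / 2) • v 0).mono fun x hx => ?_) volume
  obtain ⟨c, rfl⟩ := exists_smul_eq_of_finrank_eq_one (K := ℝ)
    (by simp : Module.finrank ℝ (EuclideanSpace ℝ (Fin 1)) = 1) hv0 x
  refine ⟨⌊c⌋, ?_⟩
  have hnot : ∀ k : ℤ, 1 / 2 ≤ |c - k| := by
    intro k
    by_contra hlt
    refine hx (mem_ballUnion.2 ⟨k • v 0, (hmem _).2 ⟨k, rfl⟩, ?_⟩)
    rw [← Int.cast_smul_eq_zsmul ℝ, ← sub_smul, norm_smul, Real.norm_eq_abs]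
    nlinarith
  have h1 := hnot ⌊c⌋
  have h2 := hnot (⌊c⌋ + 1)
  have h3 := Int.floor_le c
  have h4 := Int.lt_floor_add_one c
  push_cast at h2
  rw [abs_of_nonneg (by linarith)] at h1
  rw [abs_of_nonpos (by linarith)] at h2
  simp only
  congr 1
  linarith

lemma cellCorrelation_of_compl_null {d : ℕ} {v : Fin d → EuclideanSpace ℝ (Fin d)} {ρ : ℝ}
    (h : volume (ballUnion v ρ)ᶜ = 0) (z : EuclideanSpace ℝ (Fin d)) :
    cellCorrelation v ρ z = ballVol d ρ := by
  have h2 : volume {x | x + z ∈ ballUnion v ρ}ᶜ = 0 := by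
    have := measure_preimage_add_right volume z (ballUnion v ρ)ᶜ
    rw [h] at this
    exact this
  rw [cellCorrelation, ballVol, measureReal_def, measureReal_def, measure_inter_conull h2]

/-- For constant autocorrelation the integrand is identically zero. This settles touching intervals,
for which the formula with the kink fails. -/
lemma limitEnergy_of_autocorr_const {d : ℕ} {K : ℝ → ℝ} {u : EuclideanSpace ℝ (Fin d) → ℝ}
    (hu : Measurable u) {c : ℝ} (h : ∀ z, Tendsto (cubeCorrelation u z) atTop (𝓝 c)) :
    EnergyWellDefined K u ∧ limitEnergy K u = 0 := by
  have hc : autocorr u = fun _ => c := funext fun z => (h z).limUnder_eq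
  have he : energyIntegrand K u = 0 := by
    funext z
    simp [energyIntegrand, hc, dirDerivZero]
  refine ⟨⟨hu, fun z => ⟨c, h z⟩, fun z => ?_, ?_⟩, ?_⟩
  · rw [hc]; exact differentiableWithinAt_const c
  · rw [he]; exact integrable_zero _ _ _
  · simp [limitEnergy, he]

lemma energyWellDefined_latticeBalls {d : ℕ} (hd : 1 ≤ d)
    {v : Fin d → EuclideanSpace ℝ (Fin d)} (hv : LinearIndependent ℝ v) {ρ : ℝ} (hρ : BallsFit v ρ) :
    EnergyWellDefined (kernelOne d) (latticeBalls v ρ) := by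
  by_cases h1 : d = 1 → ∀ q ∈ bravaisNonzero v, 2 * ρ < ‖q‖
  · exact (limitEnergy_latticeBalls hd hv hρ h1).1
  · push Not at h1
    obtain ⟨rfl, h1⟩ := h1
    have h2 := cellCorrelation_of_compl_null (measure_compl_ballUnion_of_touching hv h1)
    refine (limitEnergy_of_autocorr_const (measurable_latticeBalls v ρ)
      (c := ballVol 1 ρ / cellVol v) fun z => ?_).1
    rw [← h2 z]
    exact tendsto_cubeCorrelation hv hρ z

lemma limitEnergy_latticeBalls_of_touching {v : Fin 1 → EuclideanSpace ℝ (Fin 1)}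
    (hv : LinearIndependent ℝ v) {ρ : ℝ} (hρ : BallsFit v ρ)
    (h : ∃ q ∈ bravaisNonzero v, ‖q‖ ≤ 2 * ρ) (K : ℝ → ℝ) :
    limitEnergy K (latticeBalls v ρ) = 0 := by
  have h2 := cellCorrelation_of_compl_null (measure_compl_ballUnion_of_touching hv h)
  refine (limitEnergy_of_autocorr_const (measurable_latticeBalls v ρ)
    (c := ballVol 1 ρ / cellVol v) fun z => ?_).2
  rw [← h2 z]
  exact tendsto_cubeCorrelation hv hρ z

/-! ### Dilations of a lattice -/

lemma mem_bravais_smul {d : ℕ} {v : Fin d → EuclideanSpace ℝ (Fin d)} (a : ℝ)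
    {x : EuclideanSpace ℝ (Fin d)} : x ∈ bravais (a • v) ↔ ∃ y ∈ bravais v, a • y = x := by
  have h : Set.range (a • v) =
      ((LinearMap.lsmul ℝ (EuclideanSpace ℝ (Fin d)) a).restrictScalars ℤ) '' Set.range v := by
    rw [← Set.range_comp]; rfl
  rw [bravais, h, ← Submodule.map_span]
  rfl

lemma linearIndependent_dilation {d : ℕ} {v : Fin d → EuclideanSpace ℝ (Fin d)}
    (hv : LinearIndependent ℝ v) {a : ℝ} (ha : 0 < a) : LinearIndependent ℝ (a • v) :=
  hv.units_smul fun _ => Units.mk0 a ha.ne'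

lemma cellVol_smul {d : ℕ} (v : Fin d → EuclideanSpace ℝ (Fin d)) {a : ℝ} (ha : 0 < a) :
    cellVol (a • v) = a ^ d * cellVol v := by
  have h : parallelepiped (a • v) = a • parallelepiped v :=
    (image_parallelepiped (LinearMap.lsmul ℝ (EuclideanSpace ℝ (Fin d)) a) v).symm
  rw [cellVol, h, measureReal_def, Measure.addHaar_smul, finrank_euclideanSpace_fin,
    abs_of_pos (pow_pos ha d), ENNReal.toReal_mul, ENNReal.toReal_ofReal (pow_pos ha d).le]
  rfl

/-- Dilation by `a` as a bijection between the nonzero points of the lattices. -/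
def bravaisNonzeroSMul {d : ℕ} (v : Fin d → EuclideanSpace ℝ (Fin d)) {a : ℝ} (ha : 0 < a) :
    bravaisNonzero v ≃ bravaisNonzero (a • v) where
  toFun q := ⟨a • q.1, (mem_bravais_smul a).2 ⟨q.1, q.2.1, rfl⟩, smul_ne_zero ha.ne' q.2.2⟩
  invFun q := ⟨a⁻¹ • q.1, by
    obtain ⟨y, hy, h⟩ := (mem_bravais_smul a).1 q.2.1
    rw [← h, inv_smul_smul₀ ha.ne']
    exact hy, smul_ne_zero (inv_ne_zero ha.ne') q.2.2⟩
  left_inv q := Subtype.ext (inv_smul_smul₀ ha.ne' _)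
  right_inv q := Subtype.ext (smul_inv_smul₀ ha.ne' _)

lemma norm_bravaisNonzeroSMul {d : ℕ} (v : Fin d → EuclideanSpace ℝ (Fin d)) {a : ℝ} (ha : 0 < a)
    (q : bravaisNonzero v) :
    ‖(bravaisNonzeroSMul v ha q : EuclideanSpace ℝ (Fin d))‖ =
      a * ‖(q : EuclideanSpace ℝ (Fin d))‖ := by
  change ‖a • (q : EuclideanSpace ℝ (Fin d))‖ = _
  rw [norm_smul, Real.norm_of_nonneg ha.le]

lemma forall_bravaisNonzero_smul {d : ℕ} (v : Fin d → EuclideanSpace ℝ (Fin d)) {a : ℝ}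
    (ha : 0 < a) (P : ℝ → Prop) :
    (∀ q ∈ bravaisNonzero (a • v), P ‖q‖) ↔ ∀ q ∈ bravaisNonzero v, P (a * ‖q‖) := by
  constructor
  · intro h q hq
    rw [← norm_bravaisNonzeroSMul v ha ⟨q, hq⟩]
    exact h _ (Subtype.coe_prop _)
  · intro h q hq
    obtain ⟨p, hp⟩ := (bravaisNonzeroSMul v ha).surjective ⟨q, hq⟩
    have := norm_bravaisNonzeroSMul v ha p
    rw [hp] at this
    simp only at this
    rw [this]
    exact h _ p.2

lemma ballsFit_smul {d : ℕ} (v : Fin d → EuclideanSpace ℝ (Fin d)) {a : ℝ} (ha : 0 < a) (s : ℝ) :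
    BallsFit (a • v) (a * s) ↔ BallsFit v s := by
  rw [ballsFit_iff, ballsFit_iff, forall_bravaisNonzero_smul v ha (fun r => 2 * (a * s) ≤ r),
    mul_pos_iff_of_pos_left ha]
  simp_rw [mul_left_comm (2 : ℝ) a s, mul_le_mul_iff_right₀ ha]

lemma tsum_latticeTerm_smul {d : ℕ} (v : Fin d → EuclideanSpace ℝ (Fin d)) {a : ℝ} (ha : 0 < a)
    (s : ℝ) : ∑' q, latticeTerm (a • v) (a * s) q = (∑' q, latticeTerm v s q) / a ^ (d + 1) := by
  rw [← (bravaisNonzeroSMul v ha).tsum_eq, ← tsum_div_const]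
  refine tsum_congr fun q => ?_
  rw [latticeTerm, latticeTerm, norm_bravaisNonzeroSMul, mul_pow, mul_pow, mul_pow,
    mul_div_mul_left _ _ (by positivity), div_div, mul_comm (a ^ (d + 1))]

lemma exists_min_norm {d : ℕ} (hd : 1 ≤ d) {v : Fin d → EuclideanSpace ℝ (Fin d)}
    (hv : LinearIndependent ℝ v) :
    ∃ q ∈ bravaisNonzero v, ∀ p ∈ bravaisNonzero v, ‖q‖ ≤ ‖p‖ := by
  have hmem : v ⟨0, hd⟩ ∈ bravaisNonzero v :=
    ⟨Submodule.subset_span (Set.mem_range_self _), hv.ne_zero _⟩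
  have hfin : (bravaisNonzero v ∩ {q | ‖q‖ ≤ ‖v ⟨0, hd⟩‖}).Finite :=
    (finite_bravais_inter hv ‖v ⟨0, hd⟩‖).subset fun q hq => ⟨hq.1.1, hq.2⟩
  obtain ⟨q, hq, hmin⟩ := Set.exists_min_image _ (fun q => ‖q‖) hfin
    ⟨v ⟨0, hd⟩, hmem, le_refl ‖v ⟨0, hd⟩‖⟩
  refine ⟨q, hq.1, fun p hp => ?_⟩
  by_cases h : ‖p‖ ≤ ‖v ⟨0, hd⟩‖
  · exact hmin p ⟨hp, h⟩
  · exact hq.2.trans (not_le.1 h).le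

/-! ### The energy as a function of the dilation -/

/-- The strength of the interaction between the balls of radius `s` on a lattice with unit cell
volume, relative to their volume fraction. -/
def interactionStrength {d : ℕ} (v : Fin d → EuclideanSpace ℝ (Fin d)) (s : ℝ) : ℝ :=
  unitBallVol d * s ^ (d + 1) * ∑' q, latticeTerm v s q

/-- The energy per volume fraction as a function of the radius of the balls. -/
def energyProfile (α h κ ρ : ℝ) : ℝ := (κ - α * (Real.log (2 * ρ) + 1 - 1 / 2 * h)) / ρ

/-- The minimizer of `energyProfile α h κ`. -/
def profileMinimizer (α h κ : ℝ) : ℝ := 1 / 2 * Real.exp (1 / 2 * h) * Real.exp (κ / α)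

lemma profileMinimizer_pos (α h κ : ℝ) : 0 < profileMinimizer α h κ := by
  unfold profileMinimizer; positivity

/-- Measuring the radius in units of the minimizer absorbs `h` and `κ`; minimality becomes `log x ≤
x - 1`, with equality only at `x = 1`. -/
lemma energyProfile_eq {α : ℝ} (hα : 0 < α) (h κ : ℝ) {ρ : ℝ} (hρ : 0 < ρ) :
    energyProfile α h κ ρ = -α * (Real.log (ρ / profileMinimizer α h κ) + 1) / ρ := by
  have h0 := profileMinimizer_pos α h κ
  have h1 : Real.log (profileMinimizer α h κ) = -Real.log 2 + 1 / 2 * h + κ / α := by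
    rw [profileMinimizer, Real.log_mul (by positivity) (by positivity),
      Real.log_mul (by positivity) (by positivity), Real.log_exp, Real.log_exp]
    simp
  rw [energyProfile, Real.log_div hρ.ne' h0.ne', h1, Real.log_mul two_ne_zero hρ.ne']
  congr 1
  field_simp
  ring

lemma energyProfile_profileMinimizer {α : ℝ} (hα : 0 < α) (h κ : ℝ) :
    energyProfile α h κ (profileMinimizer α h κ) =
      -(2 * α * Real.exp (-(1 / 2) * h) * Real.exp (-(κ / α))) := by
  have h0 := profileMinimizer_pos α h κ
  rw [energyProfile_eq hα h κ h0, div_self h0.ne', Real.log_one, profileMinimizer, neg_mul (1 / 2),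
    Real.exp_neg, Real.exp_neg]
  field_simp
  ring

lemma energyProfile_lt {α : ℝ} (hα : 0 < α) (h κ : ℝ) {ρ : ℝ} (hρ : 0 < ρ)
    (hne : ρ ≠ profileMinimizer α h κ) :
    energyProfile α h κ (profileMinimizer α h κ) < energyProfile α h κ ρ := by
  have h0 := profileMinimizer_pos α h κ
  rw [energyProfile_eq hα h κ hρ, energyProfile_eq hα h κ h0, div_self h0.ne', Real.log_one]
  set ρ₀ := profileMinimizer α h κ
  have h1 := Real.log_lt_sub_one_of_pos (div_pos hρ h0) (by rwa [Ne, div_eq_one_iff_eq h0.ne'])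
  rw [div_lt_div_iff₀ h0 hρ]
  have h2 : (Real.log (ρ / ρ₀) + 1) * ρ₀ < ρ := by
    rw [← lt_div_iff₀ h0]; linarith
  nlinarith

lemma energyProfile_le {α : ℝ} (hα : 0 < α) (h κ : ℝ) {ρ : ℝ} (hρ : 0 < ρ) :
    energyProfile α h κ (profileMinimizer α h κ) ≤ energyProfile α h κ ρ := by
  by_cases hne : ρ = profileMinimizer α h κ
  · rw [hne]
  · exact (energyProfile_lt hα h κ hρ hne).le

/-- At fixed `s` both the surface and the interaction terms scale like `1/ρ` for `ρ = a s`, apart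
from the logarithm, so the dilation enters only through `ρ`. -/
lemma limitEnergy_dilation {d : ℕ} (hd : 1 ≤ d)
    {v : Fin d → EuclideanSpace ℝ (Fin d)} (hv : LinearIndependent ℝ v) (hcell : cellVol v = 1)
    {s : ℝ} (hs : BallsFit v s) (h1 : d = 1 → ∀ q ∈ bravaisNonzero v, 2 * s < ‖q‖)
    {a : ℝ} (ha : 0 < a) :
    limitEnergy (kernelOne d) (latticeBalls (a • v) (a * s)) = ballVol d s *
      energyProfile (unitBallVol (d - 1) * d) (genHarmonic (((d : ℝ) - 1) / 2))
        (interactionStrength v s) (a * s) := by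
  have hs0 := hs.1
  rw [(limitEnergy_latticeBalls hd (linearIndependent_dilation hv ha)
    ((ballsFit_smul v ha s).2 hs) fun hd1 => ?_).2]
  · rw [latticeInteraction, tsum_latticeTerm_smul v ha, cellVol_smul v ha, hcell, ballVol_eq d hs0,
      ballVol_eq d (mul_pos ha hs0), energyProfile, interactionStrength, sphereArea, mul_one]
    generalize ∑' q, latticeTerm v s q = S
    generalize Real.log (2 * (a * s)) = l
    generalize genHarmonic (((d : ℝ) - 1) / 2) = h
    generalize unitBallVol (d - 1) = w
    generalize unitBallVol d = u
    have hda : a ^ d = a ^ (d - 1) * a := by rw [← pow_succ]; congr 1; omega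
    have hds : s ^ d = s ^ (d - 1) * s := by rw [← pow_succ]; congr 1; omega
    have hA : 0 < a ^ (d - 1) := by positivity
    simp only [mul_pow, pow_succ a d, pow_succ s d, hda, hds]
    generalize a ^ (d - 1) = A at hA
    generalize s ^ (d - 1) = B
    field_simp
    ring
  · rw [forall_bravaisNonzero_smul v ha (fun r => 2 * (a * s) < r)]
    intro q hq
    have := h1 hd1 q hq
    nlinarith

lemma isConfig_iff {d : ℕ} (hd : 1 ≤ d) {v : Fin d → EuclideanSpace ℝ (Fin d)}
    (hcell : cellVol v = 1) {s : ℝ} (hs : 0 < s) {a ρ : ℝ} :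
    IsConfig v (ballVol d s) a ρ ↔ 0 < a ∧ ρ = a * s ∧ BallsFit v s := by
  have hu := unitBallVol_pos d
  constructor
  · rintro ⟨ha, hfit, hlam⟩
    have hρ : ρ = a * s := by
      rw [cellVol_smul v ha, hcell, mul_one, ballVol_eq d hs, ballVol_eq d hfit.1,
        eq_div_iff (by positivity), mul_assoc, ← mul_pow] at hlam
      have := mul_left_cancel₀ hu.ne' hlam
      rw [pow_left_inj₀ (by positivity) hfit.1.le (by omega)] at this
      rw [← this, mul_comm]
    exact ⟨ha, hρ, (ballsFit_smul v ha s).1 (hρ ▸ hfit)⟩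
  · rintro ⟨ha, rfl, hfit⟩
    refine ⟨ha, (ballsFit_smul v ha s).2 hfit, ?_⟩
    rw [cellVol_smul v ha, hcell, ballVol_eq d hs, ballVol_eq d (mul_pos ha hs), mul_pow]
    field_simp

/-- Admissibility depends only on `s`, so `ρ = a s` runs over all positive numbers and the
unconstrained minimizer is attained with `a = ρ₀ / s`. -/
lemma isLeast_dilationEnergies {d : ℕ} (hd : 1 ≤ d)
    {v : Fin d → EuclideanSpace ℝ (Fin d)} (hv : LinearIndependent ℝ v) (hcell : cellVol v = 1)
    {s : ℝ} (hs : BallsFit v s) (h1 : d = 1 → ∀ q ∈ bravaisNonzero v, 2 * s < ‖q‖) :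
    IsLeast (dilationEnergies v (ballVol d s))
      (-(2 * unitBallVol (d - 1) * d * Real.exp (-(1 / 2) * genHarmonic (((d : ℝ) - 1) / 2))) *
        ballVol d s * Real.exp (-(interactionStrength v s / (unitBallVol (d - 1) * d)))) ∧
    ∀ ρ, IsOptimalRadius v (ballVol d s) ρ ↔ ρ = profileMinimizer (unitBallVol (d - 1) * d)
      (genHarmonic (((d : ℝ) - 1) / 2)) (interactionStrength v s) := by
  have hs0 := hs.1
  have hα : 0 < unitBallVol (d - 1) * d :=
    mul_pos (unitBallVol_pos _) (by exact_mod_cast hd)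
  have hB : 0 < ballVol d s := by
    rw [ballVol_eq d hs0]; exact mul_pos (unitBallVol_pos d) (pow_pos hs0 d)
  set h := genHarmonic (((d : ℝ) - 1) / 2)
  set κ := interactionStrength v s
  set α := unitBallVol (d - 1) * d with hα_def
  set ρ₀ := profileMinimizer α h κ
  have hρ₀ : 0 < ρ₀ := profileMinimizer_pos α h κ
  have hE : ∀ {a}, 0 < a → limitEnergy (kernelOne d) (latticeBalls (a • v) (a * s)) =
      ballVol d s * energyProfile α h κ (a * s) := fun ha =>
    limitEnergy_dilation hd hv hcell hs h1 ha
  have hval : -(2 * unitBallVol (d - 1) * d * Real.exp (-(1 / 2) * h)) *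
        ballVol d s * Real.exp (-(κ / α)) = ballVol d s * energyProfile α h κ ρ₀ := by
    rw [energyProfile_profileMinimizer hα, hα_def]; ring
  have ha₀ : 0 < ρ₀ / s := by positivity
  have has : ρ₀ / s * s = ρ₀ := div_mul_cancel₀ _ hs0.ne'
  have hconf : IsConfig v (ballVol d s) (ρ₀ / s) ρ₀ :=
    (isConfig_iff hd hcell hs0).2 ⟨ha₀, has.symm, hs⟩
  have hE₀ : limitEnergy (kernelOne d) (latticeBalls ((ρ₀ / s) • v) ρ₀) =
      ballVol d s * energyProfile α h κ ρ₀ := by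
    have := hE ha₀
    rwa [has] at this
  have hleast : IsLeast (dilationEnergies v (ballVol d s))
      (ballVol d s * energyProfile α h κ ρ₀) := by
    refine ⟨⟨ρ₀ / s, ρ₀, hconf, hE₀.symm⟩, ?_⟩
    rintro _ ⟨a, ρ, hc, rfl⟩
    obtain ⟨ha, rfl, -⟩ := (isConfig_iff hd hcell hs0).1 hc
    rw [hE ha]
    exact mul_le_mul_of_nonneg_left (energyProfile_le hα h κ (by positivity)) hB.le
  refine ⟨hval ▸ hleast, fun ρ => ⟨?_, ?_⟩⟩
  · rintro ⟨a, hc, hl⟩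
    obtain ⟨ha, rfl, -⟩ := (isConfig_iff hd hcell hs0).1 hc
    by_contra hne
    have h2 := hl.unique hleast
    rw [hE ha] at h2
    exact (energyProfile_lt hα h κ (mul_pos ha hs0) hne).ne' (mul_left_cancel₀ hB.ne' h2)
  · rintro rfl
    exact ⟨ρ₀ / s, hconf, hE₀ ▸ hleast⟩

/-! ### Bounds on the interaction -/

lemma appellHTerm_mono (d : ℕ) {t t' : ℝ} (ht : 0 ≤ t) (htt : t ≤ t') (p : ℕ × ℕ) :
    appellHTerm d t p ≤ appellHTerm d t' p := by
  have h1 := pochhammer_pos (a := 3 / 2) (by norm_num) (p.1 + p.2)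
  have h2 := pochhammer_pos (a := ((d : ℝ) + 1) / 2) (by positivity) (p.1 + p.2)
  have h3 := pochhammer_pos (a := ((d : ℝ) + 2) / 2) (by positivity) p.1
  have h4 := pochhammer_pos (a := ((d : ℝ) + 2) / 2) (by positivity) p.2
  have h5 := ht.trans htt
  unfold appellHTerm appellF4Term
  gcongr

lemma appellH_nonneg (d : ℕ) {t : ℝ} (ht : 0 ≤ t) : 0 ≤ appellH d t :=
  tsum_nonneg (appellHTerm_nonneg d ht)

lemma appellH_mono (d : ℕ) {t t' : ℝ} (ht : 0 ≤ t) (htt : t ≤ t')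
    (hs : Summable (appellHTerm d t')) : appellH d t ≤ appellH d t' :=
  (hs.of_nonneg_of_le (appellHTerm_nonneg d ht) (appellHTerm_mono d ht htt)).tsum_le_tsum
    (appellHTerm_mono d ht htt) hs

lemma one_le_appellH (d : ℕ) {t : ℝ} (ht : 0 ≤ t) (hs : Summable (appellHTerm d t)) :
    1 ≤ appellH d t := by
  refine le_trans (le_of_eq ?_) (hs.le_tsum (0, 0) fun p _ => appellHTerm_nonneg d ht p)
  simp [appellHTerm, appellF4Term, pochhammer]

lemma zetaTerm_nonneg {d : ℕ} (v : Fin d → EuclideanSpace ℝ (Fin d)) (e : bravaisNonzero v) :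
    0 ≤ zetaTerm v e := by
  unfold zetaTerm; positivity

lemma latticeTerm_nonneg {d : ℕ} (v : Fin d → EuclideanSpace ℝ (Fin d)) (s : ℝ)
    (q : bravaisNonzero v) : 0 ≤ latticeTerm v s q :=
  div_nonneg (appellH_nonneg d (by positivity)) (by positivity)

lemma interactionStrength_nonneg {d : ℕ} (v : Fin d → EuclideanSpace ℝ (Fin d)) {s : ℝ}
    (hs : 0 ≤ s) : 0 ≤ interactionStrength v s :=
  mul_nonneg (mul_nonneg (unitBallVol_pos d).le (by positivity))
    (tsum_nonneg (latticeTerm_nonneg v s))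

lemma summable_zetaTerm {d : ℕ} (hd : 1 ≤ d) {v : Fin d → EuclideanSpace ℝ (Fin d)}
    (hv : LinearIndependent ℝ v) : Summable (zetaTerm v) ∧ Summable (appellHTerm d (1 / 16)) := by
  obtain ⟨q, hq, hmin⟩ := exists_min_norm hd hv
  have hq0 : 0 < ‖q‖ := norm_pos_iff.2 hq.2
  -- A quarter of the shortest length is admissible with a strict gap in every dimension. Comparison
  -- with its interaction sum, using `𝓗_d ≥ 1`, gives the lattice sum, and its largest argument of
  -- `𝓗_d` is `1/16`.
  have hfit : BallsFit v (‖q‖ / 4) :=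
    ballsFit_iff.2 ⟨by positivity, fun p hp => by linarith [hmin p hp]⟩
  obtain ⟨h1, h2, -⟩ := integral_neighbourOverlap_div hd hv hfit
    fun _ p hp => by linarith [hmin p hp]
  refine ⟨h2.of_nonneg_of_le (zetaTerm_nonneg v) fun p => ?_, ?_⟩
  · rw [zetaTerm, latticeTerm]
    gcongr
    exact one_le_appellH d (by positivity) (h1 p p.2)
  · have := h1 q hq
    rwa [div_pow, div_div_cancel_left' (by positivity), ← one_div,
      show (4 : ℝ) ^ 2 = 16 by norm_num] at this

/-- If `4s` is at most the shortest length, every argument of `𝓗_d` is at most `1/16`, and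
monotonicity replaces all values by one constant. -/
lemma interactionStrength_le {d : ℕ} (hd : 1 ≤ d) {v : Fin d → EuclideanSpace ℝ (Fin d)}
    (hv : LinearIndependent ℝ v) {s : ℝ} (hs : 0 ≤ s)
    (hmin : ∀ q ∈ bravaisNonzero v, 4 * s ≤ ‖q‖) :
    interactionStrength v s ≤
      unitBallVol d * s ^ (d + 1) * (appellH d (1 / 16) * ∑' e, zetaTerm v e) := by
  obtain ⟨hz, hH⟩ := summable_zetaTerm hd hv
  have hle : ∀ q : bravaisNonzero v, latticeTerm v s q ≤ appellH d (1 / 16) * zetaTerm v q := by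
    intro q
    rw [latticeTerm, zetaTerm, mul_one_div]
    gcongr
    refine appellH_mono d (by positivity) ?_ hH
    have h0 : 0 < ‖(q : EuclideanSpace ℝ (Fin d))‖ := norm_pos_iff.2 q.2.2
    have h4 := hmin q q.2
    rw [div_le_iff₀ (by positivity)]
    nlinarith
  have hz' := hz.mul_left (appellH d (1 / 16))
  rw [interactionStrength, ← tsum_mul_left (a := appellH d (1 / 16))]
  refine mul_le_mul_of_nonneg_left ?_ (mul_nonneg (unitBallVol_pos d).le (by positivity))
  exact (hz'.of_nonneg_of_le (latticeTerm_nonneg v s) hle).tsum_le_tsum hle hz'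

/-! ### The minimal energy at given volume fraction -/

/-- The radius of the ball of volume `lam`. -/
def volumeRadius (d : ℕ) (lam : ℝ) : ℝ := (lam / unitBallVol d) ^ (1 / (d : ℝ))

lemma volumeRadius_pos (d : ℕ) {lam : ℝ} (hlam : 0 < lam) : 0 < volumeRadius d lam :=
  Real.rpow_pos_of_pos (div_pos hlam (unitBallVol_pos d)) _

lemma ballVol_volumeRadius {d : ℕ} (hd : 1 ≤ d) {lam : ℝ} (hlam : 0 < lam) :
    ballVol d (volumeRadius d lam) = lam := by
  have hu := unitBallVol_pos d
  have hd0 : (d : ℝ) ≠ 0 := by positivity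
  rw [ballVol_eq d (volumeRadius_pos d hlam), volumeRadius, ← Real.rpow_natCast,
    ← Real.rpow_mul (by positivity), one_div_mul_cancel hd0, Real.rpow_one]
  field_simp

lemma tendsto_volumeRadius {d : ℕ} (hd : 1 ≤ d) :
    Tendsto (volumeRadius d) (𝓝[>] 0) (𝓝 0) := by
  have h : ContinuousAt (volumeRadius d) 0 := by
    unfold volumeRadius
    exact (continuousAt_id.div_const _).rpow_const (Or.inr (by positivity))
  have h2 := h.tendsto
  have hd0 : (1 / (d : ℝ)) ≠ 0 := by positivity
  rw [show volumeRadius d 0 = 0 by rw [volumeRadius, zero_div, Real.zero_rpow hd0]] at h2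
  exact h2.mono_left nhdsWithin_le_nhds

lemma rpow_two_add_one_div {d : ℕ} (hd : 1 ≤ d) {lam : ℝ} (hlam : 0 < lam) :
    lam ^ (2 + 1 / (d : ℝ)) =
      lam * (unitBallVol d * unitBallVol d ^ (1 / (d : ℝ)) * volumeRadius d lam ^ (d + 1)) := by
  have hu := unitBallVol_pos d
  have h1 : lam = unitBallVol d * volumeRadius d lam ^ d := by
    rw [← ballVol_eq d (volumeRadius_pos d hlam), ballVol_volumeRadius hd hlam]
  have h2 : lam ^ (1 / (d : ℝ)) = unitBallVol d ^ (1 / (d : ℝ)) * volumeRadius d lam := by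
    rw [volumeRadius, ← Real.mul_rpow hu.le (by positivity)]
    congr 1
    field_simp
  rw [Real.rpow_add hlam, h2, Real.rpow_two, sq]
  conv_lhs => rw [mul_assoc]; enter [2, 1]; rw [h1]
  ring

lemma ballVol_le_ballVol_iff {d : ℕ} (hd : 1 ≤ d) {r s : ℝ} (hr : 0 < r) (hs : 0 < s) :
    ballVol d r ≤ ballVol d s ↔ r ≤ s := by
  rw [ballVol_eq d hr, ballVol_eq d hs, mul_le_mul_iff_right₀ (unitBallVol_pos d),
    pow_le_pow_iff_left₀ hr.le hs.le (by omega)]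

/-- A constant for the error estimate of the minimal energy. -/
def energyErrorConst (d : ℕ) : ℝ :=
  2 * Real.exp (-(1 / 2) * genHarmonic (((d : ℝ) - 1) / 2)) *
    (unitBallVol d * appellH d (1 / 16) + unitBallVol (d - 1) * d * 4 ^ (d + 1)) /
      (unitBallVol d * unitBallVol d ^ (1 / (d : ℝ)))

lemma one_sub_exp_neg_le {x : ℝ} (hx : 0 ≤ x) :
    0 ≤ 1 - Real.exp (-x) ∧ 1 - Real.exp (-x) ≤ x ∧ 1 - Real.exp (-x) ≤ 1 := by
  have h1 := Real.add_one_le_exp (-x)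
  have h2 := Real.exp_pos (-x)
  have h3 : Real.exp (-x) ≤ 1 := Real.exp_le_one_iff.2 (by linarith)
  exact ⟨by linarith, by linarith, by linarith⟩

/-- The error estimate, in terms of the relative error `η` of the leading term. -/
lemma energy_error_le {d : ℕ} (hd : 1 ≤ d) {v : Fin d → EuclideanSpace ℝ (Fin d)}
    (hv : LinearIndependent ℝ v) {lam η : ℝ} (hlam : 0 < lam) (hη : η ≤ 1)
    (hηle : (∀ q ∈ bravaisNonzero v, 4 * volumeRadius d lam ≤ ‖q‖) →
      η ≤ interactionStrength v (volumeRadius d lam) / (unitBallVol (d - 1) * d)) :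
    2 * unitBallVol (d - 1) * d * Real.exp (-(1 / 2) * genHarmonic (((d : ℝ) - 1) / 2)) *
        lam * η ≤
      (∑' e : bravaisNonzero v, zetaTerm v e) * (energyErrorConst d * lam ^ (2 + 1 / (d : ℝ))) := by
  have hu := unitBallVol_pos d
  have hα : 0 < unitBallVol (d - 1) * d :=
    mul_pos (unitBallVol_pos _) (by exact_mod_cast hd)
  have hs0 := volumeRadius_pos d hlam
  have hz := (summable_zetaTerm hd hv).1
  have hZ : 0 ≤ ∑' e : bravaisNonzero v, zetaTerm v e := tsum_nonneg (zetaTerm_nonneg v)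
  have hH : 0 ≤ appellH d (1 / 16) := appellH_nonneg d (by norm_num)
  have hbound : unitBallVol (d - 1) * d * η ≤
      (unitBallVol d * appellH d (1 / 16) + unitBallVol (d - 1) * d * 4 ^ (d + 1)) *
        (volumeRadius d lam ^ (d + 1) * ∑' e : bravaisNonzero v, zetaTerm v e) := by
    set s := volumeRadius d lam
    set Z := ∑' e : bravaisNonzero v, zetaTerm v e
    set α := unitBallVol (d - 1) * d
    -- Small balls use the bound on the interaction. Otherwise some `‖q‖ < 4s`, whose single term
    -- already gives `4^{d+1} s^{d+1} Z ≥ 1`, and `η ≤ 1` suffices.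
    by_cases h4 : ∀ q ∈ bravaisNonzero v, 4 * s ≤ ‖q‖
    · have h5 := hηle h4
      rw [le_div_iff₀ hα] at h5
      have h6 := interactionStrength_le hd hv hs0.le h4
      have h7 : 0 ≤ α * 4 ^ (d + 1) * (s ^ (d + 1) * Z) := by positivity
      linarith
    · push Not at h4
      obtain ⟨q, hq, hqs⟩ := h4
      have hq0 : 0 < ‖q‖ := norm_pos_iff.2 hq.2
      have h5 : 1 / ‖q‖ ^ (d + 1) ≤ Z := hz.le_tsum ⟨q, hq⟩ fun e _ => zetaTerm_nonneg v e
      have h6 : 1 ≤ 4 ^ (d + 1) * (s ^ (d + 1) * Z) := by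
        calc (1 : ℝ) ≤ (4 * s / ‖q‖) ^ (d + 1) := one_le_pow₀ ((one_le_div hq0).2 hqs.le)
          _ = 4 ^ (d + 1) * (s ^ (d + 1) * (1 / ‖q‖ ^ (d + 1))) := by
            rw [div_pow, mul_pow]; ring
          _ ≤ _ := by gcongr
      have h7 : 0 ≤ unitBallVol d * appellH d (1 / 16) * (s ^ (d + 1) * Z) := by positivity
      nlinarith
  rw [rpow_two_add_one_div hd hlam, energyErrorConst]
  generalize genHarmonic (((d : ℝ) - 1) / 2) = h
  have hw : 0 < unitBallVol d * unitBallVol d ^ (1 / (d : ℝ)) := by positivity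
  generalize unitBallVol d * unitBallVol d ^ (1 / (d : ℝ)) = W at *
  have := mul_le_mul_of_nonneg_left hbound
    (show 0 ≤ 2 * Real.exp (-(1 / 2) * h) * lam by positivity)
  refine le_trans (le_of_eq (by ring)) (this.trans (le_of_eq ?_))
  field_simp

/-- The minimum is the leading term times `1 - η`, with `η = 1 - e^{-κ/α}` in general and `η = 1`
for touching intervals, whose energy is zero at every scale. -/
lemma eBall_facts {d : ℕ} (hd : 1 ≤ d) {v : Fin d → EuclideanSpace ℝ (Fin d)}
    (hv : LinearIndependent ℝ v) (hcell : cellVol v = 1) {lam : ℝ} (hlam : 0 < lam)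
    (hfit : BallsFit v (volumeRadius d lam)) :
    IsLeast (dilationEnergies v lam) (eBall v lam) ∧
      |eBall v lam - (-(2 * unitBallVol (d - 1) * d *
          Real.exp (-(1 / 2) * genHarmonic (((d : ℝ) - 1) / 2))) * lam)| ≤
        (∑' e : bravaisNonzero v, zetaTerm v e) *
          (energyErrorConst d * lam ^ (2 + 1 / (d : ℝ))) := by
  have hs0 := volumeRadius_pos d hlam
  have hB := ballVol_volumeRadius hd hlam
  have hα : 0 < unitBallVol (d - 1) * d :=
    mul_pos (unitBallVol_pos _) (by exact_mod_cast hd)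
  have hκ := interactionStrength_nonneg v hs0.le
  suffices h : ∃ η : ℝ, 0 ≤ η ∧ η ≤ 1 ∧ ((∀ q ∈ bravaisNonzero v, 4 * volumeRadius d lam ≤ ‖q‖) →
      η ≤ interactionStrength v (volumeRadius d lam) / (unitBallVol (d - 1) * d)) ∧
      IsLeast (dilationEnergies v lam) (-(2 * unitBallVol (d - 1) * d *
          Real.exp (-(1 / 2) * genHarmonic (((d : ℝ) - 1) / 2))) * lam * (1 - η)) by
    obtain ⟨η, h0, h1, h2, h3⟩ := h
    have he : eBall v lam = _ := h3.csInf_eq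
    rw [he]
    refine ⟨h3, le_trans (le_of_eq ?_) (energy_error_le hd hv hlam h1 h2)⟩
    rw [← abs_of_nonneg (show 0 ≤ 2 * unitBallVol (d - 1) * d *
      Real.exp (-(1 / 2) * genHarmonic (((d : ℝ) - 1) / 2)) * lam * η by
        rw [mul_assoc 2]; positivity)]
    congr 1
    ring
  by_cases h1 : d = 1 → ∀ q ∈ bravaisNonzero v, 2 * volumeRadius d lam < ‖q‖
  · obtain ⟨g1, g2, g3⟩ := one_sub_exp_neg_le (div_nonneg hκ hα.le)
    refine ⟨_, g1, g3, fun _ => g2, ?_⟩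
    have := (isLeast_dilationEnergies hd hv hcell hfit h1).1
    rw [hB] at this
    rwa [sub_sub_cancel]
  · push Not at h1
    obtain ⟨rfl, q, hq, hq2⟩ := h1
    have hE : ∀ {a}, 0 < a →
        limitEnergy (kernelOne 1) (latticeBalls (a • v) (a * volumeRadius 1 lam)) = 0 := by
      intro a ha
      refine limitEnergy_latticeBalls_of_touching (linearIndependent_dilation hv ha)
        ((ballsFit_smul v ha _).2 hfit) ⟨_, (bravaisNonzeroSMul v ha ⟨q, hq⟩).2, ?_⟩ _
      rw [norm_bravaisNonzeroSMul]
      simp only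
      nlinarith
    -- The smallness condition cannot hold here: touching gives `‖q‖ ≤ 2s`, against `4s ≤ ‖q‖`.
    refine ⟨1, zero_le_one, le_rfl, fun h => ?_, ?_⟩
    · linarith [h q hq]
    · rw [sub_self, mul_zero]
      have hc : ∀ a ρ, IsConfig v lam a ρ ↔
          0 < a ∧ ρ = a * volumeRadius 1 lam ∧ BallsFit v (volumeRadius 1 lam) := by
        intro a ρ
        have := isConfig_iff le_rfl hcell hs0 (a := a) (ρ := ρ)
        rwa [hB] at this
      refine ⟨⟨1, 1 * volumeRadius 1 lam, (hc _ _).2 ⟨one_pos, rfl, hfit⟩, (hE one_pos).symm⟩, ?_⟩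
      rintro _ ⟨a, ρ, hconf, rfl⟩
      obtain ⟨ha, rfl, -⟩ := (hc _ _).1 hconf
      rw [hE ha]

lemma tendsto_profileMinimizer {d : ℕ} (hd : 1 ≤ d) {v : Fin d → EuclideanSpace ℝ (Fin d)}
    (hv : LinearIndependent ℝ v) (α h : ℝ) :
    Tendsto (fun lam => profileMinimizer α h (interactionStrength v (volumeRadius d lam)))
      (𝓝[>] 0) (𝓝 (1 / 2 * Real.exp (1 / 2 * h))) := by
  have hs := tendsto_volumeRadius hd
  obtain ⟨q, hq, hmin⟩ := exists_min_norm hd hv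
  have hq0 : 0 < ‖q‖ := norm_pos_iff.2 hq.2
  have hκ : Tendsto (fun lam => interactionStrength v (volumeRadius d lam)) (𝓝[>] 0) (𝓝 0) := by
    have hup : Tendsto (fun lam => unitBallVol d * volumeRadius d lam ^ (d + 1) *
        (appellH d (1 / 16) * ∑' e, zetaTerm v e)) (𝓝[>] 0) (𝓝 0) := by
      have := ((hs.pow (d + 1)).const_mul (unitBallVol d)).mul_const
        (appellH d (1 / 16) * ∑' e, zetaTerm v e)
      simpa using this
    refine squeeze_zero' ?_ ?_ hup
    · filter_upwards [self_mem_nhdsWithin] with lam hlam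
      exact interactionStrength_nonneg v (volumeRadius_pos d hlam).le
    · filter_upwards [self_mem_nhdsWithin,
        hs.eventually (gt_mem_nhds (show 0 < ‖q‖ / 4 by positivity))] with lam hlam hlt
      refine interactionStrength_le hd hv (volumeRadius_pos d hlam).le fun p hp => ?_
      linarith [hmin p hp]
  have h1 := ((Real.continuous_exp.tendsto _).comp (hκ.div_const α)).const_mul
    (1 / 2 * Real.exp (1 / 2 * h))
  simpa [profileMinimizer] using h1

end

/-! ### Assembly of the two statements -/

theorem lemma4p4 (d : ℕ) (hd : 1 ≤ d) :
    (∀ v : Fin d → EuclideanSpace ℝ (Fin d), LinearIndependent ℝ v →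
      ∀ ρ : ℝ, BallsFit v ρ →
        (∀ q ∈ bravais v, ∀ x, latticeBalls v ρ (x + q) = latticeBalls v ρ x) ∧
        EnergyWellDefined (kernelOne d) (latticeBalls v ρ) ∧
        ((d = 1 → ∀ p ∈ bravais v, ∀ q ∈ bravais v, p ≠ q → ρ < 1 / 2 * dist p q) →
          (∀ q ∈ bravaisNonzero v, Summable (appellHTerm d (ρ ^ 2 / ‖q‖ ^ 2))) ∧
          Summable (latticeTerm v ρ) ∧
          limitEnergy (kernelOne d) (latticeBalls v ρ) =
            -unitBallVol (d - 1) *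
                (Real.log (2 * ρ) + 1 - 1 / 2 * genHarmonic (((d : ℝ) - 1) / 2)) *
                (sphereArea d ρ / cellVol v) +
              latticeInteraction v ρ * ballVol d ρ ^ 2)) ∧
    (∃ C : ℝ, ∀ v : Fin d → EuclideanSpace ℝ (Fin d), LinearIndependent ℝ v → cellVol v = 1 →
      Summable (zetaTerm v) ∧
      ∃ lam₀ : ℝ, IsGreatest (volumeFractions v) lam₀ ∧
        (∀ lam : ℝ, 0 < lam → lam ≤ lam₀ →
          IsLeast (dilationEnergies v lam) (eBall v lam) ∧
          |eBall v lam - (-(2 * unitBallVol (d - 1) * d *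
              Real.exp (-(1 / 2) * genHarmonic (((d : ℝ) - 1) / 2))) * lam)| ≤
            (∑' e : bravaisNonzero v, zetaTerm v e) * (C * lam ^ (2 + 1 / (d : ℝ)))) ∧
        ∃ ρopt : ℝ → ℝ,
          (∀ lam : ℝ, 0 < lam → lam < lam₀ → ∀ ρ : ℝ, IsOptimalRadius v lam ρ ↔ ρ = ρopt lam) ∧
          Tendsto ρopt (𝓝[>] 0)
            (𝓝 (1 / 2 * Real.exp (1 / 2 * genHarmonic (((d : ℝ) - 1) / 2))))) := by
  refine ⟨fun v hv ρ hρ => ⟨fun q hq x => latticeBalls_add v ρ hq x,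
    energyWellDefined_latticeBalls hd hv hρ, fun hstrict => ?_⟩,
    energyErrorConst d, fun v hv hcell => ⟨(summable_zetaTerm hd hv).1, ?_⟩⟩
  · have h1 : d = 1 → ∀ q ∈ bravaisNonzero v, 2 * ρ < ‖q‖ := by
      intro hd1 q hq
      have := hstrict hd1 q hq.1 0 (zero_mem _) hq.2
      rw [dist_zero_right] at this
      linarith
    obtain ⟨h2, h3, -⟩ := integral_neighbourOverlap_div hd hv hρ h1
    exact ⟨h2, h3, (limitEnergy_latticeBalls hd hv hρ h1).2⟩
  · obtain ⟨q, hq, hmin⟩ := exists_min_norm hd hv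
    have hq0 : 0 < ‖q‖ := norm_pos_iff.2 hq.2
    have hm0 : 0 < ‖q‖ / 2 := by positivity
    have hfit : ∀ s, BallsFit v s ↔ 0 < s ∧ s ≤ ‖q‖ / 2 := by
      intro s
      rw [ballsFit_iff]
      refine and_congr_right fun _ => ⟨fun h => by linarith [h q hq], fun h p hp => ?_⟩
      linarith [hmin p hp]
    -- The largest volume fraction belongs to the radius equal to half the length of a shortest
    -- vector `q`.
    refine ⟨ballVol d (‖q‖ / 2), ⟨⟨‖q‖ / 2, (hfit _).2 ⟨hm0, le_rfl⟩, by rw [hcell, div_one]⟩, ?_⟩,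
      fun lam hlam hle => eBall_facts hd hv hcell hlam ((hfit _).2 ⟨volumeRadius_pos d hlam, ?_⟩),
      fun lam => profileMinimizer (unitBallVol (d - 1) * d) (genHarmonic (((d : ℝ) - 1) / 2))
        (interactionStrength v (volumeRadius d lam)), fun lam hlam hlt => ?_,
      tendsto_profileMinimizer hd hv _ _⟩
    · rintro _ ⟨ρ, hρ, rfl⟩
      rw [hcell, div_one, ballVol_le_ballVol_iff hd hρ.1 hm0]
      exact ((hfit ρ).1 hρ).2
    · rwa [← ballVol_le_ballVol_iff hd (volumeRadius_pos d hlam) hm0, ballVol_volumeRadius hd hlam]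
    · have hs0 := volumeRadius_pos d hlam
      -- Strict inequality for the volume fraction excludes touching balls, which is what uniqueness
      -- on the line requires.
      have hslt : volumeRadius d lam < ‖q‖ / 2 := by
        rw [← not_le, ← ballVol_le_ballVol_iff hd hm0 hs0, ballVol_volumeRadius hd hlam]
        exact not_le.2 hlt
      have := (isLeast_dilationEnergies hd hv hcell ((hfit _).2 ⟨hs0, hslt.le⟩)
        fun _ p hp => by linarith [hmin p hp]).2
      rwa [ballVol_volumeRadius hd hlam] at this
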